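/- **Setting.** Let $L=\{L(B): B\in\mathcal B_b(\mathbb R^2)\}$ be a homogeneous Lévy basis on a probability space $(\Omega,\mathcal F,\mathbb P)$, indexed by the bounded Borel sets of $\mathbb R^2$, with characteristic triplet $(\gamma,b,\nu)$: here $\gamma\in\mathbb R$, $b\ge 0$, and $\nu$ is a Lévy measure ($\nu(\{0\})=0$, $\int(1\wedge x^2)\,\nu(dx)<\infty$); for disjoint sets $B_1,B_2,\dots\in\mathcal B_b(\mathbb R^2)$ the variables $L(B_i)$ are independent and, if $\bigcup_i B_i$ is bounded, $L(\bigcup_i B_i)=\sum_i L(B_i)$ almost surely (as a limit of partial sums); and $\mathbb E\,e^{izL(B)}=e^{\mathrm{Leb}(B)\psi(z)}$ for all $B\in\mathcal B_b(\mathbb R^2)$, $z\in\mathbb R$, where $$\psi(z)=i\gamma z-\tfrac12 b^2z^2+\int_{\mathbb R\setminus\{0\}}\bigl(e^{izx}-1-izx\mathbf 1_{|x|\le 1}\bigr)\,\nu(dx).$$ For a Borel set $B$ of finite Lebesgue measure, $L(B)$ denotes the limit in probability of $L(B\cap[-k,k]^2)$ as $k\to\infty$. The Lévy seed $L'$ is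 a random variable with $\mathbb E\,e^{izL'}=e^{\psi(z)}$; assume $\mathrm{Var}(L')=1$. Let $a:[0,\infty)\to[0,\infty)$ be non-increasing, continuous and integrable, and such that $A=\{(r,y): r\le 0,\ 0\le y\le a(-r)\}$ has positive Lebesgue measure. Let $X_t=L(A_t)$, with $A_t=A+(t,0)$, $t\in\mathbb R$, be the trawl process with trawl function $a$. Let $\Delta_n>0$ satisfy $\Delta_n\to0$ and $n\Delta_n\to\infty$ as $n\to\infty$. Put $\bar X_n=\frac1n\sum_{k=0}^{n-1}X_{k\Delta_n}$ and, for $l=0,\dots,n-1$ and $l\Delta_n\le t<(l+1)\Delta_n$, $$\hat a(t)=-\frac1{n\Delta_n}\sum_{k=l}^{n-1}\bigl(X_{(k-l)\Delta_n}-\bar X_n\bigr)\bigl(X_{(k+1)\Delta_n}-X_{k\Delta_n}\bigr).$$ For $g:\mathbb R\to\mathbb R$ set $$\Psi^n_t(g)=\Delta_n\sum_{l=0}^{\lfloor t/\Delta_n\rfloor-1}g(\hat a(l\Delta_n))\quad(0\le t\le(n-1)\Delta_n),\qquad \Psi_t(g)=\int_0^t g(a(s))\,ds .$$ **Theorem 1.**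 Let $g:\mathbb R\to\mathbb R$ be continuous and of polynomial growth of order $q\ge0$, i.e. $|g(x)|\le C(1+|x|^q)$ for all $x\in\mathbb R$ and some $C>0$, and suppose that $\mathbb E(|L'|^{2q\vee4})<\infty$. Then $\Psi^n(g)\to\Psi(g)$ uniformly on compacts in probability: for every $T>0$ and every $\varepsilon>0$, $$\lim_{n\to\infty}\mathbb P\Bigl(\sup_{0\le t\le T}\bigl|\Psi^n_t(g)-\Psi_t(g)\bigr|\ge\varepsilon\Bigr)=0 .$$ -/

import Mathlib

open MeasureTheory ProbabilityTheory Filter Topology Set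
open scoped ENNReal

noncomputable section

namespace Trawl

/-- A Lévy measure on `ℝ`: no mass at the origin and `∫ (1 ∧ x²) ν(dx) < ∞`. -/
def IsLevyMeasure (ν : Measure ℝ) : Prop :=
  ν {0} = 0 ∧ ∫⁻ x, ENNReal.ofReal (min 1 (x ^ 2)) ∂ν < ∞

/-- The characteristic exponent with triplet `(γ, b, ν)`:
`ψ(z) = iγz - b²z²/2 + ∫ (e^{izx} - 1 - izx 1_{|x| ≤ 1}) ν(dx)`. -/
def charExponent (γ b : ℝ) (ν : Measure ℝ) (z : ℝ) : ℂ :=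
  Complex.I * (γ * z : ℝ) - ((1 / 2 * b ^ 2 * z ^ 2 : ℝ) : ℂ) +
    ∫ x : ℝ, (Complex.exp (Complex.I * (z * x : ℝ)) - 1 -
      Complex.I * (z * x : ℝ) * (if |x| ≤ 1 then 1 else 0)) ∂ν

/-- `μ` is the infinitely divisible law with characteristic triplet `(γ, b, ν)`, i.e. the law of
the Lévy seed `L'` of a homogeneous Lévy basis with this triplet. -/
def IsSeedLaw (γ b : ℝ) (ν : Measure ℝ) (μ : Measure ℝ) : Prop :=
  IsProbabilityMeasure μ ∧ ∀ z : ℝ, charFun μ z = Complex.exp (charExponent γ b ν z)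

/-- `L` is a homogeneous Lévy basis on `ℝ²` with characteristic triplet `(γ, b, ν)`: a random
field indexed by the bounded Borel sets (its values at other sets play no role) that is an
independently scattered random measure with the infinitely divisible marginals given by the
triplet. The countable additivity is almost sure convergence of the partial sums; unconditional
summability would be too strong, it fails for Gaussian bases. -/
structure IsLevyBasis {Ω : Type*} [MeasurableSpace Ω] (P : Measure Ω) (γ b : ℝ) (ν : Measure ℝ)
    (L : Set (ℝ × ℝ) → Ω → ℝ) : Prop where
  nonneg : 0 ≤ b
  levyMeasure : IsLevyMeasure ν
  measurable : ∀ B, MeasurableSet B → Bornology.IsBounded B → Measurable (L B)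
  indep : ∀ B : ℕ → Set (ℝ × ℝ), (∀ i, MeasurableSet (B i)) →
    (∀ i, Bornology.IsBounded (B i)) → Pairwise (fun i j => Disjoint (B i) (B j)) →
    iIndepFun (fun i => L (B i)) P
  additive : ∀ B : ℕ → Set (ℝ × ℝ), (∀ i, MeasurableSet (B i)) →
    Bornology.IsBounded (⋃ i, B i) → Pairwise (fun i j => Disjoint (B i) (B j)) →
    ∀ᵐ ω ∂P, Tendsto (fun N : ℕ => ∑ i ∈ Finset.range N, L (B i) ω) atTop
      (𝓝 (L (⋃ i, B i) ω))
  charFun_eq : ∀ B, MeasurableSet B → Bornology.IsBounded B → ∀ z : ℝ,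
    charFun (P.map (L B)) z =
      Complex.exp (((volume B).toReal : ℂ) * charExponent γ b ν z)

/-- `Y` is (a version of) `L(B)` for a Borel set `B` of finite Lebesgue measure, possibly
unbounded: the limit in probability of `L(B ∩ [-k,k]²)`. For bounded `B` this says `Y = L(B)`
almost surely. -/
def IsLevyValue {Ω : Type*} [MeasurableSpace Ω] (P : Measure Ω) (L : Set (ℝ × ℝ) → Ω → ℝ)
    (B : Set (ℝ × ℝ)) (Y : Ω → ℝ) : Prop :=
  TendstoInMeasure P
    (fun k : ℕ => L (B ∩ Icc (-(k : ℝ)) k ×ˢ Icc (-(k : ℝ)) k)) atTop Y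

/-- The trawl set `A = {(r, y) : r ≤ 0, 0 ≤ y ≤ a(-r)}`. -/
def trawlSet (a : ℝ → ℝ) : Set (ℝ × ℝ) := {p | p.1 ≤ 0 ∧ 0 ≤ p.2 ∧ p.2 ≤ a (-p.1)}

/-- The translated trawl set `A_t = A + (t, 0)`. -/
def trawlSetAt (a : ℝ → ℝ) (t : ℝ) : Set (ℝ × ℝ) := (fun p => p + (t, 0)) '' trawlSet a

/-- `a : [0, ∞) → [0, ∞)` is non-increasing, continuous, integrable, and its trawl set has
positive Lebesgue measure. (Values at negative arguments play no role.) -/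
structure IsTrawlFunction (a : ℝ → ℝ) : Prop where
  nonneg : ∀ s, 0 ≤ s → 0 ≤ a s
  antitone : AntitoneOn a (Ici 0)
  continuous : ContinuousOn a (Ici 0)
  integrable : IntegrableOn a (Ici 0)
  nontrivial : 0 < volume (trawlSet a)

/-- `X_t = L(A_t)` for all `t`. -/
def IsTrawlProcess {Ω : Type*} [MeasurableSpace Ω] (P : Measure Ω) (L : Set (ℝ × ℝ) → Ω → ℝ)
    (a : ℝ → ℝ) (X : ℝ → Ω → ℝ) : Prop :=
  ∀ t : ℝ, IsLevyValue P L (trawlSetAt a t) (X t)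

/-- In-fill and long-span sampling: `Δₙ → 0` and `nΔₙ → ∞`. -/
structure IsInfillLongSpan (Δ : ℕ → ℝ) : Prop where
  pos : ∀ n, 0 < Δ n
  infill : Tendsto Δ atTop (𝓝 0)
  longSpan : Tendsto (fun n : ℕ => (n : ℝ) * Δ n) atTop atTop

variable {Ω : Type*}

/-- The sample mean `X̄ₙ = n⁻¹ ∑_{k=0}^{n-1} X_{kΔₙ}`. -/
def sampleMean (X : ℝ → Ω → ℝ) (Δ : ℕ → ℝ) (n : ℕ) (ω : Ω) : ℝ :=
  (1 / (n : ℝ)) * ∑ k ∈ Finset.range n, X (k * Δ n) ω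

/-- The estimator of the trawl function:
`â(t) = -(nΔₙ)⁻¹ ∑_{k=l}^{n-1} (X_{(k-l)Δₙ} - X̄ₙ) (X_{(k+1)Δₙ} - X_{kΔₙ})`
for `lΔₙ ≤ t < (l+1)Δₙ`, that is `l = ⌊t/Δₙ⌋`. -/
def aHat (X : ℝ → Ω → ℝ) (Δ : ℕ → ℝ) (n : ℕ) (t : ℝ) (ω : Ω) : ℝ :=
  -(1 / ((n : ℝ) * Δ n)) * ∑ k ∈ Finset.Ico ⌊t / Δ n⌋₊ n,
    (X (((k : ℝ) - (⌊t / Δ n⌋₊ : ℝ)) * Δ n) ω - sampleMean X Δ n ω) *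
      (X (((k : ℝ) + 1) * Δ n) ω - X ((k : ℝ) * Δ n) ω)

/-- `Ψⁿ_t(g) = Δₙ ∑_{l=0}^{⌊t/Δₙ⌋-1} g(â(lΔₙ))`. It is meant for `0 ≤ t ≤ (n-1)Δₙ`, which
contains any given compact interval `[0, T]` for all large `n`. -/
def PsiHat (X : ℝ → Ω → ℝ) (Δ : ℕ → ℝ) (g : ℝ → ℝ) (n : ℕ) (t : ℝ) (ω : Ω) : ℝ :=
  Δ n * ∑ l ∈ Finset.range ⌊t / Δ n⌋₊, g (aHat X Δ n (l * Δ n) ω)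

/-- `Ψ_t(g) = ∫₀ᵗ g(a(s)) ds`. -/
def Psi (a g : ℝ → ℝ) (t : ℝ) : ℝ := ∫ s in (0 : ℝ)..t, g (a s)

/-- Uniform convergence on compacts in probability: for all `T > 0`,
`sup_{0 ≤ t ≤ T} |Zⁿ_t - Z_t| → 0` in probability. -/
def TendstoUCP [MeasurableSpace Ω] (P : Measure Ω) (Z : ℕ → ℝ → Ω → ℝ) (Z' : ℝ → Ω → ℝ) : Prop :=
  ∀ T : ℝ, 0 < T → ∀ ε : ℝ≥0∞, 0 < ε →
    Tendsto (fun n => P {ω | ε ≤ ⨆ t ∈ Icc (0 : ℝ) T, edist (Z n t ω) (Z' t ω)}) atTop (𝓝 0)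

/-- Polynomial growth of order `q`. -/
def PolyGrowth (f : ℝ → ℝ) (q : ℝ) : Prop :=
  ∃ C : ℝ, 0 < C ∧ ∀ x, |f x| ≤ C * (1 + |x| ^ q)

end Trawl

end

namespace Trawl

/-! ### Moments of convolution semigroups -/

/-- The laws `μ t`, `t ≥ 0`, are probability measures with characteristic functions `exp (t ψ)`. -/
structure IsConvSemigroup (ψ : ℝ → ℂ) (μ : ℝ → Measure ℝ) : Prop where
  prob : ∀ t, 0 ≤ t → IsProbabilityMeasure (μ t)
  charFun_eq : ∀ t, 0 ≤ t → ∀ z, charFun (μ t) z = Complex.exp (t * ψ z)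

/-- The law of the difference of two independent variables with law `μ`. -/
noncomputable def symmetrization (μ : Measure ℝ) : Measure ℝ := μ ∗ μ.map (fun x => -1 * x)

theorem lintegral_symmetrization (μ : Measure ℝ) [IsProbabilityMeasure μ] {f : ℝ → ℝ≥0∞}
    (hf : Measurable f) : ∫⁻ x, f x ∂(symmetrization μ) = ∫⁻ x, ∫⁻ y, f (x - y) ∂μ ∂μ := by
  rw [symmetrization, Measure.lintegral_conv hf]
  refine lintegral_congr fun x => ?_
  rw [lintegral_map (by fun_prop) (by fun_prop)]
  simp [sub_eq_add_neg]

theorem IsConvSemigroup.conv {ψ : ℝ → ℂ} {μ : ℝ → Measure ℝ} (h : IsConvSemigroup ψ μ) {s t : ℝ}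
    (hs : 0 ≤ s) (ht : 0 ≤ t) : μ s ∗ μ t = μ (s + t) := by
  have := h.prob s hs
  have := h.prob t ht
  have := h.prob (s + t) (add_nonneg hs ht)
  refine Measure.ext_of_charFun (funext fun z => ?_)
  rw [charFun_conv, h.charFun_eq s hs, h.charFun_eq t ht, h.charFun_eq _ (add_nonneg hs ht),
    ← Complex.exp_add]
  congr 1
  push_cast
  ring

theorem IsConvSemigroup.symmetrization {ψ : ℝ → ℂ} {μ : ℝ → Measure ℝ}
    (h : IsConvSemigroup ψ μ) :
    IsConvSemigroup (fun z => ψ z + ψ (-z)) (fun t => symmetrization (μ t)) where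
  prob t ht := by
    have := h.prob t ht
    have : IsProbabilityMeasure ((μ t).map (fun x => -1 * x)) :=
      Measure.isProbabilityMeasure_map (by fun_prop)
    unfold Trawl.symmetrization
    infer_instance
  charFun_eq t ht z := by
    have := h.prob t ht
    have : IsProbabilityMeasure ((μ t).map (fun x => -1 * x)) :=
      Measure.isProbabilityMeasure_map (by fun_prop)
    rw [Trawl.symmetrization, charFun_conv, charFun_map_mul, h.charFun_eq t ht, h.charFun_eq t ht,
      ← Complex.exp_add]
    congr 1
    simp
    ring

theorem IsConvSemigroup.map_neg {ψ : ℝ → ℂ} {σ : ℝ → Measure ℝ} (h : IsConvSemigroup ψ σ)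
    (hψ : ∀ z, ψ (-z) = ψ z) {t : ℝ} (ht : 0 ≤ t) : (σ t).map (fun x => -1 * x) = σ t := by
  have := h.prob t ht
  have : IsProbabilityMeasure ((σ t).map (fun x => -1 * x)) :=
    Measure.isProbabilityMeasure_map (by fun_prop)
  refine Measure.ext_of_charFun (funext fun z => ?_)
  rw [charFun_map_mul, h.charFun_eq t ht, h.charFun_eq t ht]
  simp [hψ]

theorem two_mul_abs_rpow_add_le (x y : ℝ) {r : ℝ} (hr : 2 ≤ r) :
    2 * (|x| ^ r + |y| ^ r) ≤ |x + y| ^ r + |x - y| ^ r := by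
  have key : ∀ u : ℝ, |u| ^ r = (u ^ 2) ^ (r / 2) := fun u => by
    rw [← sq_abs, ← Real.rpow_natCast, ← Real.rpow_mul (abs_nonneg u)]
    congr 1
    push_cast
    ring
  simp only [key]
  have h1 := Real.add_rpow_le_rpow_add (sq_nonneg x) (sq_nonneg y) (by linarith : 1 ≤ r / 2)
  have h2 := (convexOn_rpow (by linarith : 1 ≤ r / 2)).2 (mem_Ici.2 (sq_nonneg (x + y)))
    (mem_Ici.2 (sq_nonneg (x - y))) (by norm_num : (0 : ℝ) ≤ 1 / 2) (by norm_num : (0 : ℝ) ≤ 1 / 2)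
    (by norm_num)
  have h3 : (1 / 2 : ℝ) • (x + y) ^ 2 + (1 / 2 : ℝ) • (x - y) ^ 2 = x ^ 2 + y ^ 2 := by
    simp only [smul_eq_mul]
    ring
  rw [h3] at h2
  simp only [smul_eq_mul] at h2
  linarith

theorem measurable_ofReal_abs_rpow (r : ℝ) :
    Measurable fun x : ℝ => ENNReal.ofReal (|x| ^ r) := by
  fun_prop

/-- Absolute moments of order `r ≥ 2` are superadditive along symmetric convolution semigroups. -/
theorem IsConvSemigroup.moment_superadditive {ψ : ℝ → ℂ} {σ : ℝ → Measure ℝ}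
    (h : IsConvSemigroup ψ σ) (hψ : ∀ z, ψ (-z) = ψ z) {r : ℝ} (hr : 2 ≤ r) {s t : ℝ}
    (hs : 0 ≤ s) (ht : 0 ≤ t) :
    ∫⁻ x, ENNReal.ofReal (|x| ^ r) ∂(σ s) + ∫⁻ x, ENNReal.ofReal (|x| ^ r) ∂(σ t) ≤
      ∫⁻ x, ENNReal.ofReal (|x| ^ r) ∂(σ (s + t)) := by
  have := h.prob s hs
  have := h.prob t ht
  have hm := measurable_ofReal_abs_rpow r
  have e1 : ∫⁻ x, ENNReal.ofReal (|x| ^ r) ∂(σ (s + t)) =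
      ∫⁻ x, ∫⁻ y, ENNReal.ofReal (|x + y| ^ r) ∂(σ t) ∂(σ s) := by
    rw [← h.conv hs ht, Measure.lintegral_conv hm]
  have e2 : ∫⁻ x, ENNReal.ofReal (|x| ^ r) ∂(σ (s + t)) =
      ∫⁻ x, ∫⁻ y, ENNReal.ofReal (|x - y| ^ r) ∂(σ t) ∂(σ s) := by
    rw [e1]
    refine lintegral_congr fun x => ?_
    conv_lhs => rw [← h.map_neg hψ ht]
    rw [lintegral_map (by fun_prop) (by fun_prop)]
    simp [sub_eq_add_neg]
  have e3 : 2 * (∫⁻ x, ENNReal.ofReal (|x| ^ r) ∂(σ s) + ∫⁻ x, ENNReal.ofReal (|x| ^ r) ∂(σ t)) =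
      ∫⁻ x, ∫⁻ y, 2 * (ENNReal.ofReal (|x| ^ r) + ENNReal.ofReal (|y| ^ r)) ∂(σ t) ∂(σ s) := by
    have hin : ∀ x, ∫⁻ y, 2 * (ENNReal.ofReal (|x| ^ r) + ENNReal.ofReal (|y| ^ r)) ∂(σ t) =
        2 * (ENNReal.ofReal (|x| ^ r) + ∫⁻ y, ENNReal.ofReal (|y| ^ r) ∂(σ t)) := fun x => by
      rw [lintegral_const_mul _ (by fun_prop), lintegral_add_left (by fun_prop)]
      simp
    simp_rw [hin]
    rw [lintegral_const_mul _ (by fun_prop), lintegral_add_left (by fun_prop)]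
    simp
  have e4 : 2 * ∫⁻ x, ENNReal.ofReal (|x| ^ r) ∂(σ (s + t)) =
      ∫⁻ x, ∫⁻ y, (ENNReal.ofReal (|x + y| ^ r) + ENNReal.ofReal (|x - y| ^ r)) ∂(σ t) ∂(σ s) := by
    rw [two_mul]
    nth_rewrite 1 [e1]
    rw [e2, ← lintegral_add_left]
    · refine lintegral_congr fun x => ?_
      rw [← lintegral_add_left (by fun_prop)]
    · refine Measurable.lintegral_prod_right ?_
      fun_prop
  have : 2 * (∫⁻ x, ENNReal.ofReal (|x| ^ r) ∂(σ s) + ∫⁻ x, ENNReal.ofReal (|x| ^ r) ∂(σ t)) ≤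
      2 * ∫⁻ x, ENNReal.ofReal (|x| ^ r) ∂(σ (s + t)) := by
    rw [e3, e4]
    refine lintegral_mono fun x => lintegral_mono fun y => ?_
    rw [← ENNReal.ofReal_add (by positivity) (by positivity),
      ← ENNReal.ofReal_add (by positivity) (by positivity),
      show (2 : ℝ≥0∞) = ENNReal.ofReal 2 by simp, ← ENNReal.ofReal_mul (by norm_num)]
    exact ENNReal.ofReal_le_ofReal (two_mul_abs_rpow_add_le x y hr)
  exact (ENNReal.mul_le_mul_iff_right (by norm_num) (by norm_num)).1 this

theorem IsConvSemigroup.moment_natCast_lt_top {ψ : ℝ → ℂ} {σ : ℝ → Measure ℝ}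
    (h : IsConvSemigroup ψ σ) {r : ℝ} (hr : 1 ≤ r)
    (h1 : ∫⁻ x, ENNReal.ofReal (|x| ^ r) ∂(σ 1) < ∞) (n : ℕ) :
    ∫⁻ x, ENNReal.ofReal (|x| ^ r) ∂(σ (n + 1)) < ∞ := by
  induction n with
  | zero => simpa using h1
  | succ n ih =>
    have := h.prob 1 zero_le_one
    have := h.prob (n + 1) (by positivity)
    have hm := measurable_ofReal_abs_rpow r
    push_cast
    rw [← h.conv (by positivity) zero_le_one, Measure.lintegral_conv hm]
    have hle : ∀ x y : ℝ, ENNReal.ofReal (|x + y| ^ r) ≤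
        2 ^ (r - 1) * (ENNReal.ofReal (|x| ^ r) + ENNReal.ofReal (|y| ^ r)) := fun x y => by
      have hr0 : 0 ≤ r := by linarith
      rw [← ENNReal.ofReal_rpow_of_nonneg (abs_nonneg _) hr0,
        ← ENNReal.ofReal_rpow_of_nonneg (abs_nonneg _) hr0,
        ← ENNReal.ofReal_rpow_of_nonneg (abs_nonneg _) hr0]
      refine le_trans (ENNReal.rpow_le_rpow ?_ hr0)
        (ENNReal.rpow_add_le_mul_rpow_add_rpow _ _ hr)
      rw [← ENNReal.ofReal_add (abs_nonneg _) (abs_nonneg _)]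
      exact ENNReal.ofReal_le_ofReal (abs_add_le x y)
    refine lt_of_le_of_lt (lintegral_mono fun x => lintegral_mono fun y => hle x y) ?_
    have hin : ∀ x, ∫⁻ y, 2 ^ (r - 1) * (ENNReal.ofReal (|x| ^ r) + ENNReal.ofReal (|y| ^ r))
        ∂(σ 1) = 2 ^ (r - 1) * (ENNReal.ofReal (|x| ^ r) +
          ∫⁻ y, ENNReal.ofReal (|y| ^ r) ∂(σ 1)) := fun x => by
      rw [lintegral_const_mul _ (by fun_prop), lintegral_add_left (by fun_prop)]
      simp
    simp_rw [hin]
    rw [lintegral_const_mul _ (by fun_prop), lintegral_add_left (by fun_prop)]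
    simp only [lintegral_const, measure_univ, mul_one]
    exact ENNReal.mul_lt_top (by simp [ENNReal.rpow_lt_top_of_nonneg, hr])
      (ENNReal.add_lt_top.2 ⟨ih, h1⟩)

theorem IsConvSemigroup.moment_le {ψ : ℝ → ℂ} {σ : ℝ → Measure ℝ}
    (h : IsConvSemigroup ψ σ) (hψ : ∀ z, ψ (-z) = ψ z) {r : ℝ} (hr : 2 ≤ r)
    (h1 : ∫⁻ x, ENNReal.ofReal (|x| ^ r) ∂(σ 1) < ∞) (V : ℝ) :
    ∃ C : ℝ, 0 ≤ C ∧ ∀ t, 0 ≤ t → t ≤ V →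
      ∫⁻ x, ENNReal.ofReal (|x| ^ r) ∂(σ t) ≤ ENNReal.ofReal (C * t) := by
  set f : ℝ → ℝ≥0∞ := fun t => ∫⁻ x, ENNReal.ofReal (|x| ^ r) ∂(σ t) with hf
  have hsup : ∀ s t, 0 ≤ s → 0 ≤ t → f s + f t ≤ f (s + t) := fun s t hs ht =>
    h.moment_superadditive hψ hr hs ht
  have hmono : ∀ s t, 0 ≤ s → s ≤ t → f s ≤ f t := fun s t hs hst => by
    have := hsup s (t - s) hs (by linarith)
    rw [add_sub_cancel] at this
    exact le_trans le_self_add this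
  have hmul : ∀ (n : ℕ) (t : ℝ), 0 ≤ t → n * f t ≤ f (n * t) := fun n t ht => by
    induction n with
    | zero => simp
    | succ n ih =>
      have := hsup (n * t) t (by positivity) ht
      push_cast
      rw [add_mul, one_mul, add_mul, one_mul]
      exact le_trans (by gcongr) this
  obtain ⟨n, hn⟩ := exists_nat_ge V
  set M : ℝ := (n : ℝ) + 1 with hM
  have hM1 : 1 ≤ M := by
    rw [hM]
    have : (0 : ℝ) ≤ n := n.cast_nonneg
    linarith
  have hfM : f M < ∞ := h.moment_natCast_lt_top (by linarith) h1 n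
  refine ⟨2 * (f M).toReal, by positivity, fun t ht0 htV => ?_⟩
  rcases ht0.eq_or_lt with rfl | ht
  · have h0 := hsup 0 0 le_rfl le_rfl
    have hfin : f 0 ≠ ∞ := ((hmono 0 M le_rfl (by linarith)).trans_lt hfM).ne
    rw [add_zero] at h0
    have : f 0 ≤ 0 := by
      have h2 : f 0 + f 0 ≤ f 0 + 0 := by simpa using h0
      exact (ENNReal.add_le_add_iff_left hfin).1 h2
    simpa using this
  · set N := ⌊M / t⌋₊ with hN
    have hMt : 1 ≤ M / t := by
      rw [le_div_iff₀ ht]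
      linarith
    have hN1 : 1 ≤ N := Nat.le_floor (by simpa using hMt)
    have hNt : (N : ℝ) * t ≤ M := by
      have := Nat.floor_le (by positivity : 0 ≤ M / t)
      rwa [le_div_iff₀ ht] at this
    have hNlow : M < 2 * (N * t) := by
      have h3 := Nat.lt_floor_add_one (M / t)
      rw [div_lt_iff₀ ht, ← hN] at h3
      have : (1 : ℝ) ≤ N := by exact_mod_cast hN1
      nlinarith
    have h4 : (N : ℝ≥0∞) * f t ≤ f M := (hmul N t ht0).trans (hmono _ _ (by positivity) hNt)
    have hft : f t ≠ ∞ := ((hmono t M ht0 (by linarith)).trans_lt hfM).ne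
    rw [ENNReal.le_ofReal_iff_toReal_le hft (by positivity)]
    have h5 : (N : ℝ) * (f t).toReal ≤ (f M).toReal := by
      have := ENNReal.toReal_mono hfM.ne h4
      simpa using this
    have h6 : (0 : ℝ) ≤ (f t).toReal := by positivity
    have h7 : (0 : ℝ) ≤ (f M).toReal := by positivity
    have h8 : (f t).toReal ≤ (f t).toReal * (2 * (N * t)) := by nlinarith
    nlinarith

theorem memLp_ofReal_iff {α : Type*} [MeasurableSpace α] {μ : Measure α} {f : α → ℝ}
    (hf : AEStronglyMeasurable f μ) {r : ℝ} (hr : 0 < r) :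
    MemLp f (ENNReal.ofReal r) μ ↔ ∫⁻ x, ENNReal.ofReal (|f x| ^ r) ∂μ < ∞ := by
  have h0 : ENNReal.ofReal r ≠ 0 := by simpa using hr
  have e : ∀ x, ENNReal.ofReal (|f x| ^ r) = ‖f x‖ₑ ^ r := fun x => by
    rw [← ENNReal.ofReal_rpow_of_nonneg (abs_nonneg _) hr.le, Real.enorm_eq_ofReal_abs]
  simp_rw [e]
  have := eLpNorm_lt_top_iff_lintegral_rpow_enorm_lt_top (f := f) (μ := μ) h0 ENNReal.ofReal_ne_top
  rw [ENNReal.toReal_ofReal hr.le] at this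
  exact ⟨fun h => this.1 h.2, fun h => ⟨hf, this.2 h⟩⟩

/-- Centred moments are dominated by the moments of the symmetrization. -/
theorem centered_moment_le (μ : Measure ℝ) [IsProbabilityMeasure μ] {r : ℝ} (hr : 1 ≤ r)
    (h : ∫⁻ x, ENNReal.ofReal (|x| ^ r) ∂(symmetrization μ) < ∞) :
    MemLp id (ENNReal.ofReal r) μ ∧
      ∫⁻ x, ENNReal.ofReal (|x - ∫ y, y ∂μ| ^ r) ∂μ ≤
        ∫⁻ x, ENNReal.ofReal (|x| ^ r) ∂(symmetrization μ) := by
  have hm := measurable_ofReal_abs_rpow r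
  have hr0 : 0 < r := by linarith
  rw [lintegral_symmetrization μ hm] at h ⊢
  have hmem : MemLp id (ENNReal.ofReal r) μ := by
    have hae := ae_lt_top (Measurable.lintegral_prod_right (by fun_prop)) h.ne
    obtain ⟨x, hx⟩ := hae.exists
    have : MemLp (fun y => x - y) (ENNReal.ofReal r) μ :=
      (memLp_ofReal_iff (by fun_prop) hr0).2 hx
    have h2 := (memLp_const (μ := μ) (p := ENNReal.ofReal r) x).sub this
    refine h2.congr_norm aestronglyMeasurable_id (ae_of_all _ fun y => ?_)
    simp
  refine ⟨hmem, lintegral_mono fun x => ?_⟩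
  have hx : MemLp (fun y => x - y) (ENNReal.ofReal r) μ :=
    (memLp_const (μ := μ) (p := ENNReal.ofReal r) x).sub hmem
  have h1 : (1 : ℝ≥0∞) ≤ ENNReal.ofReal r := by simpa using hr
  have hid : Integrable (fun y : ℝ => y) μ := hmem.integrable h1
  have h2 : |x - ∫ y, y ∂μ| = ‖∫ y, (x - y) ∂μ‖ := by
    rw [integral_sub (integrable_const x) hid]
    simp
  rw [h2, ← ENNReal.ofReal_rpow_of_nonneg (norm_nonneg _) hr0.le, ofReal_norm]
  have h3 : ‖∫ y, (x - y) ∂μ‖ₑ ≤ eLpNorm (fun y => x - y) (ENNReal.ofReal r) μ := by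
    refine (enorm_integral_le_lintegral_enorm _).trans ?_
    rw [← eLpNorm_one_eq_lintegral_enorm]
    exact eLpNorm_le_eLpNorm_of_exponent_le h1 hx.1
  refine (ENNReal.rpow_le_rpow h3 hr0.le).trans ?_
  rw [eLpNorm_eq_lintegral_rpow_enorm_toReal (by simpa using hr0) ENNReal.ofReal_ne_top,
    ENNReal.toReal_ofReal hr0.le, ← ENNReal.rpow_mul, one_div_mul_cancel hr0.ne', ENNReal.rpow_one]
  refine lintegral_mono fun y => ?_
  rw [Real.enorm_eq_ofReal_abs, ENNReal.ofReal_rpow_of_nonneg (abs_nonneg _) hr0.le]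

theorem symmetrization_moment_lt_top (μ : Measure ℝ) [IsProbabilityMeasure μ] {r : ℝ} (hr : 0 < r)
    (h : MemLp id (ENNReal.ofReal r) μ) :
    ∫⁻ x, ENNReal.ofReal (|x| ^ r) ∂(symmetrization μ) < ∞ := by
  have e : symmetrization μ = (μ.prod μ).map (fun p => p.1 - p.2) := by
    rw [symmetrization, Measure.conv]
    conv_lhs => rw [← Measure.map_id (μ := μ)]
    rw [Measure.map_map (by fun_prop) (by fun_prop), Measure.map_prod_map _ _ (by fun_prop) (by fun_prop),
      Measure.map_map (by fun_prop) (by fun_prop)]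
    congr 1
    ext p
    simp [sub_eq_add_neg]
  rw [e, lintegral_map (measurable_ofReal_abs_rpow r) (by fun_prop)]
  refine (memLp_ofReal_iff (by fun_prop) hr).1 ?_
  exact (h.comp_fst μ).sub (h.comp_snd μ)

end Trawl

namespace Trawl

/-! ### Linearity of the mean and of the variance -/

/-- An additive function on `[0, ∞)` that has no nonzero limit point at `0` is linear. -/
theorem eq_mul_of_additive {f : ℝ → ℝ} (hadd : ∀ s t, 0 ≤ s → 0 ≤ t → f (s + t) = f s + f t)
    (hlim : ∀ s : ℕ → ℝ, (∀ n, 0 ≤ s n) → Tendsto s atTop (𝓝 0) → ∀ d,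
      Tendsto (fun n => f (s n)) atTop (𝓝 d) → d = 0) {t : ℝ} (ht : 0 ≤ t) : f t = t * f 1 := by
  have h0 : f 0 = 0 := by
    have := hadd 0 0 le_rfl le_rfl
    rw [add_zero] at this
    linarith
  have hmul : ∀ (n : ℕ) (t : ℝ), 0 ≤ t → f (n * t) = n * f t := fun n t ht => by
    induction n with
    | zero => simp [h0]
    | succ n ih =>
      push_cast
      rw [add_mul, one_mul, hadd _ _ (by positivity) ht, ih]
      ring
  set u : ℕ → ℝ := fun n => ((n + 1 : ℕ) * t - ⌊(n + 1 : ℕ) * t⌋₊) / (n + 1 : ℕ) with hu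
  have hfl : ∀ n : ℕ, (⌊(n + 1 : ℕ) * t⌋₊ : ℝ) ≤ (n + 1 : ℕ) * t := fun n =>
    Nat.floor_le (by positivity)
  have hu0 : ∀ n, 0 ≤ u n := fun n => div_nonneg (sub_nonneg.2 (hfl n)) (by positivity)
  have hulim : Tendsto u atTop (𝓝 0) := by
    refine squeeze_zero hu0 (fun n => ?_) tendsto_one_div_add_atTop_nhds_zero_nat
    have := Nat.lt_floor_add_one (((n + 1 : ℕ) : ℝ) * t)
    rw [hu]
    push_cast at this ⊢
    gcongr
    linarith
  have hfu : ∀ n, f (u n) = f t - (t - u n) * f 1 := fun n => by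
    have hn : ((n + 1 : ℕ) : ℝ) ≠ 0 := by positivity
    have h1 : ((n + 1 : ℕ) : ℝ) * u n = (n + 1 : ℕ) * t - ⌊(n + 1 : ℕ) * t⌋₊ := by
      rw [hu]
      field_simp
    have h2 := hmul (n + 1) (u n) (hu0 n)
    have h3 := hadd (((n + 1 : ℕ) : ℝ) * u n) (⌊((n + 1 : ℕ) : ℝ) * t⌋₊ * 1)
      (mul_nonneg (by positivity) (hu0 n)) (by positivity)
    rw [hmul _ 1 zero_le_one, h2, mul_one, h1, sub_add_cancel, hmul _ t ht] at h3
    have h4 : (⌊((n + 1 : ℕ) : ℝ) * t⌋₊ : ℝ) = (n + 1 : ℕ) * (t - u n) := by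
      rw [mul_sub, h1]
      ring
    rw [h4] at h3
    have h5 : ((n + 1 : ℕ) : ℝ) * f (u n) = (n + 1 : ℕ) * (f t - (t - u n) * f 1) := by
      linarith
    exact mul_left_cancel₀ hn h5
  have := hlim u hu0 hulim (f t - (t - 0) * f 1) (by
    simp_rw [hfu]
    exact tendsto_const_nhds.sub ((tendsto_const_nhds.sub hulim).mul_const _))
  simp only [sub_zero] at this
  linarith

theorem IsConvSemigroup.mean_add {ψ : ℝ → ℂ} {μ : ℝ → Measure ℝ} (h : IsConvSemigroup ψ μ)
    (h2 : ∀ t, 0 ≤ t → MemLp id 2 (μ t)) {s t : ℝ} (hs : 0 ≤ s) (ht : 0 ≤ t) :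
    ∫ x, x ∂(μ (s + t)) = ∫ x, x ∂(μ s) + ∫ x, x ∂(μ t) := by
  have := h.prob s hs
  have := h.prob t ht
  have hi : ∀ t, 0 ≤ t → Integrable (fun x : ℝ => x) (μ t) := fun t ht => by
    have := h.prob t ht
    exact (h2 t ht).integrable (by norm_num)
  rw [← h.conv hs ht, Measure.conv, integral_map (by fun_prop) (by fun_prop),
    integral_add ((hi s hs).comp_fst _) ((hi t ht).comp_snd _), integral_fun_fst (fun x => x),
    integral_fun_snd (fun x => x)]
  simp

theorem IsConvSemigroup.variance_add {ψ : ℝ → ℂ} {μ : ℝ → Measure ℝ} (h : IsConvSemigroup ψ μ)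
    (h2 : ∀ t, 0 ≤ t → MemLp id 2 (μ t)) {s t : ℝ} (hs : 0 ≤ s) (ht : 0 ≤ t) :
    variance id (μ (s + t)) = variance id (μ s) + variance id (μ t) := by
  have := h.prob s hs
  have := h.prob t ht
  rw [← h.conv hs ht, Measure.conv, variance_id_map (by fun_prop)]
  have h3 := (indepFun_prod (μ := μ s) (ν := μ t) (X := id) (Y := id) measurable_id
    measurable_id).variance_add ((h2 s hs).comp_fst _) ((h2 t ht).comp_snd _)
  have e1 : variance (fun ω : ℝ × ℝ => id ω.1) ((μ s).prod (μ t)) = variance id (μ s) := by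
    conv_rhs => rw [← (measurePreserving_fst (μ := μ s) (ν := μ t)).map_eq]
    rw [variance_id_map (by fun_prop)]
    rfl
  have e2 : variance (fun ω : ℝ × ℝ => id ω.2) ((μ s).prod (μ t)) = variance id (μ t) := by
    conv_rhs => rw [← (measurePreserving_snd (μ := μ s) (ν := μ t)).map_eq]
    rw [variance_id_map (by fun_prop)]
    rfl
  rw [e1, e2] at h3
  exact h3

theorem IsConvSemigroup.variance_eq {ψ : ℝ → ℂ} {μ : ℝ → Measure ℝ} (h : IsConvSemigroup ψ μ)
    (h2 : ∀ t, 0 ≤ t → MemLp id 2 (μ t)) {C : ℝ}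
    (hC : ∀ t, 0 ≤ t → t ≤ 1 → variance id (μ t) ≤ C * t) {t : ℝ} (ht : 0 ≤ t) :
    variance id (μ t) = t * variance id (μ 1) := by
  refine eq_mul_of_additive (f := fun t => variance id (μ t))
    (fun s t hs ht => h.variance_add h2 hs ht) (fun s hs hs0 d hd => ?_) ht
  have h1 : Tendsto (fun n => C * s n) atTop (𝓝 0) := by simpa using hs0.const_mul C
  refine tendsto_nhds_unique hd (squeeze_zero' (Eventually.of_forall fun n => variance_nonneg _ _)
    ?_ h1)
  filter_upwards [hs0.eventually (ge_mem_nhds zero_lt_one)] with n hn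
  exact hC _ (hs n) hn

theorem norm_charFun_sub_le {μ : Measure ℝ} [IsProbabilityMeasure μ] (h2 : MemLp id 2 μ) (z : ℝ) :
    ‖charFun μ z - Complex.exp (z * (∫ x, x ∂μ : ℝ) * Complex.I)‖ ≤
      |z| * √(variance id μ) := by
  set e : ℝ := ∫ x, x ∂μ with he
  have hid : Integrable (fun x : ℝ => x) μ := h2.integrable (by norm_num)
  have hexp : ∀ c : ℝ, ∀ x : ℝ, ‖Complex.exp (c * x * Complex.I)‖ = 1 := fun c x => by
    rw [← Complex.ofReal_mul, Complex.norm_exp_ofReal_mul_I]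
  have h3 : charFun μ z - Complex.exp (z * e * Complex.I) =
      ∫ x : ℝ, (Complex.exp (z * x * Complex.I) - Complex.exp (z * e * Complex.I)) ∂μ := by
    rw [integral_sub, charFun_apply_real]
    · simp
    · refine Integrable.of_bound (by fun_prop) 1 (ae_of_all _ fun x => (hexp z x).le)
    · exact integrable_const _
  rw [h3]
  have h4 : ∀ x : ℝ, ‖Complex.exp (z * x * Complex.I) - Complex.exp (z * e * Complex.I)‖ ≤
      |z| * |x - e| := fun x => by
    have : Complex.exp (z * x * Complex.I) - Complex.exp (z * e * Complex.I) =
        Complex.exp (z * e * Complex.I) * (Complex.exp (Complex.I * ((z * (x - e) : ℝ) : ℂ)) - 1) := by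
      rw [mul_sub, ← Complex.exp_add, mul_one]
      congr 2
      push_cast
      ring
    rw [this, norm_mul, hexp, one_mul, ← abs_mul]
    exact Real.norm_exp_I_mul_ofReal_sub_one_le
  have hsub : MemLp (fun x : ℝ => x - e) 2 μ := h2.sub (memLp_const e)
  have hint : Integrable (fun x : ℝ => |x - e|) μ := (hid.sub (integrable_const e)).abs
  refine (norm_integral_le_of_norm_le (hint.const_mul |z|) (ae_of_all _ h4)).trans ?_
  rw [integral_const_mul]
  refine mul_le_mul_of_nonneg_left ?_ (abs_nonneg z)
  refine Real.le_sqrt_of_sq_le ?_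
  have h5 := variance_nonneg (fun x : ℝ => |x - e|) μ
  have h7 : MemLp (fun x : ℝ => |x - e|) 2 μ := hsub.abs
  rw [variance_eq_sub h7] at h5
  have h6 : variance id μ = ∫ x, ((fun x : ℝ => |x - e|) ^ 2) x ∂μ := by
    rw [variance_eq_integral aemeasurable_id]
    refine integral_congr_ae (ae_of_all _ fun x => ?_)
    simp [he]
  rw [h6]
  linarith

theorem IsConvSemigroup.mean_eq {ψ : ℝ → ℂ} {μ : ℝ → Measure ℝ} (h : IsConvSemigroup ψ μ)
    (h2 : ∀ t, 0 ≤ t → MemLp id 2 (μ t)) {v : ℝ}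
    (hv : ∀ t, 0 ≤ t → variance id (μ t) = t * v) {t : ℝ} (ht : 0 ≤ t) :
    ∫ x, x ∂(μ t) = t * ∫ x, x ∂(μ 1) := by
  refine eq_mul_of_additive (f := fun t => ∫ x, x ∂(μ t))
    (fun s t hs ht => h.mean_add h2 hs ht) (fun s hs hs0 d hd => ?_) ht
  by_contra hd0
  have hz : ∀ z : ℝ, Complex.exp (z * d * Complex.I) = 1 := fun z => by
    have l1 : Tendsto (fun n => Complex.exp (z * (∫ x, x ∂(μ (s n)) : ℝ) * Complex.I)) atTop
        (𝓝 (Complex.exp (z * d * Complex.I))) := by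
      refine (Complex.continuous_exp.tendsto _).comp ?_
      exact ((Complex.continuous_ofReal.tendsto d).comp hd).const_mul (z : ℂ) |>.mul_const _
    have l2 : Tendsto (fun n => charFun (μ (s n)) z) atTop (𝓝 1) := by
      have : Tendsto (fun n => Complex.exp (s n * ψ z)) atTop (𝓝 (Complex.exp ((0 : ℝ) * ψ z))) :=
        (Complex.continuous_exp.tendsto _).comp
          (((Complex.continuous_ofReal.tendsto 0).comp hs0).mul_const _)
      simp only [Complex.ofReal_zero, zero_mul, Complex.exp_zero] at this
      refine this.congr fun n => ?_
      rw [h.charFun_eq _ (hs n)]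
    have l3 : Tendsto (fun n => charFun (μ (s n)) z -
        Complex.exp (z * (∫ x, x ∂(μ (s n)) : ℝ) * Complex.I)) atTop (𝓝 0) := by
      refine squeeze_zero_norm (a := fun n => |z| * √(s n * v)) (fun n => ?_) ?_
      · have := h.prob _ (hs n)
        rw [← hv _ (hs n)]
        exact norm_charFun_sub_le (h2 _ (hs n)) z
      · have : Tendsto (fun n => |z| * √(s n * v)) atTop (𝓝 (|z| * √(0 * v))) :=
          ((Real.continuous_sqrt.tendsto _).comp (hs0.mul_const v)).const_mul _
        simpa using this
    have := tendsto_nhds_unique l3 (l2.sub l1)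
    exact (sub_eq_zero.1 this.symm).symm
  have h3 := hz (Real.pi / d)
  have h4 : (((Real.pi / d : ℝ) : ℂ) * (d : ℂ)) * Complex.I = Real.pi * Complex.I := by
    have : (d : ℂ) ≠ 0 := by exact_mod_cast hd0
    push_cast
    field_simp
  rw [h4, Complex.exp_pi_mul_I] at h3
  norm_num at h3

/-! ### The law of a Lévy basis -/

variable {Ω : Type*} [MeasurableSpace Ω] {P : Measure Ω}
  {γ b : ℝ} {ν : Measure ℝ} {L : Set (ℝ × ℝ) → Ω → ℝ}

/-- The law of the value of `L` at a set of measure `t`. -/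
noncomputable def marginalLaw (P : Measure Ω) (L : Set (ℝ × ℝ) → Ω → ℝ) (t : ℝ) : Measure ℝ :=
  P.map (L (Ioc 0 t ×ˢ Icc 0 1))

theorem IsLevyBasis.isConvSemigroup [IsProbabilityMeasure P] (hL : IsLevyBasis P γ b ν L) :
    IsConvSemigroup (charExponent γ b ν) (marginalLaw P L) where
  prob t _ := Measure.isProbabilityMeasure_map (hL.measurable _
    (measurableSet_Ioc.prod measurableSet_Icc)
    ((Metric.isBounded_Ioc 0 t).prod (Metric.isBounded_Icc 0 1))).aemeasurable
  charFun_eq t ht z := by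
    rw [marginalLaw, hL.charFun_eq _ (measurableSet_Ioc.prod measurableSet_Icc)
      ((Metric.isBounded_Ioc 0 t).prod (Metric.isBounded_Icc 0 1)), Measure.volume_eq_prod,
      Measure.prod_prod]
    simp [ht]

theorem IsLevyBasis.map_eq [IsProbabilityMeasure P] (hL : IsLevyBasis P γ b ν L) {B : Set (ℝ × ℝ)} (hB : MeasurableSet B)
    (hb : Bornology.IsBounded B) : P.map (L B) = marginalLaw P L (volume B).toReal := by
  have := hL.isConvSemigroup.prob (volume B).toReal ENNReal.toReal_nonneg
  have : IsProbabilityMeasure (P.map (L B)) :=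
    Measure.isProbabilityMeasure_map (hL.measurable B hB hb).aemeasurable
  refine Measure.ext_of_charFun (funext fun z => ?_)
  rw [hL.charFun_eq B hB hb, hL.isConvSemigroup.charFun_eq _ ENNReal.toReal_nonneg]

theorem IsLevyBasis.seed_eq [IsProbabilityMeasure P] (hL : IsLevyBasis P γ b ν L) {seed : Measure ℝ}
    (hseed : IsSeedLaw γ b ν seed) : marginalLaw P L 1 = seed := by
  have := hL.isConvSemigroup.prob 1 zero_le_one
  have := hseed.1
  refine Measure.ext_of_charFun (funext fun z => ?_)
  rw [hseed.2, hL.isConvSemigroup.charFun_eq _ zero_le_one]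
  simp

/-- The centred basis `L(B) - m Leb(B)`. -/
noncomputable def centered (L : Set (ℝ × ℝ) → Ω → ℝ) (m : ℝ) (B : Set (ℝ × ℝ)) (ω : Ω) : ℝ :=
  L B ω - m * (volume B).toReal

theorem IsLevyBasis.measurable_centered (hL : IsLevyBasis P γ b ν L) (m : ℝ) {B : Set (ℝ × ℝ)}
    (hB : MeasurableSet B) (hb : Bornology.IsBounded B) : Measurable (centered L m B) :=
  (hL.measurable B hB hb).sub_const _

/-- The moments of the centred basis. -/
structure HasMoments (P : Measure Ω) (L : Set (ℝ × ℝ) → Ω → ℝ) (m R : ℝ) : Prop where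
  memLp : ∀ B, MeasurableSet B → Bornology.IsBounded B →
    MemLp (centered L m B) (ENNReal.ofReal R) P
  mean : ∀ B, MeasurableSet B → Bornology.IsBounded B → ∫ ω, centered L m B ω ∂P = 0
  sq : ∀ B, MeasurableSet B → Bornology.IsBounded B →
    ∫ ω, centered L m B ω ^ 2 ∂P = (volume B).toReal
  moment_le : ∀ r, 2 ≤ r → r ≤ R → ∀ V, ∃ C, 0 ≤ C ∧ ∀ B, MeasurableSet B →
    Bornology.IsBounded B → (volume B).toReal ≤ V →
      ∫ ω, |centered L m B ω| ^ r ∂P ≤ C * (volume B).toReal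

theorem IsLevyBasis.exists_hasMoments [IsProbabilityMeasure P] (hL : IsLevyBasis P γ b ν L) {seed : Measure ℝ}
    (hseed : IsSeedLaw γ b ν seed) (hvar : variance id seed = 1) {R : ℝ} (hR : 2 ≤ R)
    (hmom : Integrable (fun x : ℝ => |x| ^ R) seed) : ∃ m, HasMoments P L m R := by
  have hS := hL.isConvSemigroup
  set μ := marginalLaw P L with hμ
  have hp := fun t (ht : 0 ≤ t) => hS.prob t ht
  have hid : MemLp id (ENNReal.ofReal R) (μ 1) := by
    rw [hμ, hL.seed_eq hseed, memLp_ofReal_iff aestronglyMeasurable_id (by linarith)]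
    exact hmom.lintegral_lt_top
  have hsymm : ∀ z, (fun z => charExponent γ b ν z + charExponent γ b ν (-z)) (-z) =
      (fun z => charExponent γ b ν z + charExponent γ b ν (-z)) z := fun z => by
    simp [add_comm]
  have hmain : ∀ r, 2 ≤ r → r ≤ R → ∀ V, ∃ C, 0 ≤ C ∧ ∀ t, 0 ≤ t → t ≤ V →
      MemLp id (ENNReal.ofReal r) (μ t) ∧
        ∫⁻ x, ENNReal.ofReal (|x - ∫ y, y ∂(μ t)| ^ r) ∂(μ t) ≤ ENNReal.ofReal (C * t) := by
    intro r hr hrR V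
    have := hp 1 zero_le_one
    obtain ⟨C, hC0, hC⟩ := hS.symmetrization.moment_le hsymm hr
      (symmetrization_moment_lt_top (μ 1) (by linarith)
        (hid.mono_exponent (ENNReal.ofReal_le_ofReal hrR))) V
    refine ⟨C, hC0, fun t ht htV => ?_⟩
    have := hp t ht
    obtain ⟨h1, h2⟩ := centered_moment_le (μ t) (by linarith : 1 ≤ r)
      ((hC t ht htV).trans_lt ENNReal.ofReal_lt_top)
    exact ⟨h1, h2.trans (hC t ht htV)⟩
  have hmem : ∀ r, 2 ≤ r → r ≤ R → ∀ t, 0 ≤ t → MemLp id (ENNReal.ofReal r) (μ t) :=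
    fun r hr hrR t ht => by
      obtain ⟨C, -, h⟩ := hmain r hr hrR t
      exact (h t ht le_rfl).1
  have h2 : ∀ t, 0 ≤ t → MemLp id 2 (μ t) := fun t ht => by
    simpa using hmem 2 le_rfl hR t ht
  obtain ⟨C, hC0, hC⟩ := hmain 2 le_rfl hR 1
  have hvle : ∀ t, 0 ≤ t → t ≤ 1 → variance id (μ t) ≤ C * t := fun t ht ht1 => by
    have h3 := (hC t ht ht1).2
    have := hp t ht
    rw [variance_eq_integral aemeasurable_id,
      integral_eq_lintegral_of_nonneg_ae (ae_of_all _ fun x => by positivity) (by fun_prop)]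
    refine ENNReal.toReal_le_of_le_ofReal (by positivity) (le_trans (le_of_eq ?_) h3)
    refine lintegral_congr fun x => ?_
    congr 1
    simp
  have hv : ∀ t, 0 ≤ t → variance id (μ t) = t * 1 := fun t ht => by
    rw [hS.variance_eq h2 hvle ht, hμ, hL.seed_eq hseed, hvar]
  have he := fun t (ht : 0 ≤ t) => hS.mean_eq h2 hv ht
  refine ⟨∫ x, x ∂(μ 1), ?_⟩
  set m := ∫ x, x ∂(μ 1) with hm
  have hc : ∀ B : Set (ℝ × ℝ), (volume B).toReal * m = m * (volume B).toReal := fun B => mul_comm _ _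
  constructor
  · intro B hB hb
    have := (memLp_map_measure_iff aestronglyMeasurable_id
      (hL.measurable B hB hb).aemeasurable).1
        (by rw [hL.map_eq hB hb]; exact hmem R hR le_rfl _ ENNReal.toReal_nonneg)
    exact this.sub (memLp_const _)
  · intro B hB hb
    have hLm := (hL.measurable B hB hb).aemeasurable (μ := P)
    have h3 : MemLp (fun ω => L B ω) 2 P := (memLp_map_measure_iff aestronglyMeasurable_id hLm).1
        (by rw [hL.map_eq hB hb]; exact h2 _ ENNReal.toReal_nonneg)
    have h4 : ∫ ω, L B ω ∂P = ∫ x, x ∂(P.map (L B)) := by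
      rw [integral_map hLm (by fun_prop)]
    unfold centered
    rw [integral_sub (h3.integrable (by norm_num)) (integrable_const _), h4, hL.map_eq hB hb,
      he _ ENNReal.toReal_nonneg]
    simp [hc]
  · intro B hB hb
    have hLm := (hL.measurable B hB hb).aemeasurable (μ := P)
    have h3 := hv (volume B).toReal ENNReal.toReal_nonneg
    rw [variance_eq_integral aemeasurable_id, mul_one] at h3
    simp only [id] at h3
    rw [he _ ENNReal.toReal_nonneg, hμ, ← hL.map_eq hB hb, integral_map hLm (by fun_prop), hc] at h3
    exact h3
  · intro r hr hrR V
    obtain ⟨C, hC0, hC⟩ := hmain r hr hrR V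
    refine ⟨C, hC0, fun B hB hb hV => ?_⟩
    have hLm := (hL.measurable B hB hb).aemeasurable (μ := P)
    have h3 := (hC _ ENNReal.toReal_nonneg hV).2
    rw [he _ ENNReal.toReal_nonneg, hμ, ← hL.map_eq hB hb,
      lintegral_map' (by fun_prop) hLm, hc] at h3
    have hcm : Measurable (fun ω => centered L m B ω) := hL.measurable_centered m hB hb
    have hcr : Measurable (fun ω => |centered L m B ω| ^ r) := by fun_prop
    rw [integral_eq_lintegral_of_nonneg_ae (ae_of_all _ fun x => by positivity)
      hcr.aestronglyMeasurable]
    exact ENNReal.toReal_le_of_le_ofReal (by positivity) h3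

/-! ### Additivity and independence -/

theorem IsLevyBasis.empty_ae_eq (hL : IsLevyBasis P γ b ν L) : L ∅ =ᵐ[P] 0 := by
  have h := hL.additive (fun _ => ∅) (fun _ => MeasurableSet.empty) (by simp)
    (fun i j _ => disjoint_bot_left)
  filter_upwards [h] with ω hω
  have h2 := (hω.comp (tendsto_add_atTop_nat 1)).sub hω
  simp only [iUnion_empty, sub_self] at h2
  refine tendsto_nhds_unique (f := fun _ : ℕ => L ∅ ω) tendsto_const_nhds (h2.congr fun n => ?_)
  simp
  ring

theorem IsLevyBasis.union_ae_eq (hL : IsLevyBasis P γ b ν L) {B C : Set (ℝ × ℝ)}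
    (hB : MeasurableSet B) (hC : MeasurableSet C) (hBb : Bornology.IsBounded B)
    (hCb : Bornology.IsBounded C) (hd : Disjoint B C) :
    L (B ∪ C) =ᵐ[P] fun ω => L B ω + L C ω := by
  set D : ℕ → Set (ℝ × ℝ) := fun i => if i = 0 then B else if i = 1 then C else ∅ with hD
  have hU : ⋃ i, D i = B ∪ C := by
    ext x
    simp only [mem_iUnion, mem_union]
    constructor
    · rintro ⟨i, hi⟩
      simp only [hD] at hi
      split_ifs at hi
      · exact Or.inl hi
      · exact Or.inr hi
      · exact hi.elim
    · rintro (h | h)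
      · exact ⟨0, by simpa [hD] using h⟩
      · exact ⟨1, by simpa [hD] using h⟩
  have h := hL.additive D (fun i => by simp only [hD]; split_ifs <;> simp [*])
    (by rw [hU]; exact hBb.union hCb) (fun i j hij => by
      simp only [hD]
      split_ifs with h1 h2 h3 h4 h5 <;> first
        | exact hd | exact hd.symm | (exfalso; omega) | simp)
  filter_upwards [h, hL.empty_ae_eq] with ω hω h0
  rw [hU] at hω
  refine tendsto_nhds_unique (hω.comp (tendsto_add_atTop_nat 2)) ?_
  refine tendsto_const_nhds.congr fun n => ?_
  simp only [Function.comp]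
  induction n with
  | zero => simp [hD, Finset.sum_range_succ]
  | succ n ih =>
    rw [show n + 1 + 2 = (n + 2) + 1 by ring, Finset.sum_range_succ, ← ih]
    simp [hD, h0]

theorem IsLevyBasis.centered_biUnion_ae_eq (hL : IsLevyBasis P γ b ν L) (m : ℝ) {ι : Type*}
    {C : ι → Set (ℝ × ℝ)} (hC : ∀ i, MeasurableSet (C i)) (hb : ∀ i, Bornology.IsBounded (C i))
    (hd : Pairwise (fun i j => Disjoint (C i) (C j))) (S : Finset ι) :
    centered L m (⋃ i ∈ S, C i) =ᵐ[P] fun ω => ∑ i ∈ S, centered L m (C i) ω := by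
  classical
  induction S using Finset.induction_on with
  | empty =>
    filter_upwards [hL.empty_ae_eq] with ω h0
    simp [centered, h0]
  | insert i S hi ih =>
    have hmS : MeasurableSet (⋃ j ∈ S, C j) := S.measurableSet_biUnion fun j _ => hC j
    have hbS : Bornology.IsBounded (⋃ j ∈ S, C j) :=
      (Bornology.isBounded_biUnion_finset S).2 fun j _ => hb j
    have hdS : Disjoint (C i) (⋃ j ∈ S, C j) := by
      rw [disjoint_iUnion₂_right]
      intro j hj
      exact hd fun h => hi (h ▸ hj)
    filter_upwards [ih, hL.union_ae_eq (hC i) hmS (hb i) hbS hdS] with ω h1 h2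
    rw [Finset.set_biUnion_insert, Finset.sum_insert hi, ← h1]
    simp only [centered]
    rw [h2, measure_union hdS hmS, ENNReal.toReal_add (hb i).measure_lt_top.ne
      hbS.measure_lt_top.ne]
    ring

theorem IsLevyBasis.iIndepFun_centered (hL : IsLevyBasis P γ b ν L) (m : ℝ) {ι : Type*}
    [Countable ι] {C : ι → Set (ℝ × ℝ)} (hC : ∀ i, MeasurableSet (C i))
    (hb : ∀ i, Bornology.IsBounded (C i)) (hd : Pairwise (fun i j => Disjoint (C i) (C j))) :
    iIndepFun (fun i => centered L m (C i)) P := by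
  obtain ⟨f, hf⟩ := exists_injective_nat ι
  set D : ℕ → Set (ℝ × ℝ) := fun n => ⋃ (i : ι) (_ : f i = n), C i with hD
  have hDf : ∀ i, D (f i) = C i := fun i => by
    ext x
    simp only [hD, mem_iUnion, exists_prop]
    constructor
    · rintro ⟨j, hj, hx⟩
      rwa [← hf hj]
    · exact fun hx => ⟨i, rfl, hx⟩
  have hcase : ∀ n, (∃ i, f i = n) ∨ D n = ∅ := fun n => by
    by_cases h : ∃ i, f i = n
    · exact Or.inl h
    · right
      ext x
      simp only [hD, mem_iUnion, exists_prop, mem_empty_iff_false, iff_false]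
      rintro ⟨i, hi, -⟩
      exact h ⟨i, hi⟩
  have h := hL.indep D
    (fun n => by
      rcases hcase n with ⟨i, rfl⟩ | h
      · rw [hDf]
        exact hC i
      · simp [h])
    (fun n => by
      rcases hcase n with ⟨i, rfl⟩ | h
      · rw [hDf]
        exact hb i
      · simp [h])
    (fun n k hnk => by
      rcases hcase n with ⟨i, rfl⟩ | h
      · rcases hcase k with ⟨j, rfl⟩ | h'
        · rw [hDf, hDf]
          exact hd fun hij => hnk (congrArg f hij)
        · simp [h']
      · simp [h])
  have h2 := h.precomp hf
  simp only [hDf] at h2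
  exact h2.comp (fun i x => x - m * (volume (C i)).toReal) fun i => by fun_prop

end Trawl

namespace Trawl

/-! ### A moment inequality for sums of martingale differences -/

theorem abs_add_rpow_le {p : ℝ} (hp : 2 ≤ p) (x y : ℝ) :
    |x + y| ^ p ≤ |x| ^ p + p * (|x| ^ (p - 2) * x) * y +
      (p ^ 2 + (p + 1) ^ p) * (|x| ^ (p - 2) * y ^ 2 + |y| ^ p) := by
  have hC : 1 ≤ (p + 1) ^ p := Real.one_le_rpow (by linarith) (by linarith)
  rcases eq_or_ne x 0 with rfl | hx
  · have h1 : (0 : ℝ) ≤ |(0 : ℝ)| ^ p := by positivity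
    have h2 : (0 : ℝ) ≤ |(0 : ℝ)| ^ (p - 2) * y ^ 2 := by positivity
    have h3 : 0 ≤ |y| ^ p := by positivity
    have h4 : 1 ≤ p ^ 2 + (p + 1) ^ p := by nlinarith
    rw [zero_add, mul_zero, mul_zero, zero_mul, add_zero]
    nlinarith
  have key : ∀ u : ℝ, |1 + u| ^ p ≤ 1 + p * u + (p ^ 2 + (p + 1) ^ p) * (u ^ 2 + |u| ^ p) := by
    intro u
    have hup : 0 ≤ |u| ^ p := by positivity
    rcases le_total (p * |u|) 1 with h | h
    · have h1 : |p * u| ≤ 1 := by rwa [abs_mul, abs_of_nonneg (by linarith : 0 ≤ p)]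
      have hu1 : |u| ≤ 1 := by nlinarith [abs_nonneg u]
      have h2 : 0 ≤ 1 + u := by linarith [neg_abs_le u]
      have h3 : |1 + u| ^ p ≤ Real.exp (p * u) := by
        rw [abs_of_nonneg h2, mul_comm, Real.exp_mul]
        refine Real.rpow_le_rpow h2 ?_ (by linarith)
        linarith [Real.add_one_le_exp u]
      have h4 := (abs_le.1 (Real.abs_exp_sub_one_sub_id_le h1)).2
      nlinarith [sq_nonneg u, mul_nonneg (by linarith : (0 : ℝ) ≤ (p + 1) ^ p) (sq_nonneg u),
        mul_nonneg (by positivity : 0 ≤ p ^ 2 + (p + 1) ^ p) hup]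
    · have h1 : |1 + u| ≤ (p + 1) * |u| := by
        calc |1 + u| ≤ |1| + |u| := abs_add_le _ _
          _ ≤ (p + 1) * |u| := by rw [abs_one]; linarith
      have h2 : |1 + u| ^ p ≤ (p + 1) ^ p * |u| ^ p := by
        rw [← Real.mul_rpow (by linarith) (abs_nonneg u)]
        exact Real.rpow_le_rpow (abs_nonneg _) h1 (by linarith)
      have h3 : -(p * u) ≤ p ^ 2 * u ^ 2 := by
        have : -(p * u) ≤ p * |u| := by nlinarith [neg_abs_le u]
        have h5 : p ^ 2 * u ^ 2 = (p * |u|) * (p * |u|) := by rw [← sq_abs u]; ring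
        rw [h5]
        nlinarith
      nlinarith [mul_nonneg (by linarith : (0 : ℝ) ≤ (p + 1) ^ p) (sq_nonneg u),
        mul_nonneg (sq_nonneg p) hup]
  have hxp : |x| ^ (p - 2) * x ^ 2 = |x| ^ p := by
    rw [← sq_abs x, ← Real.rpow_natCast, ← Real.rpow_add (abs_pos.2 hx)]
    norm_num
  obtain ⟨u, rfl⟩ : ∃ u, y = x * u := ⟨y / x, by field_simp⟩
  have e1 : |x + x * u| ^ p = |x| ^ p * |1 + u| ^ p := by
    rw [← Real.mul_rpow (abs_nonneg _) (abs_nonneg _), ← abs_mul]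
    ring_nf
  have e2 : |x * u| ^ p = |x| ^ p * |u| ^ p := by
    rw [abs_mul, Real.mul_rpow (abs_nonneg _) (abs_nonneg _)]
  have e3 : |x| ^ p + p * (|x| ^ (p - 2) * x) * (x * u) +
      (p ^ 2 + (p + 1) ^ p) * (|x| ^ (p - 2) * (x * u) ^ 2 + |x * u| ^ p) =
      |x| ^ p * (1 + p * u + (p ^ 2 + (p + 1) ^ p) * (u ^ 2 + |u| ^ p)) := by
    rw [e2, ← hxp]
    ring
  rw [e1, e3]
  exact mul_le_mul_of_nonneg_left (key u) (by positivity)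

theorem abs_rpow_sub_two_mul_sq {p : ℝ} (hp : 2 ≤ p) (x : ℝ) :
    |x| ^ (p - 2) * x ^ 2 = |x| ^ p := by
  rw [← sq_abs x, ← Real.rpow_natCast, ← Real.rpow_add_of_nonneg (abs_nonneg x) (by linarith)
    (by norm_num)]
  norm_num

theorem abs_rpow_mul_sq_le {p τ : ℝ} (hp : 2 ≤ p) (hτ : 0 < τ) (x z : ℝ) :
    |x| ^ (p - 2) * z ^ 2 ≤ |x| ^ p / τ + τ ^ (p / 2 - 1) * |z| ^ p := by
  rcases le_total (τ * z ^ 2) (x ^ 2) with h | h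
  · have h1 : z ^ 2 ≤ x ^ 2 / τ := by rw [le_div_iff₀ hτ]; linarith
    have h2 : |x| ^ (p - 2) * z ^ 2 ≤ |x| ^ p / τ := by
      rw [← abs_rpow_sub_two_mul_sq hp x, mul_div_assoc]
      gcongr
    have h3 : 0 ≤ τ ^ (p / 2 - 1) * |z| ^ p := by positivity
    linarith
  · have e : ∀ w : ℝ, |w| ^ (p - 2) = (w ^ 2) ^ (p / 2 - 1) := fun w => by
      rw [← sq_abs, ← Real.rpow_natCast, ← Real.rpow_mul (abs_nonneg w)]
      congr 1
      push_cast
      ring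
    have h1 : |x| ^ (p - 2) ≤ τ ^ (p / 2 - 1) * |z| ^ (p - 2) := by
      rw [e, e, ← Real.mul_rpow hτ.le (sq_nonneg z)]
      exact Real.rpow_le_rpow (sq_nonneg x) h (by linarith)
    have h2 : 0 ≤ |x| ^ p / τ := by positivity
    have h3 : |x| ^ (p - 2) * z ^ 2 ≤ τ ^ (p / 2 - 1) * |z| ^ p := by
      rw [← abs_rpow_sub_two_mul_sq hp z, ← mul_assoc]
      gcongr
    linarith

variable {Ω : Type*} [MeasurableSpace Ω] {P : Measure Ω}

theorem memLp_iff_integrable_abs_rpow {f : Ω → ℝ} (hf : AEStronglyMeasurable f P) {p : ℝ}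
    (hp : 0 < p) : MemLp f (ENNReal.ofReal p) P ↔ Integrable (fun ω => |f ω| ^ p) P := by
  have := integrable_norm_rpow_iff hf (p := ENNReal.ofReal p) (by simpa using hp)
    ENNReal.ofReal_ne_top
  rw [ENNReal.toReal_ofReal hp.le] at this
  exact this.symm

theorem integrable_abs_rpow_of_memLp {f : Ω → ℝ} {p : ℝ} (hp : 0 < p)
    (hf : MemLp f (ENNReal.ofReal p) P) : Integrable (fun ω => |f ω| ^ p) P :=
  (memLp_iff_integrable_abs_rpow hf.1 hp).1 hf

theorem integral_abs_add_mul_rpow_le [IsProbabilityMeasure P] {p τ : ℝ} (hp : 2 ≤ p) (hτ : 0 < τ)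
    {M Z J : Ω → ℝ} (hM : MemLp M (ENNReal.ofReal p) P) (hZ : MemLp Z (ENNReal.ofReal p) P)
    (hJ : MemLp J (ENNReal.ofReal p) P) (hind : IndepFun (fun ω => (M ω, Z ω)) J P)
    (hJ0 : ∫ ω, J ω ∂P = 0) :
    MemLp (fun ω => M ω + Z ω * J ω) (ENNReal.ofReal p) P ∧
    ∫ ω, |M ω + Z ω * J ω| ^ p ∂P ≤ ∫ ω, |M ω| ^ p ∂P + (p ^ 2 + (p + 1) ^ p) *
      (((∫ ω, |M ω| ^ p ∂P) / τ + τ ^ (p / 2 - 1) * ∫ ω, |Z ω| ^ p ∂P) * ∫ ω, J ω ^ 2 ∂P +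
        (∫ ω, |Z ω| ^ p ∂P) * ∫ ω, |J ω| ^ p ∂P) := by
  have hp0 : 0 < p := by linarith
  have iM := integrable_abs_rpow_of_memLp hp0 hM
  have iZ := integrable_abs_rpow_of_memLp hp0 hZ
  have iJ := integrable_abs_rpow_of_memLp hp0 hJ
  have h2p : (2 : ℝ≥0∞) ≤ ENNReal.ofReal p := by
    rw [show (2 : ℝ≥0∞) = ENNReal.ofReal 2 by simp]
    exact ENNReal.ofReal_le_ofReal hp
  have iJ1 : Integrable J P := hJ.integrable (le_trans (by norm_num) h2p)
  have iJ2 : Integrable (fun ω => J ω ^ 2) P := (hJ.mono_exponent h2p).integrable_sq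
  have aM := hM.1.aemeasurable
  have aZ := hZ.1.aemeasurable
  have iH : Integrable (fun ω => |M ω| ^ (p - 2) * Z ω ^ 2) P := by
    refine Integrable.mono' ((iM.div_const τ).add (iZ.const_mul (τ ^ (p / 2 - 1)))) ?_
      (ae_of_all _ fun ω => ?_)
    · have : AEMeasurable (fun ω => |M ω| ^ (p - 2) * Z ω ^ 2) P := by fun_prop
      exact this.aestronglyMeasurable
    · rw [Real.norm_of_nonneg (by positivity)]
      exact abs_rpow_mul_sq_le hp hτ _ _
  have iG : Integrable (fun ω => |M ω| ^ (p - 2) * M ω * Z ω) P := by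
    refine Integrable.mono' (iM.add iH) ?_ (ae_of_all _ fun ω => ?_)
    · have : AEMeasurable (fun ω => |M ω| ^ (p - 2) * M ω * Z ω) P := by fun_prop
      exact this.aestronglyMeasurable
    · have h0 : 0 ≤ |M ω| ^ (p - 2) := by positivity
      have h1 : |M ω * Z ω| ≤ M ω ^ 2 + Z ω ^ 2 := by
        rw [abs_le]
        constructor <;> nlinarith [sq_nonneg (M ω + Z ω), sq_nonneg (M ω - Z ω)]
      rw [Real.norm_eq_abs, mul_assoc, abs_mul, abs_of_nonneg h0]
      simp only [Pi.add_apply]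
      rw [← abs_rpow_sub_two_mul_sq hp (M ω), ← mul_add]
      gcongr
  have indG : IndepFun (fun ω => |M ω| ^ (p - 2) * M ω * Z ω) J P :=
    hind.comp (φ := fun q : ℝ × ℝ => |q.1| ^ (p - 2) * q.1 * q.2) (ψ := id) (by fun_prop)
      measurable_id
  have indH : IndepFun (fun ω => |M ω| ^ (p - 2) * Z ω ^ 2) (fun ω => J ω ^ 2) P :=
    hind.comp (φ := fun q : ℝ × ℝ => |q.1| ^ (p - 2) * q.2 ^ 2) (ψ := fun x => x ^ 2)
      (by fun_prop) (by fun_prop)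
  have indZ : IndepFun (fun ω => |Z ω| ^ p) (fun ω => |J ω| ^ p) P :=
    hind.comp (φ := fun q : ℝ × ℝ => |q.2| ^ p) (ψ := fun x => |x| ^ p)
      (by fun_prop) (by fun_prop)
  have iGJ : Integrable (fun ω => |M ω| ^ (p - 2) * M ω * Z ω * J ω) P :=
    indG.integrable_mul iG iJ1
  have iHJ : Integrable (fun ω => |M ω| ^ (p - 2) * Z ω ^ 2 * J ω ^ 2) P :=
    indH.integrable_mul iH iJ2
  have iZJ : Integrable (fun ω => |Z ω| ^ p * |J ω| ^ p) P := indZ.integrable_mul iZ iJ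
  have eGJ : ∫ ω, |M ω| ^ (p - 2) * M ω * Z ω * J ω ∂P = _ :=
    indG.integral_mul_eq_mul_integral iG.1 iJ1.1
  have eHJ : ∫ ω, |M ω| ^ (p - 2) * Z ω ^ 2 * J ω ^ 2 ∂P = _ :=
    indH.integral_mul_eq_mul_integral iH.1 iJ2.1
  have eZJ : ∫ ω, |Z ω| ^ p * |J ω| ^ p ∂P = _ := indZ.integral_mul_eq_mul_integral iZ.1 iJ.1
  rw [hJ0, mul_zero] at eGJ
  have mZJ : MemLp (fun ω => Z ω * J ω) (ENNReal.ofReal p) P := by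
    refine (memLp_iff_integrable_abs_rpow (hZ.1.mul hJ.1) hp0).2 ?_
    refine iZJ.congr (ae_of_all _ fun ω => ?_)
    simp only [Pi.mul_apply]
    rw [abs_mul, Real.mul_rpow (abs_nonneg _) (abs_nonneg _)]
  have mS : MemLp (fun ω => M ω + Z ω * J ω) (ENNReal.ofReal p) P := hM.add mZJ
  refine ⟨mS, ?_⟩
  have hle : ∀ ω, |M ω + Z ω * J ω| ^ p ≤ |M ω| ^ p +
      p * (|M ω| ^ (p - 2) * M ω * Z ω * J ω) + (p ^ 2 + (p + 1) ^ p) *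
        (|M ω| ^ (p - 2) * Z ω ^ 2 * J ω ^ 2 + |Z ω| ^ p * |J ω| ^ p) := fun ω => by
    refine (abs_add_rpow_le hp (M ω) (Z ω * J ω)).trans (le_of_eq ?_)
    rw [abs_mul, Real.mul_rpow (abs_nonneg _) (abs_nonneg _)]
    ring
  have i1 : Integrable (fun ω => |M ω| ^ p + p * (|M ω| ^ (p - 2) * M ω * Z ω * J ω)) P :=
    iM.add (iGJ.const_mul p)
  have i2 : Integrable (fun ω => (p ^ 2 + (p + 1) ^ p) *
      (|M ω| ^ (p - 2) * Z ω ^ 2 * J ω ^ 2 + |Z ω| ^ p * |J ω| ^ p)) P :=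
    (iHJ.add iZJ).const_mul _
  have i3 : Integrable (fun ω => |M ω| ^ p + p * (|M ω| ^ (p - 2) * M ω * Z ω * J ω) +
      (p ^ 2 + (p + 1) ^ p) *
        (|M ω| ^ (p - 2) * Z ω ^ 2 * J ω ^ 2 + |Z ω| ^ p * |J ω| ^ p)) P := i1.add i2
  refine (integral_mono (integrable_abs_rpow_of_memLp hp0 mS) i3 hle).trans ?_
  rw [integral_add i1 i2, integral_add iM (iGJ.const_mul p),
    integral_const_mul, integral_const_mul, integral_add iHJ iZJ, eGJ, eHJ, eZJ, mul_zero, add_zero]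
  have hH : ∫ ω, |M ω| ^ (p - 2) * Z ω ^ 2 ∂P ≤
      (∫ ω, |M ω| ^ p ∂P) / τ + τ ^ (p / 2 - 1) * ∫ ω, |Z ω| ^ p ∂P := by
    rw [← integral_div, ← integral_const_mul, ← integral_add (iM.div_const τ) (iZ.const_mul _)]
    exact integral_mono iH ((iM.div_const τ).add (iZ.const_mul _)) fun ω =>
      abs_rpow_mul_sq_le hp hτ _ _
  have hJ2 : 0 ≤ ∫ ω, J ω ^ 2 ∂P := integral_nonneg fun ω => sq_nonneg _
  gcongr

theorem le_of_affine_recursion {u : ℕ → ℝ} {n : ℕ} {β d : ℝ} (hn : 0 < n) (hβ : 0 ≤ β)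
    (hd : 0 ≤ d) (h0 : u 0 ≤ 0) {N : ℕ} (hN : N ≤ n)
    (hu : ∀ k < N, u (k + 1) ≤ u k * (1 + β / n) + d) :
    u N ≤ Real.exp β * (n * d) := by
  have hn' : (0 : ℝ) < n := by exact_mod_cast hn
  have h1 : 1 ≤ 1 + β / n := by
    have : 0 ≤ β / n := by positivity
    linarith
  have claim : ∀ k ≤ N, u k ≤ (1 + β / n) ^ k * (k * d) := by
    intro k hk
    induction k with
    | zero => simpa using h0
    | succ k ih =>
      have h2 := ih (by omega)
      have h3 : 1 ≤ (1 + β / n) ^ (k + 1) := one_le_pow₀ h1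
      calc u (k + 1) ≤ u k * (1 + β / n) + d := hu k (by omega)
        _ ≤ (1 + β / n) ^ k * (k * d) * (1 + β / n) + (1 + β / n) ^ (k + 1) * d := by
            refine add_le_add (mul_le_mul_of_nonneg_right h2 (by linarith)) ?_
            nlinarith
        _ = (1 + β / n) ^ (k + 1) * ((k + 1 : ℕ) * d) := by
            push_cast
            ring
  refine (claim N le_rfl).trans ?_
  have h4 : (1 + β / n) ^ N ≤ Real.exp β := by
    calc (1 + β / n) ^ N ≤ (1 + β / n) ^ n := pow_le_pow_right₀ h1 hN
      _ ≤ (Real.exp (β / n)) ^ n := by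
          gcongr
          linarith [Real.add_one_le_exp (β / n)]
      _ = Real.exp β := by
          rw [← Real.exp_nat_mul]
          congr 1
          field_simp
  have h5 : (N : ℝ) ≤ n := by exact_mod_cast hN
  gcongr

/-- A Rosenthal type inequality: if `Jₖ` is centred and independent of `Zₖ` and of the partial sum
`∑_{i < k} Zᵢ Jᵢ`, and has second and `p`-th moments of order `δ`, then `∑_{k < n} Zₖ Jₖ` has a
`p`-th moment of order `nδ + (nδ)^{p/2}`. -/
theorem integral_abs_sum_mul_rpow_le [IsProbabilityMeasure P] {p c δ K : ℝ} (hp : 2 ≤ p)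
    (hc : 0 ≤ c) (hδ : 0 < δ) (hK : 0 ≤ K) {n N : ℕ} (hn : 0 < n) (hN : N ≤ n) {Z J : ℕ → Ω → ℝ}
    (hZ : ∀ k < N, MemLp (Z k) (ENNReal.ofReal p) P)
    (hJ : ∀ k < N, MemLp (J k) (ENNReal.ofReal p) P)
    (hJ0 : ∀ k < N, ∫ ω, J k ω ∂P = 0)
    (hJ2 : ∀ k < N, ∫ ω, J k ω ^ 2 ∂P ≤ c * δ)
    (hJp : ∀ k < N, ∫ ω, |J k ω| ^ p ∂P ≤ c * δ)
    (hZp : ∀ k < N, ∫ ω, |Z k ω| ^ p ∂P ≤ K)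
    (hind : ∀ k < N, IndepFun (fun ω => (∑ i ∈ Finset.range k, Z i ω * J i ω, Z k ω)) (J k) P) :
    MemLp (fun ω => ∑ i ∈ Finset.range N, Z i ω * J i ω) (ENNReal.ofReal p) P ∧
    ∫ ω, |∑ i ∈ Finset.range N, Z i ω * J i ω| ^ p ∂P ≤
      Real.exp ((p ^ 2 + (p + 1) ^ p) * c) * ((p ^ 2 + (p + 1) ^ p) * c * K) *
        (n * δ + (n * δ) ^ (p / 2)) := by
  set D := p ^ 2 + (p + 1) ^ p with hD
  have hD0 : 0 ≤ D := by positivity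
  have hn' : (0 : ℝ) < n := by exact_mod_cast hn
  set τ := n * δ with hτ
  have hτ0 : 0 < τ := by positivity
  have hmem : ∀ k ≤ N, MemLp (fun ω => ∑ i ∈ Finset.range k, Z i ω * J i ω)
      (ENNReal.ofReal p) P := by
    intro k hk
    induction k with
    | zero => simp
    | succ k ih =>
      simp_rw [Finset.sum_range_succ]
      exact (integral_abs_add_mul_rpow_le hp hτ0 (ih (by omega)) (hZ k (by omega))
        (hJ k (by omega)) (hind k (by omega)) (hJ0 k (by omega))).1
  refine ⟨hmem N le_rfl, ?_⟩
  have hrec := le_of_affine_recursion (u := fun k => ∫ ω, |∑ i ∈ Finset.range k, Z i ω * J i ω| ^ p ∂P)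
    (β := D * c) (d := D * c * K * δ * (τ ^ (p / 2 - 1) + 1)) hn (by positivity) (by positivity)
    (by simp [Real.zero_rpow (by linarith : p ≠ 0)]) hN (fun k hk => by
      have h := (integral_abs_add_mul_rpow_le hp hτ0 (hmem k hk.le) (hZ k hk) (hJ k hk)
        (hind k hk) (hJ0 k hk)).2
      simp_rw [Finset.sum_range_succ]
      refine h.trans ?_
      have hu0 : 0 ≤ ∫ ω, |∑ i ∈ Finset.range k, Z i ω * J i ω| ^ p ∂P :=
        integral_nonneg fun ω => by positivity
      have hz0 : 0 ≤ ∫ ω, |Z k ω| ^ p ∂P := integral_nonneg fun ω => by positivity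
      have hj0 : 0 ≤ ∫ ω, |J k ω| ^ p ∂P := integral_nonneg fun ω => by positivity
      have hj2 : 0 ≤ ∫ ω, J k ω ^ 2 ∂P := integral_nonneg fun ω => by positivity
      set U := ∫ ω, |∑ i ∈ Finset.range k, Z i ω * J i ω| ^ p ∂P
      have e1 : ((U / τ + τ ^ (p / 2 - 1) * ∫ ω, |Z k ω| ^ p ∂P) * ∫ ω, J k ω ^ 2 ∂P +
          (∫ ω, |Z k ω| ^ p ∂P) * ∫ ω, |J k ω| ^ p ∂P) ≤
          (U / τ + τ ^ (p / 2 - 1) * K) * (c * δ) + K * (c * δ) := by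
        gcongr
        · exact hZp k hk
        · exact hJ2 k hk
        · exact hZp k hk
        · exact hJp k hk
      have e2 : U / τ * (c * δ) = U * (c / n) := by
        rw [hτ]
        field_simp
      calc _ ≤ U + D * ((U / τ + τ ^ (p / 2 - 1) * K) * (c * δ) + K * (c * δ)) := by gcongr
        _ = U + D * (U / τ * (c * δ)) + D * c * K * δ * (τ ^ (p / 2 - 1) + 1) := by ring
        _ = U * (1 + D * c / n) + D * c * K * δ * (τ ^ (p / 2 - 1) + 1) := by
          rw [e2]
          ring)
  refine hrec.trans (le_of_eq ?_)
  have e3 : τ ^ (p / 2) = τ * τ ^ (p / 2 - 1) := by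
    rw [mul_comm, ← Real.rpow_add_one hτ0.ne']
    congr 1
    ring
  rw [e3, hτ]
  ring

end Trawl

namespace Trawl

/-! ### Sums of independent cells -/

variable {Ω : Type*}

/-- The σ-algebra generated by the cells in `S`. -/
abbrev cellAlgebra (ξ : ℕ × ℕ → Ω → ℝ) (S : Set (ℕ × ℕ)) : MeasurableSpace Ω :=
  ⨆ q ∈ S, MeasurableSpace.comap (ξ q) inferInstance

theorem cellAlgebra_mono (ξ : ℕ × ℕ → Ω → ℝ) {S T : Set (ℕ × ℕ)} (h : S ⊆ T) :
    cellAlgebra ξ S ≤ cellAlgebra ξ T :=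
  biSup_mono fun _ hq => h hq

/-- The sum of the cells in `S`. -/
def cellSum (ξ : ℕ × ℕ → Ω → ℝ) (S : Finset (ℕ × ℕ)) (ω : Ω) : ℝ := ∑ q ∈ S, ξ q ω

theorem measurable_cellSum (ξ : ℕ × ℕ → Ω → ℝ) {S : Finset (ℕ × ℕ)} {T : Set (ℕ × ℕ)}
    (h : ∀ q ∈ S, q ∈ T) : Measurable[cellAlgebra ξ T] (cellSum ξ S) := by
  unfold cellSum
  refine Finset.measurable_sum _ fun q hq => ?_
  refine Measurable.mono (comap_measurable (ξ q)) ?_ le_rfl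
  exact le_biSup (fun q => MeasurableSpace.comap (ξ q) inferInstance) (h q hq)

/-- The index set of all cells up to time `n`. -/
def grid (n : ℕ) : Finset (ℕ × ℕ) := Finset.range (n + 1) ×ˢ Finset.range (n + 1)

/-- Cells that are alive at time `k`; the cell `(i, j)` is born at time `i` and dies after `j`. -/
def aliveCells (n k : ℕ) : Finset (ℕ × ℕ) := (grid n).filter fun q => q.1 ≤ k ∧ k ≤ q.2

/-- Cells born at time `k`. -/
def bornCells (n k : ℕ) : Finset (ℕ × ℕ) := (grid n).filter fun q => q.1 = k ∧ k ≤ q.2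

/-- Cells born up to time `m` that die after time `k`. -/
def dyingCells (n m k : ℕ) : Finset (ℕ × ℕ) := (grid n).filter fun q => q.1 ≤ m ∧ q.2 = k

/-- Cells born up to time `m` that outlive time `k`. -/
def survivingCells (n m k : ℕ) : Finset (ℕ × ℕ) := (grid n).filter fun q => q.1 ≤ m ∧ k < q.2

/-- Cells alive at time `m` that die before time `k`. -/
def earlyCells (n m k : ℕ) : Finset (ℕ × ℕ) :=
  (grid n).filter fun q => q.1 ≤ m ∧ m ≤ q.2 ∧ q.2 < k

theorem cellSum_alive_succ (ξ : ℕ × ℕ → Ω → ℝ) (n k : ℕ) (ω : Ω) :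
    cellSum ξ (aliveCells n (k + 1)) ω - cellSum ξ (aliveCells n k) ω =
      cellSum ξ (bornCells n (k + 1)) ω - cellSum ξ (dyingCells n k k) ω := by
  simp only [cellSum, aliveCells, bornCells, dyingCells, Finset.sum_filter]
  rw [← Finset.sum_sub_distrib, ← Finset.sum_sub_distrib]
  refine Finset.sum_congr rfl fun q _ => ?_
  split_ifs <;> first | (exfalso; omega) | simp

theorem cellSum_alive_eq (ξ : ℕ × ℕ → Ω → ℝ) (n : ℕ) {m k : ℕ} (h : m ≤ k) (ω : Ω) :
    cellSum ξ (aliveCells n m) ω = cellSum ξ (survivingCells n m k) ω +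
      cellSum ξ (dyingCells n m k) ω + cellSum ξ (earlyCells n m k) ω := by
  simp only [cellSum, aliveCells, survivingCells, dyingCells, earlyCells, Finset.sum_filter]
  rw [← Finset.sum_add_distrib, ← Finset.sum_add_distrib]
  refine Finset.sum_congr rfl fun q _ => ?_
  split_ifs <;> first | (exfalso; omega) | simp

theorem filter_subset_filter_of_imp {s : Finset (ℕ × ℕ)} {f g : ℕ × ℕ → Prop} [DecidablePred f]
    [DecidablePred g] (h : ∀ q, f q → g q) : s.filter f ⊆ s.filter g :=
  Finset.monotone_filter_right s fun q _ => h q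

variable [MeasurableSpace Ω] {P : Measure Ω}

theorem indepFun_of_cells {ξ : ℕ × ℕ → Ω → ℝ} (hm : ∀ q, Measurable (ξ q)) (hi : iIndepFun ξ P)
    {Z J : ℕ → Ω → ℝ} {S T : ℕ → Set (ℕ × ℕ)} {k : ℕ}
    (hZ : ∀ i ≤ k, Measurable[cellAlgebra ξ (S i)] (Z i))
    (hJ : ∀ i ≤ k, Measurable[cellAlgebra ξ (T i)] (J i))
    (hS : ∀ i ≤ k, Disjoint (S i) (T k)) (hT : ∀ i < k, Disjoint (T i) (T k)) :
    IndepFun (fun ω => (∑ i ∈ Finset.range k, Z i ω * J i ω, Z k ω)) (J k) P := by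
  set U : Set (ℕ × ℕ) := (T k)ᶜ with hU
  have hind : Indep (cellAlgebra ξ U) (cellAlgebra ξ (T k)) P :=
    indep_iSup_of_disjoint (fun q => (hm q).comap_le) hi disjoint_compl_left
  have hSU : ∀ i ≤ k, S i ⊆ U := fun i h => (hS i h).subset_compl_right
  have hTU : ∀ i < k, T i ⊆ U := fun i h => (hT i h).subset_compl_right
  have hZU : ∀ i ≤ k, Measurable[cellAlgebra ξ U] (Z i) := fun i h =>
    (hZ i h).mono (cellAlgebra_mono ξ (hSU i h)) le_rfl
  have hJU : ∀ i < k, Measurable[cellAlgebra ξ U] (J i) := fun i h =>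
    (hJ i h.le).mono (cellAlgebra_mono ξ (hTU i h)) le_rfl
  have hpair : Measurable[cellAlgebra ξ U]
      (fun ω => (∑ i ∈ Finset.range k, Z i ω * J i ω, Z k ω)) := by
    refine Measurable.prodMk (Finset.measurable_sum _ fun i hik => ?_) (hZU k le_rfl)
    have hik' := Finset.mem_range.1 hik
    exact (hZU i hik'.le).mul (hJU i hik')
  rw [IndepFun_iff_Indep]
  exact indep_of_indep_of_le_left (indep_of_indep_of_le_right hind (hJ k le_rfl).comap_le)
    hpair.comap_le

/-- Independent centred variables `ξ (i, j)` whose sums have variance and `p`-th, fourth and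
`2p`-th moments controlled by the total weight. -/
structure CellModel (P : Measure Ω) (ξ : ℕ × ℕ → Ω → ℝ) (w : ℕ × ℕ → ℝ) (p V C : ℝ) : Prop where
  measurable : ∀ q, Measurable (ξ q)
  indep : iIndepFun ξ P
  weight_nonneg : ∀ q, 0 ≤ w q
  memLp : ∀ q, MemLp (ξ q) (ENNReal.ofReal (2 * p)) P
  mean : ∀ q, ∫ ω, ξ q ω ∂P = 0
  sq : ∀ S, ∫ ω, cellSum ξ S ω ^ 2 ∂P = ∑ q ∈ S, w q
  moment : ∀ r, r = p ∨ r = 4 ∨ r = 2 * p → ∀ S, ∑ q ∈ S, w q ≤ V →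
    ∫ ω, |cellSum ξ S ω| ^ r ∂P ≤ C * ∑ q ∈ S, w q

namespace CellModel

variable {ξ : ℕ × ℕ → Ω → ℝ} {w : ℕ × ℕ → ℝ} {p V C : ℝ}

theorem weight_le (h : CellModel P ξ w p V C) {S T : Finset (ℕ × ℕ)} (hST : S ⊆ T) :
    ∑ q ∈ S, w q ≤ ∑ q ∈ T, w q :=
  Finset.sum_le_sum_of_subset_of_nonneg hST fun q _ _ => h.weight_nonneg q

theorem memLp_cellSum (h : CellModel P ξ w p V C) (S : Finset (ℕ × ℕ)) :
    MemLp (cellSum ξ S) (ENNReal.ofReal (2 * p)) P := by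
  have := memLp_finsetSum S fun q _ => h.memLp q
  exact this

theorem memLp_cellSum_of_le [IsProbabilityMeasure P] (h : CellModel P ξ w p V C) {r : ℝ}
    (hr : r ≤ 2 * p) (S : Finset (ℕ × ℕ)) : MemLp (cellSum ξ S) (ENNReal.ofReal r) P :=
  (h.memLp_cellSum S).mono_exponent (ENNReal.ofReal_le_ofReal hr)

theorem memLp_two [IsProbabilityMeasure P] (h : CellModel P ξ w p V C) (hp : 2 ≤ p)
    (S : Finset (ℕ × ℕ)) : MemLp (cellSum ξ S) 2 P := by
  simpa using h.memLp_cellSum_of_le (r := 2) (by linarith) S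

theorem mean_cellSum [IsProbabilityMeasure P] (h : CellModel P ξ w p V C) (hp : 2 ≤ p)
    (S : Finset (ℕ × ℕ)) : ∫ ω, cellSum ξ S ω ∂P = 0 := by
  unfold cellSum
  rw [integral_finsetSum]
  · simp [h.mean]
  · intro q _
    refine (h.memLp q).integrable ?_
    rw [show (1 : ℝ≥0∞) = ENNReal.ofReal 1 by simp]
    exact ENNReal.ofReal_le_ofReal (by linarith)

/-- The covariance of two cell sums, one contained in the other. -/
theorem integral_mul_of_subset [IsProbabilityMeasure P] (h : CellModel P ξ w p V C) (hp : 2 ≤ p)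
    {S T : Finset (ℕ × ℕ)} (hST : S ⊆ T) :
    ∫ ω, cellSum ξ S ω * cellSum ξ T ω ∂P = ∑ q ∈ S, w q := by
  have hsplit : ∀ ω, cellSum ξ (T \ S) ω = cellSum ξ T ω - cellSum ξ S ω := fun ω =>
    Finset.sum_sdiff_eq_sub hST
  have hw : ∑ q ∈ T \ S, w q = ∑ q ∈ T, w q - ∑ q ∈ S, w q := Finset.sum_sdiff_eq_sub hST
  have h1 := h.sq (T \ S)
  simp_rw [hsplit] at h1
  have iS := (h.memLp_two hp S).integrable_sq
  have iT := (h.memLp_two hp T).integrable_sq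
  have iST : Integrable (fun ω => cellSum ξ S ω * cellSum ξ T ω) P :=
    (h.memLp_two hp S).integrable_mul (h.memLp_two hp T)
  have i2 : Integrable (fun ω => cellSum ξ T ω ^ 2 + cellSum ξ S ω ^ 2) P := iT.add iS
  have e : ∀ ω, (cellSum ξ T ω - cellSum ξ S ω) ^ 2 =
      cellSum ξ T ω ^ 2 + cellSum ξ S ω ^ 2 - 2 * (cellSum ξ S ω * cellSum ξ T ω) := fun ω => by
    ring
  simp_rw [e] at h1
  rw [integral_sub i2 (iST.const_mul 2), integral_add iT iS, integral_const_mul, h.sq, h.sq,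
    hw] at h1
  linarith

end CellModel

theorem abs_mul_rpow_le (x y r : ℝ) :
    |x * y| ^ r ≤ (|x| ^ (2 * r) + |y| ^ (2 * r)) / 2 := by
  have e : ∀ u : ℝ, |u| ^ (2 * r) = (|u| ^ r) ^ 2 := fun u => by
    rw [mul_comm, Real.rpow_mul (abs_nonneg u)]
    norm_num
  rw [abs_mul, Real.mul_rpow (abs_nonneg _) (abs_nonneg _), e, e]
  nlinarith [sq_nonneg (|x| ^ r - |y| ^ r)]

theorem abs_sub_rpow_le (x y : ℝ) {r : ℝ} (hr : 0 ≤ r) :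
    |x - y| ^ r ≤ 2 ^ r * (|x| ^ r + |y| ^ r) := by
  have h1 : |x - y| ≤ 2 * max |x| |y| := by
    have := abs_sub x y
    linarith [le_max_left |x| |y|, le_max_right |x| |y|]
  have h2 : (max |x| |y|) ^ r ≤ |x| ^ r + |y| ^ r := by
    have hx : 0 ≤ |x| ^ r := by positivity
    have hy : 0 ≤ |y| ^ r := by positivity
    rcases max_choice |x| |y| with h | h <;> rw [h] <;> linarith
  calc |x - y| ^ r ≤ (2 * max |x| |y|) ^ r := Real.rpow_le_rpow (abs_nonneg _) h1 hr
    _ = 2 ^ r * (max |x| |y|) ^ r := Real.mul_rpow (by norm_num) (by positivity)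
    _ ≤ _ := by gcongr

theorem abs_five_rpow_le (x y z u v : ℝ) {r : ℝ} (hr : 1 ≤ r) :
    |x - y - z - u - v| ^ r ≤
      5 ^ (r - 1) * (|x| ^ r + |y| ^ r + |z| ^ r + |u| ^ r + |v| ^ r) := by
  have h := Real.rpow_sum_le_const_mul_sum_rpow (Finset.univ : Finset (Fin 5)) ![x, y, z, u, v] hr
  simp only [Fin.sum_univ_five, Finset.card_univ, Fintype.card_fin] at h
  refine le_trans (Real.rpow_le_rpow (abs_nonneg _) ?_ (by linarith)) h
  simp only [Matrix.cons_val]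
  have h1 := abs_sub (x - y - z - u) v
  have h2 := abs_sub (x - y - z) u
  have h3 := abs_sub (x - y) z
  have h4 := abs_sub x y
  linarith

namespace CellModel

variable {ξ : ℕ × ℕ → Ω → ℝ} {w : ℕ × ℕ → ℝ} {p V C δ : ℝ}

/-- The product of a part of a cell sum with the whole sum, centred. -/
theorem centered_product_moments [IsProbabilityMeasure P] (h : CellModel P ξ w p V C) (hp : 2 ≤ p)
    (hC : 0 ≤ C) {S T : Finset (ℕ × ℕ)} (hST : S ⊆ T) (hV : ∑ q ∈ T, w q ≤ V)
    (hδ : ∑ q ∈ T, w q ≤ δ) :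
    MemLp (fun ω => cellSum ξ S ω * cellSum ξ T ω - ∑ q ∈ S, w q) (ENNReal.ofReal p) P ∧
    ∫ ω, (cellSum ξ S ω * cellSum ξ T ω - ∑ q ∈ S, w q) ∂P = 0 ∧
    ∫ ω, (cellSum ξ S ω * cellSum ξ T ω - ∑ q ∈ S, w q) ^ 2 ∂P ≤ C * δ ∧
    ∫ ω, |cellSum ξ S ω * cellSum ξ T ω - ∑ q ∈ S, w q| ^ p ∂P ≤ 2 ^ (p + 1) * C * δ := by
  have hp0 : 0 < p := by linarith
  have hSw := h.weight_le hST
  have hprod : ∀ r, 1 ≤ r → r ≤ p → (2 * r = p ∨ 2 * r = 4 ∨ 2 * r = 2 * p) →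
      Integrable (fun ω => |cellSum ξ S ω * cellSum ξ T ω| ^ r) P ∧
      ∫ ω, |cellSum ξ S ω * cellSum ξ T ω| ^ r ∂P ≤ C * δ := by
    intro r hr hrp hr'
    have iS := integrable_abs_rpow_of_memLp (by linarith)
      (h.memLp_cellSum_of_le (r := 2 * r) (by linarith) S)
    have iT := integrable_abs_rpow_of_memLp (by linarith)
      (h.memLp_cellSum_of_le (r := 2 * r) (by linarith) T)
    have iD : Integrable (fun ω => (|cellSum ξ S ω| ^ (2 * r) + |cellSum ξ T ω| ^ (2 * r)) / 2) P :=
      (iS.add iT).div_const 2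
    have aS := (h.memLp_cellSum S).1.aemeasurable
    have aT := (h.memLp_cellSum T).1.aemeasurable
    have i1 : Integrable (fun ω => |cellSum ξ S ω * cellSum ξ T ω| ^ r) P := by
      refine Integrable.mono' iD ?_ (ae_of_all _ fun ω => ?_)
      · have : AEMeasurable (fun ω => |cellSum ξ S ω * cellSum ξ T ω| ^ r) P := by fun_prop
        exact this.aestronglyMeasurable
      · rw [Real.norm_of_nonneg (by positivity)]
        exact abs_mul_rpow_le _ _ _
    refine ⟨i1, (integral_mono i1 iD fun ω => abs_mul_rpow_le _ _ _).trans ?_⟩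
    rw [integral_div, integral_add iS iT]
    have b1 := h.moment (2 * r) hr' S (hSw.trans hV)
    have b2 := h.moment (2 * r) hr' T hV
    have b3 : C * ∑ q ∈ S, w q ≤ C * δ := mul_le_mul_of_nonneg_left (hSw.trans hδ) hC
    have b4 : C * ∑ q ∈ T, w q ≤ C * δ := mul_le_mul_of_nonneg_left hδ hC
    linarith
  have aST : AEStronglyMeasurable (fun ω => cellSum ξ S ω * cellSum ξ T ω) P :=
    (h.memLp_cellSum S).1.mul (h.memLp_cellSum T).1
  have mp : MemLp (fun ω => cellSum ξ S ω * cellSum ξ T ω) (ENNReal.ofReal p) P :=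
    (memLp_iff_integrable_abs_rpow aST hp0).2
      (hprod p (by linarith) le_rfl (Or.inr (Or.inr rfl))).1
  have m2 : MemLp (fun ω => cellSum ξ S ω * cellSum ξ T ω) 2 P := by
    refine mp.mono_exponent ?_
    rw [show (2 : ℝ≥0∞) = ENNReal.ofReal 2 by simp]
    exact ENNReal.ofReal_le_ofReal hp
  have i1 : Integrable (fun ω => cellSum ξ S ω * cellSum ξ T ω) P := m2.integrable (by norm_num)
  have hmean := h.integral_mul_of_subset hp hST
  have mc : MemLp (fun ω => cellSum ξ S ω * cellSum ξ T ω - ∑ q ∈ S, w q) (ENNReal.ofReal p) P :=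
    mp.sub (memLp_const _)
  refine ⟨mc, ?_, ?_, ?_⟩
  · rw [integral_sub i1 (integrable_const _), hmean]
    simp
  · have hv := variance_le_expectation_sq (X := fun ω => cellSum ξ S ω * cellSum ξ T ω) m2.1
    rw [variance_eq_integral m2.1.aemeasurable, hmean] at hv
    refine hv.trans (le_trans (le_of_eq ?_) (hprod 2 (by norm_num) hp (by norm_num)).2)
    refine integral_congr_ae (ae_of_all _ fun ω => ?_)
    simp [mul_pow]
  · obtain ⟨ip, bp⟩ := hprod p (by linarith) le_rfl (Or.inr (Or.inr rfl))
    have hj : |∑ q ∈ S, w q| ^ p ≤ ∫ ω, |cellSum ξ S ω * cellSum ξ T ω| ^ p ∂P := by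
      have hw0 : 0 ≤ ∑ q ∈ S, w q := Finset.sum_nonneg fun q _ => h.weight_nonneg q
      have h1 : |∑ q ∈ S, w q| ≤ ∫ ω, |cellSum ξ S ω * cellSum ξ T ω| ∂P := by
        rw [← hmean]
        exact abs_integral_le_integral_abs
      refine (Real.rpow_le_rpow (abs_nonneg _) h1 hp0.le).trans ?_
      exact (convexOn_rpow (by linarith : 1 ≤ p)).map_integral_le
        (Real.continuous_rpow_const hp0.le).continuousOn isClosed_Ici
        (ae_of_all _ fun ω => mem_Ici.2 (abs_nonneg _)) i1.abs ip
    have i2 : Integrable (fun ω => 2 ^ p * (|cellSum ξ S ω * cellSum ξ T ω| ^ p +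
        |∑ q ∈ S, w q| ^ p)) P := (ip.add (integrable_const _)).const_mul _
    refine (integral_mono (integrable_abs_rpow_of_memLp hp0 mc) i2
      fun ω => abs_sub_rpow_le _ _ hp0.le).trans ?_
    rw [integral_const_mul, integral_add ip (integrable_const _), integral_const, probReal_univ,
      one_smul, Real.rpow_add_one (by norm_num)]
    have : (0 : ℝ) ≤ 2 ^ p := by positivity
    nlinarith

end CellModel

end Trawl

namespace Trawl

variable {Ω : Type*} [MeasurableSpace Ω] {P : Measure Ω}

/-- The constant in the moment bound for bilinear sums of cells. -/
noncomputable def blockConst (p V C : ℝ) : ℝ :=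
  Real.exp ((p ^ 2 + (p + 1) ^ p) * (1 + 2 ^ (p + 1) * C)) *
    ((p ^ 2 + (p + 1) ^ p) * (1 + 2 ^ (p + 1) * C) * (C * V + 1))

namespace CellModel

variable {ξ : ℕ × ℕ → Ω → ℝ} {w : ℕ × ℕ → ℝ} {p V C δ : ℝ}

theorem integral_abs_bilinear_sum_le [IsProbabilityMeasure P] (h : CellModel P ξ w p V C)
    (hp : 2 ≤ p) (hC : 0 ≤ C) (hV : 0 ≤ V) (hδ : 0 < δ) {n N : ℕ} (hn : 0 < n) (hN : N ≤ n)
    {S T : ℕ → Finset (ℕ × ℕ)} (hS : ∀ k < N, ∑ q ∈ S k, w q ≤ V)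
    (hTV : ∀ k < N, ∑ q ∈ T k, w q ≤ V) (hT : ∀ k < N, ∑ q ∈ T k, w q ≤ δ)
    (hST : ∀ k < N, ∀ i ≤ k, Disjoint (S i) (T k)) (hTT : ∀ k < N, ∀ i < k, Disjoint (T i) (T k)) :
    MemLp (fun ω => ∑ i ∈ Finset.range N, cellSum ξ (S i) ω * cellSum ξ (T i) ω)
      (ENNReal.ofReal p) P ∧
    ∫ ω, |∑ i ∈ Finset.range N, cellSum ξ (S i) ω * cellSum ξ (T i) ω| ^ p ∂P ≤
      blockConst p V C * (n * δ + (n * δ) ^ (p / 2)) := by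
  have hc1 : C ≤ 1 + 2 ^ (p + 1) * C := by
    have : (1 : ℝ) ≤ 2 ^ (p + 1) := Real.one_le_rpow (by norm_num) (by linarith)
    nlinarith
  have hc2 : 1 ≤ 1 + 2 ^ (p + 1) * C := by
    have : 0 ≤ 2 ^ (p + 1) * C := by positivity
    linarith
  refine integral_abs_sum_mul_rpow_le hp (by linarith) hδ (by positivity) hn hN
    (fun k _ => h.memLp_cellSum_of_le (by linarith) _)
    (fun k _ => h.memLp_cellSum_of_le (by linarith) _)
    (fun k _ => h.mean_cellSum hp _) (fun k hk => ?_) (fun k hk => ?_) (fun k hk => ?_)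
    (fun k hk => ?_)
  · rw [h.sq]
    have := hT k hk
    nlinarith
  · refine (h.moment p (Or.inl rfl) _ (hTV k hk)).trans ?_
    refine (mul_le_mul_of_nonneg_left (hT k hk) hC).trans ?_
    exact mul_le_mul_of_nonneg_right hc1 hδ.le
  · refine (h.moment p (Or.inl rfl) _ (hS k hk)).trans ?_
    have := mul_le_mul_of_nonneg_left (hS k hk) hC
    linarith
  · exact indepFun_of_cells h.measurable h.indep (S := fun i => (S i : Set (ℕ × ℕ)))
      (T := fun i => (T i : Set (ℕ × ℕ)))
      (fun i _ => measurable_cellSum ξ fun q hq => hq)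
      (fun i _ => measurable_cellSum ξ fun q hq => hq)
      (fun i hi => Finset.disjoint_coe.2 (hST k hk i hi))
      (fun i hi => Finset.disjoint_coe.2 (hTT k hk i hi))

theorem integral_abs_centered_product_sum_le [IsProbabilityMeasure P] (h : CellModel P ξ w p V C)
    (hp : 2 ≤ p) (hC : 0 ≤ C) (hV : 0 ≤ V) (hδ : 0 < δ) {n N : ℕ} (hn : 0 < n) (hN : N ≤ n)
    {S T : ℕ → Finset (ℕ × ℕ)} (hST : ∀ k, S k ⊆ T k)
    (hTV : ∀ k < N, ∑ q ∈ T k, w q ≤ V) (hT : ∀ k < N, ∑ q ∈ T k, w q ≤ δ)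
    (hTT : ∀ k < N, ∀ i < k, Disjoint (T i) (T k)) :
    MemLp (fun ω => ∑ i ∈ Finset.range N,
      (cellSum ξ (S i) ω * cellSum ξ (T i) ω - ∑ q ∈ S i, w q)) (ENNReal.ofReal p) P ∧
    ∫ ω, |∑ i ∈ Finset.range N,
      (cellSum ξ (S i) ω * cellSum ξ (T i) ω - ∑ q ∈ S i, w q)| ^ p ∂P ≤
      blockConst p V C * (n * δ + (n * δ) ^ (p / 2)) := by
  have hc1 : C ≤ 1 + 2 ^ (p + 1) * C := by
    have : (1 : ℝ) ≤ 2 ^ (p + 1) := Real.one_le_rpow (by norm_num) (by linarith)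
    nlinarith
  have hc0 : 0 ≤ 1 + 2 ^ (p + 1) * C := by positivity
  have hm := fun k (hk : k < N) => h.centered_product_moments hp hC (hST k) (hTV k hk) (hT k hk)
  have key := integral_abs_sum_mul_rpow_le (P := P) (K := C * V + 1) (Z := fun _ _ => 1)
    (J := fun k ω => cellSum ξ (S k) ω * cellSum ξ (T k) ω - ∑ q ∈ S k, w q)
    hp hc0 hδ (by positivity) hn hN
    (fun k _ => memLp_const _) (fun k hk => (hm k hk).1) (fun k hk => (hm k hk).2.1)
    (fun k hk => (hm k hk).2.2.1.trans (mul_le_mul_of_nonneg_right hc1 hδ.le))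
    (fun k hk => (hm k hk).2.2.2.trans (by nlinarith))
    (fun k _ => by
      have : 0 ≤ C * V := by positivity
      simpa using this)
    (fun k hk => indepFun_of_cells h.measurable h.indep (S := fun _ => ∅)
      (T := fun i => (T i : Set (ℕ × ℕ)))
      (fun i _ => measurable_const)
      (fun i _ => ((measurable_cellSum ξ fun q hq => Finset.mem_coe.2 (hST i hq)).mul
        (measurable_cellSum ξ fun q hq => hq)).sub_const _)
      (fun i _ => disjoint_bot_left)
      (fun i hi => Finset.disjoint_coe.2 (hTT k hk i hi)))
  simpa only [one_mul, blockConst] using key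

/-- The moment bound for the centring by the sample mean. -/
theorem integral_abs_mean_mul_le [IsProbabilityMeasure P] (h : CellModel P ξ w p V C)
    (hp : 2 ≤ p) (hC : 0 ≤ C) {n l : ℕ} (hn : 0 < n) (hl : l ≤ n)
    (hX : ∀ k ≤ n, ∑ q ∈ aliveCells n k, w q ≤ V) :
    MemLp (fun ω => (1 / (n : ℝ) * ∑ k ∈ Finset.range n, cellSum ξ (aliveCells n k) ω) *
      (cellSum ξ (aliveCells n n) ω - cellSum ξ (aliveCells n l) ω)) (ENNReal.ofReal p) P ∧
    ∫ ω, |(1 / (n : ℝ) * ∑ k ∈ Finset.range n, cellSum ξ (aliveCells n k) ω) *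
      (cellSum ξ (aliveCells n n) ω - cellSum ξ (aliveCells n l) ω)| ^ p ∂P ≤
      (1 + 2 ^ (2 * p + 1)) * (C * V) := by
  have hp0 : 0 < p := by linarith
  have h2p : 0 < 2 * p := by linarith
  have hn' : (0 : ℝ) < n := by exact_mod_cast hn
  have hiX := fun k => integrable_abs_rpow_of_memLp h2p (h.memLp_cellSum (aliveCells n k))
  have hbX : ∀ k ≤ n, ∫ ω, |cellSum ξ (aliveCells n k) ω| ^ (2 * p) ∂P ≤ C * V := fun k hk =>
    (h.moment _ (Or.inr (Or.inr rfl)) _ (hX k hk)).trans (mul_le_mul_of_nonneg_left (hX k hk) hC)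
  set F : Ω → ℝ := fun ω => (1 / (n : ℝ) * ∑ k ∈ Finset.range n, cellSum ξ (aliveCells n k) ω) *
      (cellSum ξ (aliveCells n n) ω - cellSum ξ (aliveCells n l) ω) with hF
  have hle : ∀ ω, |F ω| ^ p ≤
      (1 / (n : ℝ) * ∑ k ∈ Finset.range n, |cellSum ξ (aliveCells n k) ω| ^ (2 * p) +
        2 ^ (2 * p) * (|cellSum ξ (aliveCells n n) ω| ^ (2 * p) +
          |cellSum ξ (aliveCells n l) ω| ^ (2 * p))) / 2 := fun ω => by
    refine (abs_mul_rpow_le _ _ _).trans ?_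
    have b1 : |1 / (n : ℝ) * ∑ k ∈ Finset.range n, cellSum ξ (aliveCells n k) ω| ^ (2 * p) ≤
        1 / (n : ℝ) * ∑ k ∈ Finset.range n, |cellSum ξ (aliveCells n k) ω| ^ (2 * p) := by
      have h1 := Real.rpow_sum_le_const_mul_sum_rpow (Finset.range n)
        (fun k => cellSum ξ (aliveCells n k) ω) (by linarith : 1 ≤ 2 * p)
      rw [Finset.card_range] at h1
      rw [abs_mul, Real.mul_rpow (abs_nonneg _) (abs_nonneg _),
        abs_of_nonneg (by positivity : 0 ≤ 1 / (n : ℝ))]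
      calc (1 / (n : ℝ)) ^ (2 * p) * |∑ k ∈ Finset.range n, cellSum ξ (aliveCells n k) ω| ^ (2 * p)
          ≤ (1 / (n : ℝ)) ^ (2 * p) * (∑ k ∈ Finset.range n,
            |cellSum ξ (aliveCells n k) ω|) ^ (2 * p) := by
            gcongr
            exact Finset.abs_sum_le_sum_abs _ _
        _ ≤ (1 / (n : ℝ)) ^ (2 * p) * ((n : ℝ) ^ (2 * p - 1) *
            ∑ k ∈ Finset.range n, |cellSum ξ (aliveCells n k) ω| ^ (2 * p)) := by gcongr
        _ = 1 / (n : ℝ) * ∑ k ∈ Finset.range n, |cellSum ξ (aliveCells n k) ω| ^ (2 * p) := by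
            rw [← mul_assoc]
            congr 1
            rw [one_div, Real.inv_rpow hn'.le, Real.rpow_sub_one hn'.ne']
            have : (n : ℝ) ^ (2 * p) ≠ 0 := (Real.rpow_pos_of_pos hn' _).ne'
            field_simp
    have b2 := abs_sub_rpow_le (cellSum ξ (aliveCells n n) ω) (cellSum ξ (aliveCells n l) ω) h2p.le
    linarith
  have i1 : Integrable (fun ω => 1 / (n : ℝ) * ∑ k ∈ Finset.range n,
      |cellSum ξ (aliveCells n k) ω| ^ (2 * p)) P :=
    (integrable_finsetSum _ fun k _ => hiX k).const_mul _
  have i2 : Integrable (fun ω => 2 ^ (2 * p) * (|cellSum ξ (aliveCells n n) ω| ^ (2 * p) +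
          |cellSum ξ (aliveCells n l) ω| ^ (2 * p))) P := ((hiX n).add (hiX l)).const_mul _
  have i3 : Integrable (fun ω => (1 / (n : ℝ) * ∑ k ∈ Finset.range n,
      |cellSum ξ (aliveCells n k) ω| ^ (2 * p) +
        2 ^ (2 * p) * (|cellSum ξ (aliveCells n n) ω| ^ (2 * p) +
          |cellSum ξ (aliveCells n l) ω| ^ (2 * p))) / 2) P := (i1.add i2).div_const 2
  have hmX : ∀ S : Finset (ℕ × ℕ), AEMeasurable (fun ω => cellSum ξ S ω) P := fun S =>
    (h.memLp_cellSum S).1.aemeasurable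
  have hmF : AEMeasurable F P := by
    refine AEMeasurable.mul (AEMeasurable.const_mul ?_ _) ((hmX _).sub (hmX _))
    exact Finset.aemeasurable_fun_sum _ fun k _ => hmX _
  have iF : Integrable (fun ω => |F ω| ^ p) P := by
    refine Integrable.mono' i3 ?_ (ae_of_all _ fun ω => ?_)
    · have : AEMeasurable (fun ω => |F ω| ^ p) P := by fun_prop
      exact this.aestronglyMeasurable
    · rw [Real.norm_of_nonneg (by positivity)]
      exact hle ω
  refine ⟨(memLp_iff_integrable_abs_rpow hmF.aestronglyMeasurable hp0).2 iF,
    (integral_mono iF i3 hle).trans ?_⟩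
  rw [integral_div, integral_add i1 i2, integral_const_mul, integral_const_mul,
    integral_add (hiX n) (hiX l), integral_finsetSum _ fun k _ => hiX k]
  have b3 : ∑ k ∈ Finset.range n, ∫ ω, |cellSum ξ (aliveCells n k) ω| ^ (2 * p) ∂P ≤
      n * (C * V) := by
    have := Finset.sum_le_card_nsmul (Finset.range n)
      (fun k => ∫ ω, |cellSum ξ (aliveCells n k) ω| ^ (2 * p) ∂P) (C * V)
      fun k hk => hbX k (Finset.mem_range.1 hk).le
    simpa using this
  have b4 : 1 / (n : ℝ) * ∑ k ∈ Finset.range n, ∫ ω, |cellSum ξ (aliveCells n k) ω| ^ (2 * p) ∂P ≤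
      C * V := by
    calc _ ≤ 1 / (n : ℝ) * (n * (C * V)) := by gcongr
      _ = C * V := by field_simp
  have b5 := hbX n le_rfl
  have b6 := hbX l hl
  have hCV : 0 ≤ C * V := (integral_nonneg fun ω => by positivity).trans b5
  have b7 : (0 : ℝ) ≤ 2 ^ (2 * p) := by positivity
  rw [Real.rpow_add_one (by norm_num)]
  nlinarith

/-- The `p`-th moment of the centred sum of lagged products of a process with independent cells. -/
theorem integral_abs_estimator_le [IsProbabilityMeasure P] (h : CellModel P ξ w p V C)
    (hp : 2 ≤ p) (hC : 0 ≤ C) (hδ : 0 < δ) {n l : ℕ} (hn : 0 < n) (hl : l ≤ n)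
    (hX : ∀ k ≤ n, ∑ q ∈ aliveCells n k, w q ≤ V)
    (hI : ∀ k < n, ∑ q ∈ bornCells n (k + 1), w q ≤ δ)
    (hR : ∀ k < n, ∑ q ∈ dyingCells n k k, w q ≤ δ) :
    MemLp (fun ω => ∑ k ∈ Finset.Ico l n, (cellSum ξ (aliveCells n (k - l)) ω -
      1 / (n : ℝ) * ∑ k ∈ Finset.range n, cellSum ξ (aliveCells n k) ω) *
      (cellSum ξ (aliveCells n (k + 1)) ω - cellSum ξ (aliveCells n k) ω) +
      ∑ k ∈ Finset.Ico l n, ∑ q ∈ dyingCells n (k - l) k, w q) (ENNReal.ofReal p) P ∧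
    ∫ ω, |∑ k ∈ Finset.Ico l n, (cellSum ξ (aliveCells n (k - l)) ω -
      1 / (n : ℝ) * ∑ k ∈ Finset.range n, cellSum ξ (aliveCells n k) ω) *
      (cellSum ξ (aliveCells n (k + 1)) ω - cellSum ξ (aliveCells n k) ω) +
      ∑ k ∈ Finset.Ico l n, ∑ q ∈ dyingCells n (k - l) k, w q| ^ p ∂P ≤
      5 ^ (p - 1) * (4 * (blockConst p V C * (n * δ + (n * δ) ^ (p / 2))) +
        (1 + 2 ^ (2 * p + 1)) * (C * V)) := by
  have hp0 : 0 < p := by linarith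
  set N := n - l with hN
  have hNn : N ≤ n := Nat.sub_le _ _
  have hV : 0 ≤ V := (Finset.sum_nonneg fun q _ => h.weight_nonneg q).trans (hX 0 (Nat.zero_le _))
  have hsub : ∀ {f g : ℕ × ℕ → Prop} [DecidablePred f] [DecidablePred g], (∀ q, f q → g q) →
      ∑ q ∈ (grid n).filter f, w q ≤ ∑ q ∈ (grid n).filter g, w q := fun hfg =>
    h.weight_le (filter_subset_filter_of_imp hfg)
  have hIV : ∀ k < n, ∑ q ∈ bornCells n (k + 1), w q ≤ V := fun k hk =>
    (hsub fun q hq => by omega).trans (hX (k + 1) (by omega))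
  have hRV : ∀ k < n, ∑ q ∈ dyingCells n k k, w q ≤ V := fun k hk =>
    (hsub fun q hq => by omega).trans (hX k (by omega))
  -- the four bilinear sums
  obtain ⟨m1, b1⟩ := h.integral_abs_bilinear_sum_le hp hC hV hδ hn hNn
    (S := fun i => aliveCells n i) (T := fun i => bornCells n (l + i + 1))
    (fun k hk => hX k (by omega)) (fun k hk => hIV _ (by omega)) (fun k hk => hI _ (by omega))
    (fun k hk i hi => by
      rw [Finset.disjoint_left]
      intro q h1 h2
      simp only [aliveCells, bornCells, Finset.mem_filter] at h1 h2
      omega)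
    (fun k hk i hi => by
      rw [Finset.disjoint_left]
      intro q h1 h2
      simp only [bornCells, Finset.mem_filter] at h1 h2
      omega)
  obtain ⟨m2, b2⟩ := h.integral_abs_bilinear_sum_le hp hC hV hδ hn hNn
    (S := fun i => earlyCells n i (l + i)) (T := fun i => dyingCells n (l + i) (l + i))
    (fun k hk => (hsub fun q hq => by omega).trans (hX k (by omega)))
    (fun k hk => hRV _ (by omega)) (fun k hk => hR _ (by omega))
    (fun k hk i hi => by
      rw [Finset.disjoint_left]
      intro q h1 h2
      simp only [earlyCells, dyingCells, Finset.mem_filter] at h1 h2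
      omega)
    (fun k hk i hi => by
      rw [Finset.disjoint_left]
      intro q h1 h2
      simp only [dyingCells, Finset.mem_filter] at h1 h2
      omega)
  obtain ⟨m3, b3⟩ := h.integral_abs_bilinear_sum_le hp hC hV hδ hn hNn
    (S := fun i => survivingCells n (N - 1 - i) (l + (N - 1 - i)))
    (T := fun i => dyingCells n (l + (N - 1 - i)) (l + (N - 1 - i)))
    (fun k hk => (hsub fun q hq => by omega).trans (hX (N - 1 - k) (by omega)))
    (fun k hk => hRV _ (by omega)) (fun k hk => hR _ (by omega))
    (fun k hk i hi => by
      rw [Finset.disjoint_left]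
      intro q h1 h2
      simp only [survivingCells, dyingCells, Finset.mem_filter] at h1 h2
      omega)
    (fun k hk i hi => by
      rw [Finset.disjoint_left]
      intro q h1 h2
      simp only [dyingCells, Finset.mem_filter] at h1 h2
      omega)
  have hrefl : ∀ ω, ∑ i ∈ Finset.range N,
      cellSum ξ (survivingCells n (N - 1 - i) (l + (N - 1 - i))) ω *
        cellSum ξ (dyingCells n (l + (N - 1 - i)) (l + (N - 1 - i))) ω =
      ∑ i ∈ Finset.range N, cellSum ξ (survivingCells n i (l + i)) ω *
        cellSum ξ (dyingCells n (l + i) (l + i)) ω := fun ω =>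
    Finset.sum_range_reflect (fun i => cellSum ξ (survivingCells n i (l + i)) ω *
        cellSum ξ (dyingCells n (l + i) (l + i)) ω) N
  simp_rw [hrefl] at m3 b3
  obtain ⟨m4, b4⟩ := h.integral_abs_centered_product_sum_le hp hC hV hδ hn hNn
    (S := fun i => dyingCells n i (l + i)) (T := fun i => dyingCells n (l + i) (l + i))
    (fun k => filter_subset_filter_of_imp fun q hq => by omega)
    (fun k hk => hRV _ (by omega)) (fun k hk => hR _ (by omega))
    (fun k hk i hi => by
      rw [Finset.disjoint_left]
      intro q h1 h2
      simp only [dyingCells, Finset.mem_filter] at h1 h2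
      omega)
  obtain ⟨m5, b5⟩ := h.integral_abs_mean_mul_le hp hC hn hl hX
  set F1 := fun ω => ∑ i ∈ Finset.range N, cellSum ξ (aliveCells n i) ω *
    cellSum ξ (bornCells n (l + i + 1)) ω with hF1
  set F2 := fun ω => ∑ i ∈ Finset.range N, cellSum ξ (earlyCells n i (l + i)) ω *
    cellSum ξ (dyingCells n (l + i) (l + i)) ω with hF2
  set F3 := fun ω => ∑ i ∈ Finset.range N, cellSum ξ (survivingCells n i (l + i)) ω *
    cellSum ξ (dyingCells n (l + i) (l + i)) ω with hF3
  set F4 := fun ω => ∑ i ∈ Finset.range N, (cellSum ξ (dyingCells n i (l + i)) ω *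
    cellSum ξ (dyingCells n (l + i) (l + i)) ω - ∑ q ∈ dyingCells n i (l + i), w q) with hF4
  set F5 := fun ω => (1 / (n : ℝ) * ∑ k ∈ Finset.range n, cellSum ξ (aliveCells n k) ω) *
      (cellSum ξ (aliveCells n n) ω - cellSum ξ (aliveCells n l) ω) with hF5
  have hdecomp : ∀ ω, ∑ k ∈ Finset.Ico l n, (cellSum ξ (aliveCells n (k - l)) ω -
      1 / (n : ℝ) * ∑ k ∈ Finset.range n, cellSum ξ (aliveCells n k) ω) *
      (cellSum ξ (aliveCells n (k + 1)) ω - cellSum ξ (aliveCells n k) ω) +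
      ∑ k ∈ Finset.Ico l n, ∑ q ∈ dyingCells n (k - l) k, w q =
      F1 ω - F2 ω - F3 ω - F4 ω - F5 ω := fun ω => by
    have hlast : F5 ω = ∑ i ∈ Finset.range N, (1 / (n : ℝ) *
        ∑ k ∈ Finset.range n, cellSum ξ (aliveCells n k) ω) *
        (cellSum ξ (aliveCells n (l + i + 1)) ω - cellSum ξ (aliveCells n (l + i)) ω) := by
      have := Finset.sum_range_sub (fun i => cellSum ξ (aliveCells n (l + i)) ω) N
      rw [← Finset.mul_sum]
      simp only [← add_assoc] at this
      rw [this, add_zero, hN, Nat.add_sub_cancel' hl]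
    rw [hlast, Finset.sum_Ico_eq_sum_range, Finset.sum_Ico_eq_sum_range, ← hN]
    simp only [hF1, hF2, hF3, hF4]
    simp only [← Finset.sum_sub_distrib, ← Finset.sum_add_distrib]
    refine Finset.sum_congr rfl fun i _ => ?_
    rw [Nat.add_sub_cancel_left, sub_mul, cellSum_alive_succ,
      cellSum_alive_eq ξ n (Nat.le_add_left i l)]
    ring
  simp_rw [hdecomp]
  have mF : MemLp (fun ω => F1 ω - F2 ω - F3 ω - F4 ω - F5 ω) (ENNReal.ofReal p) P :=
    (((m1.sub m2).sub m3).sub m4).sub m5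
  refine ⟨mF, ?_⟩
  have i1 := integrable_abs_rpow_of_memLp hp0 m1
  have i2 := integrable_abs_rpow_of_memLp hp0 m2
  have i3 := integrable_abs_rpow_of_memLp hp0 m3
  have i4 := integrable_abs_rpow_of_memLp hp0 m4
  have i5 := integrable_abs_rpow_of_memLp hp0 m5
  have i12 : Integrable (fun ω => |F1 ω| ^ p + |F2 ω| ^ p) P := i1.add i2
  have i13 : Integrable (fun ω => |F1 ω| ^ p + |F2 ω| ^ p + |F3 ω| ^ p) P := i12.add i3
  have i14 : Integrable (fun ω => |F1 ω| ^ p + |F2 ω| ^ p + |F3 ω| ^ p + |F4 ω| ^ p) P :=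
    i13.add i4
  have i15 : Integrable (fun ω => |F1 ω| ^ p + |F2 ω| ^ p + |F3 ω| ^ p + |F4 ω| ^ p +
    |F5 ω| ^ p) P := i14.add i5
  refine (integral_mono (integrable_abs_rpow_of_memLp hp0 mF) (i15.const_mul (5 ^ (p - 1)))
    fun ω => abs_five_rpow_le _ _ _ _ _ (by linarith)).trans ?_
  rw [integral_const_mul, integral_add i14 i5, integral_add i13 i4, integral_add i12 i3,
    integral_add i1 i2]
  gcongr
  linarith

end CellModel

end Trawl

namespace Trawl

/-! ### The cells of a Lévy basis -/

/-- The points that belong to `A k`, `k ≤ n`, exactly for `i ≤ k ≤ j`, where `q = (i, j)`. -/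
def cellSet (A : ℕ → Set (ℝ × ℝ)) (n : ℕ) (q : ℕ × ℕ) : Set (ℝ × ℝ) :=
  {x | q.1 ≤ q.2 ∧ q.2 ≤ n ∧ ∀ k ≤ n, (x ∈ A k ↔ q.1 ≤ k ∧ k ≤ q.2)}

/-- A finite sequence of bounded Borel sets in which no point returns after having left. -/
structure IsInterlaced (A : ℕ → Set (ℝ × ℝ)) (n : ℕ) : Prop where
  measurableSet : ∀ k, MeasurableSet (A k)
  isBounded : ∀ k, Bornology.IsBounded (A k)
  mem_of_mem : ∀ i k j, i ≤ k → k ≤ j → j ≤ n → ∀ x, x ∈ A i → x ∈ A j → x ∈ A k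

theorem pairwise_disjoint_cellSet (A : ℕ → Set (ℝ × ℝ)) (n : ℕ) :
    Pairwise fun q q' => Disjoint (cellSet A n q) (cellSet A n q') := by
  intro q q' hqq
  rw [Set.disjoint_left]
  rintro x ⟨h1, h2, h3⟩ ⟨h1', h2', h3'⟩
  refine hqq ?_
  have a1 := (h3' q.1 (by omega)).1 ((h3 q.1 (by omega)).2 ⟨le_rfl, h1⟩)
  have a2 := (h3' q.2 (by omega)).1 ((h3 q.2 (by omega)).2 ⟨h1, le_rfl⟩)
  have a3 := (h3 q'.1 (by omega)).1 ((h3' q'.1 (by omega)).2 ⟨le_rfl, h1'⟩)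
  have a4 := (h3 q'.2 (by omega)).1 ((h3' q'.2 (by omega)).2 ⟨h1', le_rfl⟩)
  exact Prod.ext (by omega) (by omega)

namespace IsInterlaced

variable {A : ℕ → Set (ℝ × ℝ)} {n : ℕ}

theorem measurableSet_cellSet (hA : IsInterlaced A n) (q : ℕ × ℕ) :
    MeasurableSet (cellSet A n q) := by
  have hk : ∀ k, Measurable fun x => x ∈ A k := fun k => (hA.measurableSet k).mem
  have : cellSet A n q = {x | q.1 ≤ q.2} ∩ ({x | q.2 ≤ n} ∩
      ⋂ (k : ℕ) (_ : k ≤ n), {x | x ∈ A k ↔ q.1 ≤ k ∧ k ≤ q.2}) := by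
    ext x
    simp [cellSet]
  rw [this]
  refine (MeasurableSet.const _).inter ((MeasurableSet.const _).inter
    (MeasurableSet.iInter fun k => MeasurableSet.iInter fun _ => ?_))
  exact measurableSet_setOfPred.2 ((hk k).iff measurable_const)

theorem isBounded_cellSet (hA : IsInterlaced A n) (q : ℕ × ℕ) :
    Bornology.IsBounded (cellSet A n q) :=
  (hA.isBounded q.1).subset fun _ hx => (hx.2.2 q.1 (hx.1.trans hx.2.1)).2 ⟨le_rfl, hx.1⟩

theorem exists_mem_cellSet (hA : IsInterlaced A n) {k : ℕ} (hk : k ≤ n) {x : ℝ × ℝ}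
    (hx : x ∈ A k) : ∃ q : ℕ × ℕ, q.1 ≤ k ∧ k ≤ q.2 ∧ q.2 ≤ n ∧ x ∈ cellSet A n q := by
  classical
  have hex : ∃ i, x ∈ A i := ⟨k, hx⟩
  have h1 : x ∈ A (Nat.find hex) := Nat.find_spec hex
  have h2 : Nat.find hex ≤ k := Nat.find_min' hex hx
  have h3 : x ∈ A (Nat.findGreatest (fun i => x ∈ A i) n) :=
    Nat.findGreatest_spec (P := fun i => x ∈ A i) hk hx
  have h4 : k ≤ Nat.findGreatest (fun i => x ∈ A i) n := Nat.le_findGreatest hk hx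
  have h5 : Nat.findGreatest (fun i => x ∈ A i) n ≤ n := Nat.findGreatest_le n
  refine ⟨(Nat.find hex, Nat.findGreatest (fun i => x ∈ A i) n), h2, h4, h5, h2.trans h4, h5,
    fun j hj => ⟨fun hxj => ⟨Nat.find_min' hex hxj, Nat.le_findGreatest hj hxj⟩, fun hj' => ?_⟩⟩
  exact hA.mem_of_mem _ j _ hj'.1 hj'.2 h5 x h1 h3

theorem biUnion_alive (hA : IsInterlaced A n) {k : ℕ} (hk : k ≤ n) :
    ⋃ q ∈ aliveCells n k, cellSet A n q = A k := by
  ext x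
  simp only [mem_iUnion, exists_prop, aliveCells, grid, Finset.mem_filter, Finset.mem_product,
    Finset.mem_range]
  constructor
  · rintro ⟨q, ⟨-, hq⟩, hx⟩
    exact (hx.2.2 k hk).2 hq
  · intro hx
    obtain ⟨q, h1, h2, h3, h4⟩ := hA.exists_mem_cellSet hk hx
    exact ⟨q, ⟨⟨by omega, by omega⟩, h1, h2⟩, h4⟩

theorem biUnion_born_subset {k : ℕ} (hk : k < n) :
    ⋃ q ∈ bornCells n (k + 1), cellSet A n q ⊆ A (k + 1) \ A k := by
  intro x
  simp only [mem_iUnion, exists_prop, bornCells, Finset.mem_filter]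
  rintro ⟨q, ⟨-, hq⟩, hx⟩
  refine ⟨(hx.2.2 (k + 1) hk).2 (by omega), fun h => ?_⟩
  have := (hx.2.2 k hk.le).1 h
  omega

theorem biUnion_dying (hA : IsInterlaced A n) {m k : ℕ} (hm : m ≤ k) (hk : k < n) :
    ⋃ q ∈ dyingCells n m k, cellSet A n q = (A m ∩ A k) \ A (k + 1) := by
  ext x
  simp only [mem_iUnion, exists_prop, dyingCells, grid, Finset.mem_filter, Finset.mem_product,
    Finset.mem_range]
  constructor
  · rintro ⟨q, ⟨-, hq⟩, hx⟩
    have h1 := hx.1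
    refine ⟨?_, fun h => ?_⟩
    · by_cases h2 : m ≤ q.2
      · exact ⟨(hx.2.2 m (by omega)).2 ⟨hq.1, h2⟩, (hx.2.2 k hk.le).2 (by omega)⟩
      · omega
    · have := (hx.2.2 (k + 1) hk).1 h
      omega
  · rintro ⟨⟨hm', hk'⟩, hn⟩
    obtain ⟨q, h1, h2, h3, h4⟩ := hA.exists_mem_cellSet hk.le hk'
    have h5 := (h4.2.2 m (by omega)).1 hm'
    have h6 : ¬ (q.1 ≤ k + 1 ∧ k + 1 ≤ q.2) := fun h => hn ((h4.2.2 (k + 1) hk).2 h)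
    exact ⟨q, ⟨⟨by omega, by omega⟩, by omega, by omega⟩, h4⟩

theorem sum_volume_cellSet (hA : IsInterlaced A n) (S : Finset (ℕ × ℕ)) :
    ∑ q ∈ S, (volume (cellSet A n q)).toReal = (volume (⋃ q ∈ S, cellSet A n q)).toReal := by
  rw [measure_biUnion_finset (fun q _ q' _ h => pairwise_disjoint_cellSet A n h)
    (fun q _ => hA.measurableSet_cellSet q), ENNReal.toReal_sum]
  exact fun q _ => (hA.isBounded_cellSet q).measure_lt_top.ne

end IsInterlaced

variable {Ω : Type*} [MeasurableSpace Ω] {P : Measure Ω} {γ b : ℝ} {ν : Measure ℝ}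
  {L : Set (ℝ × ℝ) → Ω → ℝ} {m p : ℝ}

theorem IsLevyBasis.exists_cellModel (hL : IsLevyBasis P γ b ν L)
    (hm : HasMoments P L m (2 * p)) (hp : 2 ≤ p) (V : ℝ) :
    ∃ C, 0 ≤ C ∧ ∀ n A, IsInterlaced A n →
      CellModel P (fun q => centered L m (cellSet A n q))
        (fun q => (volume (cellSet A n q)).toReal) p V C := by
  obtain ⟨C1, h1, hC1⟩ := hm.moment_le p hp (by linarith) V
  obtain ⟨C2, h2, hC2⟩ := hm.moment_le 4 (by norm_num) (by linarith) V
  obtain ⟨C3, h3, hC3⟩ := hm.moment_le (2 * p) (by linarith) le_rfl V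
  refine ⟨C1 + C2 + C3, by positivity, fun n A hA => ?_⟩
  have hms := hA.measurableSet_cellSet
  have hbd := hA.isBounded_cellSet
  have hae := fun S : Finset (ℕ × ℕ) => hL.centered_biUnion_ae_eq m hms hbd
    (pairwise_disjoint_cellSet A n) S
  have hmS := fun S : Finset (ℕ × ℕ) => S.measurableSet_biUnion fun q _ => hms q
  have hbS := fun S : Finset (ℕ × ℕ) => (Bornology.isBounded_biUnion_finset S).2 fun q _ => hbd q
  constructor
  · exact fun q => hL.measurable_centered m (hms q) (hbd q)
  · exact hL.iIndepFun_centered m hms hbd (pairwise_disjoint_cellSet A n)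
  · exact fun q => ENNReal.toReal_nonneg
  · exact fun q => hm.memLp _ (hms q) (hbd q)
  · exact fun q => hm.mean _ (hms q) (hbd q)
  · intro S
    rw [hA.sum_volume_cellSet, ← hm.sq _ (hmS S) (hbS S)]
    refine integral_congr_ae ?_
    filter_upwards [hae S] with ω hω
    simp only [cellSum]
    rw [hω]
  · intro r hr S hS
    rw [hA.sum_volume_cellSet] at hS ⊢
    have e : ∫ ω, |cellSum (fun q => centered L m (cellSet A n q)) S ω| ^ r ∂P =
        ∫ ω, |centered L m (⋃ q ∈ S, cellSet A n q) ω| ^ r ∂P := by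
      refine integral_congr_ae ?_
      filter_upwards [hae S] with ω hω
      simp only [cellSum]
      rw [hω]
    have hv : 0 ≤ (volume (⋃ q ∈ S, cellSet A n q)).toReal := ENNReal.toReal_nonneg
    rw [e]
    rcases hr with rfl | rfl | rfl
    · refine (hC1 _ (hmS S) (hbS S) hS).trans (mul_le_mul_of_nonneg_right (by linarith) hv)
    · refine (hC2 _ (hmS S) (hbS S) hS).trans (mul_le_mul_of_nonneg_right (by linarith) hv)
    · refine (hC3 _ (hmS S) (hbS S) hS).trans (mul_le_mul_of_nonneg_right (by linarith) hv)

/-- The sum of lagged products `∑_{k=l}^{n-1} (x_{k-l} - x̄) (x_{k+1} - x_k)`. -/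
noncomputable def laggedSum (n l : ℕ) (x : ℕ → ℝ) : ℝ :=
  ∑ k ∈ Finset.Ico l n, (x (k - l) - 1 / (n : ℝ) * ∑ k ∈ Finset.range n, x k) * (x (k + 1) - x k)

theorem laggedSum_congr {n l : ℕ} {x y : ℕ → ℝ} (h : ∀ k ≤ n, x k = y k) :
    laggedSum n l x = laggedSum n l y := by
  unfold laggedSum
  rw [Finset.sum_congr rfl fun k hk => h k (Finset.mem_range.1 hk).le]
  refine Finset.sum_congr rfl fun k hk => ?_
  have := (Finset.mem_Ico.1 hk).2
  rw [h (k - l) (by omega), h (k + 1) (by omega), h k (by omega)]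

theorem laggedSum_sub_const {n : ℕ} (hn : 0 < n) (l : ℕ) (x : ℕ → ℝ) (c : ℝ) :
    laggedSum n l (fun k => x k - c) = laggedSum n l x := by
  have hn' : (n : ℝ) ≠ 0 := by positivity
  unfold laggedSum
  refine Finset.sum_congr rfl fun k _ => ?_
  rw [Finset.sum_sub_distrib, Finset.sum_const, Finset.card_range, nsmul_eq_mul, mul_sub]
  field_simp
  ring

theorem continuous_laggedSum (n l : ℕ) : Continuous (laggedSum n l) := by
  unfold laggedSum
  fun_prop

/-- The moment bound for the lagged products of the values of a centred Lévy basis on an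
interlaced sequence of sets, uniform in the sequence. -/
theorem IsLevyBasis.exists_laggedSum_moment_le [IsProbabilityMeasure P]
    (hL : IsLevyBasis P γ b ν L) (hm : HasMoments P L m (2 * p)) (hp : 2 ≤ p) (V : ℝ) :
    ∃ D, 0 ≤ D ∧ ∀ (n l : ℕ) (A : ℕ → Set (ℝ × ℝ)) (δ : ℝ), 0 < n → l ≤ n → 0 < δ →
      IsInterlaced A n → (∀ k ≤ n, (volume (A k)).toReal ≤ V) →
      (∀ k < n, (volume (A (k + 1) \ A k)).toReal ≤ δ) →
      (∀ k < n, (volume (A k \ A (k + 1))).toReal ≤ δ) →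
      ∫⁻ ω, ENNReal.ofReal (|laggedSum n l (fun k => centered L m (A k) ω) +
        ∑ k ∈ Finset.Ico l n, (volume ((A (k - l) ∩ A k) \ A (k + 1))).toReal| ^ p) ∂P ≤
      ENNReal.ofReal (D * (1 + n * δ + (n * δ) ^ (p / 2))) := by
  obtain ⟨C, hC, hmodel⟩ := hL.exists_cellModel hm hp V
  set D1 : ℝ := 5 ^ (p - 1) * 4 * |blockConst p V C| with hD1
  set D2 : ℝ := 5 ^ (p - 1) * (1 + 2 ^ (2 * p + 1)) * (C * |V|) with hD2
  refine ⟨D1 + D2, by positivity, fun n l A δ hn hl hδ hA hV hI hR => ?_⟩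
  have hcell := hmodel n A hA
  have hsub : ∀ {B B' : Set (ℝ × ℝ)}, B ⊆ B' → Bornology.IsBounded B' →
      (volume B).toReal ≤ (volume B').toReal := fun hBB hb =>
    ENNReal.toReal_mono hb.measure_lt_top.ne (measure_mono hBB)
  obtain ⟨h1, h2⟩ := hcell.integral_abs_estimator_le hp hC hδ hn hl
    (fun k hk => by
      rw [hA.sum_volume_cellSet, hA.biUnion_alive hk]
      exact hV k hk)
    (fun k hk => by
      rw [hA.sum_volume_cellSet]
      exact (hsub (IsInterlaced.biUnion_born_subset hk)
        ((hA.isBounded _).subset sdiff_subset)).trans (hI k hk))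
    (fun k hk => by
      rw [hA.sum_volume_cellSet, hA.biUnion_dying le_rfl hk, inter_self]
      exact hR k hk)
  have hw : ∑ k ∈ Finset.Ico l n, ∑ q ∈ dyingCells n (k - l) k,
      (volume (cellSet A n q)).toReal =
      ∑ k ∈ Finset.Ico l n, (volume ((A (k - l) ∩ A k) \ A (k + 1))).toReal := by
    refine Finset.sum_congr rfl fun k hk => ?_
    rw [hA.sum_volume_cellSet, hA.biUnion_dying (Nat.sub_le k l) (Finset.mem_Ico.1 hk).2]
  rw [hw] at h1 h2
  have hX : ∀ᵐ ω ∂P, ∀ k ≤ n, centered L m (A k) ω =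
      cellSum (fun q => centered L m (cellSet A n q)) (aliveCells n k) ω := by
    rw [ae_all_iff]
    intro k
    by_cases hk : k ≤ n
    · filter_upwards [hL.centered_biUnion_ae_eq m hA.measurableSet_cellSet hA.isBounded_cellSet
        (pairwise_disjoint_cellSet A n) (aliveCells n k)] with ω hω _
      rw [hA.biUnion_alive hk] at hω
      exact hω
    · exact ae_of_all _ fun ω h => absurd h hk
  have hcongr : ∫⁻ ω, ENNReal.ofReal (|laggedSum n l (fun k => centered L m (A k) ω) +
        ∑ k ∈ Finset.Ico l n, (volume ((A (k - l) ∩ A k) \ A (k + 1))).toReal| ^ p) ∂P =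
      ∫⁻ ω, ENNReal.ofReal (|laggedSum n l (fun k =>
        cellSum (fun q => centered L m (cellSet A n q)) (aliveCells n k) ω) +
        ∑ k ∈ Finset.Ico l n, (volume ((A (k - l) ∩ A k) \ A (k + 1))).toReal| ^ p) ∂P := by
    refine lintegral_congr_ae ?_
    filter_upwards [hX] with ω hω
    rw [laggedSum_congr hω]
  rw [hcongr]
  unfold laggedSum
  rw [← ofReal_integral_eq_lintegral_ofReal (integrable_abs_rpow_of_memLp (by linarith) h1)
    (ae_of_all _ fun ω => by positivity)]
  refine ENNReal.ofReal_le_ofReal (h2.trans ?_)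
  have hτ : 0 ≤ n * δ + (n * δ) ^ (p / 2) := by positivity
  have b1 : 5 ^ (p - 1) * (4 * (blockConst p V C * (n * δ + (n * δ) ^ (p / 2)))) ≤
      D1 * (n * δ + (n * δ) ^ (p / 2)) := by
    have : 5 ^ (p - 1) * (4 * (blockConst p V C * (n * δ + (n * δ) ^ (p / 2)))) =
      5 ^ (p - 1) * 4 * blockConst p V C * (n * δ + (n * δ) ^ (p / 2)) := by ring
    rw [this, hD1]
    gcongr
    exact le_abs_self _
  have b2 : 5 ^ (p - 1) * ((1 + 2 ^ (2 * p + 1)) * (C * V)) ≤ D2 := by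
    rw [hD2, mul_assoc]
    gcongr
    exact le_abs_self _
  have hD1' : 0 ≤ D1 := by positivity
  have hD2' : 0 ≤ D2 := by positivity
  nlinarith

end Trawl

namespace Trawl

/-! ### Geometry of trawl sets -/

section Geometry

variable {a : ℝ → ℝ}

theorem mem_trawlSetAt {t : ℝ} {p : ℝ × ℝ} :
    p ∈ trawlSetAt a t ↔ p.1 ≤ t ∧ 0 ≤ p.2 ∧ p.2 ≤ a (max (t - p.1) 0) := by
  simp only [trawlSetAt, trawlSet, mem_image, mem_ofPred_eq, Prod.exists]
  constructor
  · rintro ⟨x, y, ⟨h1, h2, h3⟩, rfl⟩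
    simp only [Prod.mk_add_mk, add_zero]
    refine ⟨by linarith, h2, ?_⟩
    rwa [show t - (x + t) = -x by ring, max_eq_left (by linarith)]
  · rintro ⟨h1, h2, h3⟩
    refine ⟨p.1 - t, p.2, ⟨by linarith, h2, ?_⟩, by ext <;> simp⟩
    rwa [show -(p.1 - t) = t - p.1 by ring, ← max_eq_left (by linarith : 0 ≤ t - p.1)]

/-- The extension of a trawl function to the line that is constant on the negative half-line. -/
theorem IsTrawlFunction.continuous_ext (ha : IsTrawlFunction a) :
    Continuous fun s => a (max s 0) :=
  ha.continuous.comp_continuous (by fun_prop) fun s => mem_Ici.2 (le_max_right s 0)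

theorem IsTrawlFunction.antitone_ext (ha : IsTrawlFunction a) : Antitone fun s => a (max s 0) :=
  fun _ _ hst => ha.antitone (mem_Ici.2 (le_max_right _ 0)) (mem_Ici.2 (le_max_right _ 0))
    (max_le_max_right 0 hst)

theorem IsTrawlFunction.nonneg_ext (ha : IsTrawlFunction a) (s : ℝ) : 0 ≤ a (max s 0) :=
  ha.nonneg _ (le_max_right s 0)

theorem IsTrawlFunction.measurableSet_trawlSetAt (ha : IsTrawlFunction a) (t : ℝ) :
    MeasurableSet (trawlSetAt a t) := by
  have hc := ha.continuous_ext
  have : trawlSetAt a t = {p | p.1 ≤ t} ∩ ({p | 0 ≤ p.2} ∩ {p | p.2 ≤ a (max (t - p.1) 0)}) := by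
    ext p
    simp [mem_trawlSetAt]
  rw [this]
  refine ((isClosed_le (by fun_prop) (by fun_prop)).inter ((isClosed_le (by fun_prop)
    (by fun_prop)).inter (isClosed_le (by fun_prop) ?_))).measurableSet
  exact hc.comp (by fun_prop : Continuous fun p : ℝ × ℝ => t - p.1)

theorem IsTrawlFunction.mem_of_mem (ha : IsTrawlFunction a) {s t u : ℝ} (hst : s ≤ t) (htu : t ≤ u)
    {x : ℝ × ℝ} (hs : x ∈ trawlSetAt a s) (hu : x ∈ trawlSetAt a u) : x ∈ trawlSetAt a t := by
  rw [mem_trawlSetAt] at hs hu ⊢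
  exact ⟨hs.1.trans hst, hs.2.1, hu.2.2.trans (ha.antitone_ext (by linarith))⟩

theorem IsTrawlFunction.volume_inter (ha : IsTrawlFunction a) {s t : ℝ} (hst : s ≤ t) :
    volume (trawlSetAt a s ∩ trawlSetAt a t) =
      ∫⁻ u in Ici (t - s), ENNReal.ofReal (a (max u 0)) := by
  have hm := (ha.measurableSet_trawlSetAt s).inter (ha.measurableSet_trawlSetAt t)
  have hs : ∀ r : ℝ, volume (Prod.mk r ⁻¹' (trawlSetAt a s ∩ trawlSetAt a t)) =
      (Ici (t - s)).indicator (fun u => ENNReal.ofReal (a (max u 0))) (t - r) := fun r => by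
    by_cases hr : r ≤ s
    · have : Prod.mk r ⁻¹' (trawlSetAt a s ∩ trawlSetAt a t) = Icc 0 (a (max (t - r) 0)) := by
        ext y
        simp only [mem_preimage, mem_inter_iff, mem_trawlSetAt, mem_Icc]
        have h1 : a (max (t - r) 0) ≤ a (max (s - r) 0) := ha.antitone_ext (by linarith)
        constructor
        · exact fun h => ⟨h.1.2.1, h.2.2.2⟩
        · exact fun h => ⟨⟨hr, h.1, h.2.trans h1⟩, by linarith, h.1, h.2⟩
      rw [this, indicator_of_mem (mem_Ici.2 (by linarith)), Real.volume_Icc, sub_zero]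
    · have : Prod.mk r ⁻¹' (trawlSetAt a s ∩ trawlSetAt a t) = ∅ := by
        ext y
        simp only [mem_preimage, mem_inter_iff, mem_trawlSetAt, mem_empty_iff_false, iff_false]
        exact fun h => hr h.1.1
      rw [this, indicator_of_notMem (fun h => hr (by linarith [mem_Ici.1 h])), measure_empty]
  rw [Measure.volume_eq_prod, Measure.prod_apply hm]
  simp_rw [hs]
  rw [lintegral_sub_left_eq_self (fun u => (Ici (t - s)).indicator
    (fun u => ENNReal.ofReal (a (max u 0))) u) t, lintegral_indicator measurableSet_Ici]

theorem IsTrawlFunction.tail_lt_top (ha : IsTrawlFunction a) {x : ℝ} (hx : 0 ≤ x) :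
    ∫⁻ u in Ici x, ENNReal.ofReal (a (max u 0)) < ∞ := by
  have h1 : ∫⁻ u in Ici 0, ENNReal.ofReal (a (max u 0)) < ∞ := by
    rw [setLIntegral_congr_fun measurableSet_Ici (g := fun u => ENNReal.ofReal (a u))
      fun u hu => by rw [max_eq_left (mem_Ici.1 hu)]]
    exact ha.integrable.lintegral_lt_top
  exact (lintegral_mono_set (Ici_subset_Ici.2 hx)).trans_lt h1

theorem IsTrawlFunction.volume_trawlSetAt (ha : IsTrawlFunction a) (t : ℝ) :
    volume (trawlSetAt a t) = ∫⁻ u in Ici 0, ENNReal.ofReal (a (max u 0)) := by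
  have := ha.volume_inter (le_refl t)
  rwa [inter_self, sub_self] at this

theorem IsTrawlFunction.volume_lt_top (ha : IsTrawlFunction a) (t : ℝ) :
    volume (trawlSetAt a t) < ∞ := by
  rw [ha.volume_trawlSetAt]
  exact ha.tail_lt_top le_rfl

theorem tail_eq_add (a : ℝ → ℝ) {x y : ℝ} (hxy : x ≤ y) :
    ∫⁻ u in Ici x, ENNReal.ofReal (a (max u 0)) =
      (∫⁻ u in Ico x y, ENNReal.ofReal (a (max u 0))) +
        ∫⁻ u in Ici y, ENNReal.ofReal (a (max u 0)) := by
  have hd : Disjoint (Ico x y) (Ici y) := by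
    rw [Set.disjoint_left]
    exact fun u h1 h2 => absurd h1.2 (not_lt.2 h2)
  rw [← Ico_union_Ici_eq_Ici hxy, lintegral_union measurableSet_Ici hd]

/-- The points of the trawl sets at `u ≤ s` that have left at time `t ≥ s`. -/
theorem IsTrawlFunction.volume_inter_diff (ha : IsTrawlFunction a) {u s t : ℝ} (hus : u ≤ s)
    (hst : s ≤ t) : volume ((trawlSetAt a u ∩ trawlSetAt a s) \ trawlSetAt a t) =
      ∫⁻ r in Ico (s - u) (t - u), ENNReal.ofReal (a (max r 0)) := by
  have e : (trawlSetAt a u ∩ trawlSetAt a s) \ trawlSetAt a t =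
      (trawlSetAt a u ∩ trawlSetAt a s) \ (trawlSetAt a u ∩ trawlSetAt a t) := by
    ext x
    simp only [Set.mem_sdiff, mem_inter_iff]
    tauto
  have hfin := ha.tail_lt_top (by linarith : 0 ≤ t - u)
  have hsub : trawlSetAt a u ∩ trawlSetAt a t ⊆ trawlSetAt a u ∩ trawlSetAt a s := fun x hx =>
    ⟨hx.1, ha.mem_of_mem hus hst hx.1 hx.2⟩
  rw [e, measure_sdiff hsub
    ((ha.measurableSet_trawlSetAt u).inter (ha.measurableSet_trawlSetAt t)).nullMeasurableSet
    (by rw [ha.volume_inter (hus.trans hst)]; exact hfin.ne), ha.volume_inter hus,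
    ha.volume_inter (hus.trans hst), tail_eq_add a (by linarith : s - u ≤ t - u)]
  exact ENNReal.add_sub_cancel_right hfin.ne

theorem IsTrawlFunction.lintegral_Ico_le (ha : IsTrawlFunction a) {x y : ℝ} :
    ∫⁻ r in Ico x y, ENNReal.ofReal (a (max r 0)) ≤
      ENNReal.ofReal (a (max x 0)) * ENNReal.ofReal (y - x) := by
  refine (setLIntegral_mono measurable_const fun r hr =>
    ENNReal.ofReal_le_ofReal (ha.antitone_ext hr.1)).trans ?_
  rw [setLIntegral_const, Real.volume_Ico]

theorem IsTrawlFunction.le_lintegral_Ico (ha : IsTrawlFunction a) {x y : ℝ} :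
    ENNReal.ofReal (a (max y 0)) * ENNReal.ofReal (y - x) ≤
      ∫⁻ r in Ico x y, ENNReal.ofReal (a (max r 0)) := by
  rw [← Real.volume_Ico, ← setLIntegral_const]
  exact setLIntegral_mono (ENNReal.measurable_ofReal.comp ha.continuous_ext.measurable)
    fun r hr => ENNReal.ofReal_le_ofReal (ha.antitone_ext hr.2.le)

theorem IsTrawlFunction.volume_inter_diff_le (ha : IsTrawlFunction a) {u s t : ℝ} (hus : u ≤ s)
    (hst : s ≤ t) : (volume ((trawlSetAt a u ∩ trawlSetAt a s) \ trawlSetAt a t)).toReal ≤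
      a (max (s - u) 0) * (t - s) := by
  have h0 := ha.nonneg_ext (s - u)
  refine ENNReal.toReal_le_of_le_ofReal (mul_nonneg h0 (by linarith)) ?_
  rw [ha.volume_inter_diff hus hst, ENNReal.ofReal_mul h0]
  refine ha.lintegral_Ico_le.trans (le_of_eq ?_)
  congr 2
  ring

theorem IsTrawlFunction.le_volume_inter_diff (ha : IsTrawlFunction a) {u s t : ℝ} (hus : u ≤ s)
    (hst : s ≤ t) : a (max (t - u) 0) * (t - s) ≤
      (volume ((trawlSetAt a u ∩ trawlSetAt a s) \ trawlSetAt a t)).toReal := by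
  have h0 := ha.nonneg_ext (t - u)
  have hfin : volume ((trawlSetAt a u ∩ trawlSetAt a s) \ trawlSetAt a t) ≠ ∞ :=
    ((measure_mono (sdiff_subset.trans inter_subset_left)).trans_lt (ha.volume_lt_top u)).ne
  rw [← ENNReal.ofReal_le_iff_le_toReal hfin, ha.volume_inter_diff hus hst, ENNReal.ofReal_mul h0]
  refine le_trans (le_of_eq ?_) ha.le_lintegral_Ico
  congr 2
  ring

theorem IsTrawlFunction.volume_diff_le (ha : IsTrawlFunction a) {s t : ℝ} (hst : s ≤ t) :
    (volume (trawlSetAt a s \ trawlSetAt a t)).toReal ≤ a 0 * (t - s) := by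
  have := ha.volume_inter_diff_le (le_refl s) hst
  rwa [inter_self, sub_self, max_self] at this

theorem IsTrawlFunction.volume_diff_le' (ha : IsTrawlFunction a) {s t : ℝ} (hst : s ≤ t) :
    (volume (trawlSetAt a t \ trawlSetAt a s)).toReal ≤ a 0 * (t - s) := by
  have e : volume (trawlSetAt a t \ trawlSetAt a s) = volume (trawlSetAt a s \ trawlSetAt a t) := by
    have ms := ha.measurableSet_trawlSetAt s
    have mt := ha.measurableSet_trawlSetAt t
    have h1 := measure_inter_add_sdiff (μ := volume) (trawlSetAt a t) ms
    have h2 := measure_inter_add_sdiff (μ := volume) (trawlSetAt a s) mt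
    have hfin : volume (trawlSetAt a t ∩ trawlSetAt a s) ≠ ∞ :=
      ((measure_mono inter_subset_left).trans_lt (ha.volume_lt_top t)).ne
    rw [ha.volume_trawlSetAt t, ← ha.volume_trawlSetAt s, ← h2,
      inter_comm (trawlSetAt a s)] at h1
    exact (ENNReal.add_right_inj hfin).1 h1
  rw [e]
  exact ha.volume_diff_le hst

/-- The square `[-K, K]²`. -/
def box (K : ℕ) : Set (ℝ × ℝ) := Icc (-(K : ℝ)) K ×ˢ Icc (-(K : ℝ)) K

theorem measurableSet_box (K : ℕ) : MeasurableSet (box K) :=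
  measurableSet_Icc.prod measurableSet_Icc

theorem isBounded_box (K : ℕ) : Bornology.IsBounded (box K) :=
  (Metric.isBounded_Icc _ _).prod (Metric.isBounded_Icc _ _)

theorem tendsto_volume_inter_box {B : Set (ℝ × ℝ)} (hB : volume B ≠ ∞) :
    Tendsto (fun K => (volume (B ∩ box K)).toReal) atTop (𝓝 (volume B).toReal) := by
  have hmono : Monotone fun K => B ∩ box K := fun K K' hK => by
    have : (K : ℝ) ≤ K' := by exact_mod_cast hK
    refine inter_subset_inter_right B (prod_mono ?_ ?_) <;>
      exact Icc_subset_Icc (by linarith) this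
  have hU : ⋃ K, B ∩ box K = B := by
    rw [← inter_iUnion, inter_eq_left]
    intro x _
    obtain ⟨K, hK⟩ := exists_nat_ge (max |x.1| |x.2|)
    have h1 := abs_le.1 ((le_max_left _ _).trans hK)
    have h2 := abs_le.1 ((le_max_right _ _).trans hK)
    exact mem_iUnion.2 ⟨K, h1, h2⟩
  have := tendsto_measure_iUnion_atTop (μ := volume) hmono
  rw [hU] at this
  exact (ENNReal.tendsto_toReal hB).comp this

theorem IsTrawlFunction.isInterlaced (ha : IsTrawlFunction a) {Δ : ℝ} (hΔ : 0 ≤ Δ) (n K : ℕ) :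
    IsInterlaced (fun k => trawlSetAt a (k * Δ) ∩ box K) n where
  measurableSet k := (ha.measurableSet_trawlSetAt _).inter (measurableSet_box K)
  isBounded k := (isBounded_box K).subset inter_subset_right
  mem_of_mem i k j hik hkj _ x hi hj := by
    have h1 : (i : ℝ) ≤ k := by exact_mod_cast hik
    have h2 : (k : ℝ) ≤ j := by exact_mod_cast hkj
    exact ⟨ha.mem_of_mem (by gcongr) (by gcongr) hi.1 hj.1, hi.2⟩

end Geometry

/-! ### Removal of the truncation -/

theorem exists_common_subseq {α : Type*} [MeasurableSpace α] {μ : Measure α}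
    {f : ℕ → ℕ → α → ℝ} {g : ℕ → α → ℝ} (h : ∀ k, TendstoInMeasure μ (f k) atTop (g k)) (N : ℕ) :
    ∃ ns : ℕ → ℕ, StrictMono ns ∧ ∀ k < N, ∀ᵐ x ∂μ,
      Tendsto (fun i => f k (ns i) x) atTop (𝓝 (g k x)) := by
  induction N with
  | zero => exact ⟨id, strictMono_id, fun k hk => absurd hk (Nat.not_lt_zero k)⟩
  | succ N ih =>
    obtain ⟨ns, hns, hae⟩ := ih
    have h1 : TendstoInMeasure μ (fun i => f N (ns i)) atTop (g N) := fun ε hε =>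
      (h N ε hε).comp hns.tendsto_atTop
    obtain ⟨ms, hms, hae'⟩ := h1.exists_seq_tendsto_ae
    refine ⟨ns ∘ ms, hns.comp hms, fun k hk => ?_⟩
    rcases Nat.lt_succ_iff_lt_or_eq.1 hk with hk | rfl
    · filter_upwards [hae k hk] with x hx
      exact hx.comp hms.tendsto_atTop
    · exact hae'

variable {Ω : Type*} [MeasurableSpace Ω] {P : Measure Ω} {γ b : ℝ} {ν : Measure ℝ}
  {L : Set (ℝ × ℝ) → Ω → ℝ} {m p : ℝ} {a : ℝ → ℝ} {X : ℝ → Ω → ℝ}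

theorem IsLevyBasis.measurable_inter_box (hL : IsLevyBasis P γ b ν L) (ha : IsTrawlFunction a)
    (t : ℝ) (K : ℕ) : Measurable (L (trawlSetAt a t ∩ box K)) :=
  hL.measurable _ ((ha.measurableSet_trawlSetAt t).inter (measurableSet_box K))
    ((isBounded_box K).subset inter_subset_right)

theorem IsTrawlProcess.aemeasurable (hX : IsTrawlProcess P L a X) (hL : IsLevyBasis P γ b ν L)
    (ha : IsTrawlFunction a) (t : ℝ) : AEMeasurable (X t) P :=
  TendstoInMeasure.aemeasurable (fun K => (hL.measurable_inter_box ha t K).aemeasurable) (hX t)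

theorem IsTrawlProcess.exists_laggedSum_moment_le [IsProbabilityMeasure P]
    (hX : IsTrawlProcess P L a X) (hL : IsLevyBasis P γ b ν L)
    (hm : HasMoments P L m (2 * p)) (hp : 2 ≤ p) (ha : IsTrawlFunction a) :
    ∃ D, 0 ≤ D ∧ ∀ (n l : ℕ) (Δ : ℝ), 0 < n → l ≤ n → 0 < Δ →
      ∫⁻ ω, ENNReal.ofReal (|laggedSum n l (fun k => X (k * Δ) ω) +
        ∑ k ∈ Finset.Ico l n, (volume ((trawlSetAt a ((k - l : ℕ) * Δ) ∩ trawlSetAt a (k * Δ)) \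
          trawlSetAt a ((k + 1 : ℕ) * Δ))).toReal| ^ p) ∂P ≤
      ENNReal.ofReal (D * (1 + n * ((a 0 + 1) * Δ) + (n * ((a 0 + 1) * Δ)) ^ (p / 2))) := by
  set V := (volume (trawlSetAt a 0)).toReal with hV
  obtain ⟨D, hD, hbound⟩ := hL.exists_laggedSum_moment_le hm hp V
  refine ⟨D, hD, fun n l Δ hn hl hΔ => ?_⟩
  have hvol : ∀ t, volume (trawlSetAt a t) = volume (trawlSetAt a 0) := fun t => by
    rw [ha.volume_trawlSetAt, ha.volume_trawlSetAt]
  have hfin := fun t => (ha.volume_lt_top t).ne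
  set T : ℕ → Set (ℝ × ℝ) := fun k => trawlSetAt a (k * Δ) with hT
  set A : ℕ → ℕ → Set (ℝ × ℝ) := fun K k => T k ∩ box K with hA
  have hstep : ∀ k : ℕ, (k : ℝ) * Δ ≤ (k + 1 : ℕ) * Δ := fun k => by
    push_cast
    nlinarith
  have hstep' : ∀ k : ℕ, ((k + 1 : ℕ) : ℝ) * Δ - k * Δ = Δ := fun k => by
    push_cast
    ring
  have ha0 := ha.nonneg 0 le_rfl
  have hδ : a 0 * Δ ≤ (a 0 + 1) * Δ := by nlinarith
  have hdiff : ∀ (B B' : Set (ℝ × ℝ)) (K : ℕ), (B ∩ box K) \ (B' ∩ box K) ⊆ B \ B' := by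
    rintro B B' K x ⟨⟨h1, h2⟩, h3⟩
    exact ⟨h1, fun h => h3 ⟨h, h2⟩⟩
  set B := ENNReal.ofReal (D * (1 + n * ((a 0 + 1) * Δ) + (n * ((a 0 + 1) * Δ)) ^ (p / 2))) with hB
  have hK : ∀ K, ∫⁻ ω, ENNReal.ofReal (|laggedSum n l (fun k => centered L m (A K k) ω) +
        ∑ k ∈ Finset.Ico l n, (volume ((A K (k - l) ∩ A K k) \ A K (k + 1))).toReal| ^ p) ∂P ≤
        B := by
    intro K
    refine hbound n l (A K) _ hn hl (by positivity) (ha.isInterlaced hΔ.le n K) (fun k _ => ?_)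
      (fun k _ => ?_) (fun k _ => ?_)
    · rw [hV, ← hvol (k * Δ)]
      exact ENNReal.toReal_mono (hfin _) (measure_mono inter_subset_left)
    · refine (ENNReal.toReal_mono ?_ (measure_mono (hdiff _ _ K))).trans
        ((ha.volume_diff_le' (hstep k)).trans ?_)
      · exact ((measure_mono sdiff_subset).trans_lt (ha.volume_lt_top _)).ne
      · rwa [hstep']
    · refine (ENNReal.toReal_mono ?_ (measure_mono (hdiff _ _ K))).trans
        ((ha.volume_diff_le (hstep k)).trans ?_)
      · exact ((measure_mono sdiff_subset).trans_lt (ha.volume_lt_top _)).ne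
      · rwa [hstep']
  obtain ⟨ns, hns, hae⟩ := exists_common_subseq (μ := P)
    (f := fun k K => L (trawlSetAt a (k * Δ) ∩ box K)) (g := fun k => X (k * Δ))
    (fun k => hX (k * Δ)) (n + 1)
  have hw : Tendsto (fun i => ∑ k ∈ Finset.Ico l n,
      (volume ((A (ns i) (k - l) ∩ A (ns i) k) \ A (ns i) (k + 1))).toReal) atTop
      (𝓝 (∑ k ∈ Finset.Ico l n, (volume ((T (k - l) ∩ T k) \ T (k + 1))).toReal)) := by
    refine tendsto_finsetSum _ fun k _ => ?_
    have e : ∀ K, (A K (k - l) ∩ A K k) \ A K (k + 1) =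
        ((T (k - l) ∩ T k) \ T (k + 1)) ∩ box K := fun K => by
      ext x
      simp only [hA, Set.mem_sdiff, mem_inter_iff]
      tauto
    simp_rw [e]
    refine (tendsto_volume_inter_box ?_).comp hns.tendsto_atTop
    exact ((measure_mono (sdiff_subset.trans inter_subset_right)).trans_lt
      (ha.volume_lt_top _)).ne
  have hlim : ∀ᵐ ω ∂P, Tendsto (fun i => ENNReal.ofReal
      (|laggedSum n l (fun k => centered L m (A (ns i) k) ω) + ∑ k ∈ Finset.Ico l n,
        (volume ((A (ns i) (k - l) ∩ A (ns i) k) \ A (ns i) (k + 1))).toReal| ^ p)) atTop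
      (𝓝 (ENNReal.ofReal (|laggedSum n l (fun k => X (k * Δ) ω) +
        ∑ k ∈ Finset.Ico l n, (volume ((T (k - l) ∩ T k) \ T (k + 1))).toReal| ^ p))) := by
    have hae' : ∀ᵐ ω ∂P, ∀ k < n + 1, Tendsto (fun i => L (trawlSetAt a (k * Δ) ∩ box (ns i)) ω)
        atTop (𝓝 (X (k * Δ) ω)) := by
      rw [ae_all_iff]
      intro k
      by_cases hk : k < n + 1
      · filter_upwards [hae k hk] with ω hω _ using hω
      · exact ae_of_all _ fun ω h => absurd h hk
    filter_upwards [hae'] with ω hω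
    -- indices beyond the sample are frozen so that the convergence holds in the product
    set x : ℕ → ℕ → ℝ := fun i k => if k ≤ n then centered L m (A (ns i) k) ω else 0 with hx
    set y : ℕ → ℝ := fun k => if k ≤ n then X (k * Δ) ω - m * V else 0 with hy
    have hxy : Tendsto x atTop (𝓝 y) := by
      rw [tendsto_pi_nhds]
      intro k
      by_cases hk : k ≤ n
      · simp only [hx, hy, hk, if_true]
        have hv := (tendsto_volume_inter_box (hfin (k * Δ))).comp hns.tendsto_atTop
        rw [hvol, ← hV] at hv
        exact (hω k (Nat.lt_succ_of_le hk)).sub (hv.const_mul m)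
      · simp only [hx, hy, hk, if_false]
        exact tendsto_const_nhds
    have h1 := ((continuous_laggedSum n l).tendsto y).comp hxy
    have e1 : ∀ i, laggedSum n l (x i) = laggedSum n l (fun k => centered L m (A (ns i) k) ω) :=
      fun i => laggedSum_congr fun k hk => by simp [hx, hk]
    have e2 : laggedSum n l y = laggedSum n l (fun k => X (k * Δ) ω) := by
      rw [← laggedSum_sub_const hn l (fun k => X (k * Δ) ω) (m * V)]
      exact laggedSum_congr fun k hk => by simp [hy, hk]
    simp only [Function.comp_def, e1, e2] at h1
    refine (ENNReal.continuous_ofReal.tendsto _).comp ?_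
    exact ((continuous_abs.tendsto _).comp (h1.add hw)).rpow_const (Or.inr (by linarith))
  have hmeas : ∀ i, Measurable fun ω => ENNReal.ofReal
      (|laggedSum n l (fun k => centered L m (A (ns i) k) ω) + ∑ k ∈ Finset.Ico l n,
        (volume ((A (ns i) (k - l) ∩ A (ns i) k) \ A (ns i) (k + 1))).toReal| ^ p) := fun i => by
    have h1 : Measurable fun ω => (fun k => centered L m (A (ns i) k) ω) :=
      measurable_pi_lambda _ fun k => (hL.measurable_inter_box ha (k * Δ) (ns i)).sub_const _
    have h2 : Measurable fun ω => laggedSum n l (fun k => centered L m (A (ns i) k) ω) :=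
      (continuous_laggedSum n l).measurable.comp h1
    fun_prop
  calc ∫⁻ ω, ENNReal.ofReal (|laggedSum n l (fun k => X (k * Δ) ω) +
        ∑ k ∈ Finset.Ico l n, (volume ((T (k - l) ∩ T k) \ T (k + 1))).toReal| ^ p) ∂P
      = ∫⁻ ω, liminf (fun i => ENNReal.ofReal
      (|laggedSum n l (fun k => centered L m (A (ns i) k) ω) + ∑ k ∈ Finset.Ico l n,
        (volume ((A (ns i) (k - l) ∩ A (ns i) k) \ A (ns i) (k + 1))).toReal| ^ p)) atTop ∂P :=
        lintegral_congr_ae (by filter_upwards [hlim] with ω hω using hω.liminf_eq.symm)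
    _ ≤ _ := lintegral_liminf_le hmeas
    _ ≤ liminf (fun _ : ℕ => B) atTop := liminf_le_liminf (Eventually.of_forall fun i => hK (ns i))
    _ = B := liminf_const B

end Trawl

namespace Trawl

/-! ### Consistency of the estimator in `L^p` -/

variable {Ω : Type*} [MeasurableSpace Ω] {P : Measure Ω} {γ b : ℝ} {ν : Measure ℝ}
  {L : Set (ℝ × ℝ) → Ω → ℝ} {m p : ℝ} {a : ℝ → ℝ} {X : ℝ → Ω → ℝ} {Δ : ℕ → ℝ}

theorem aHat_eq_laggedSum {Ω : Type*} (X : ℝ → Ω → ℝ) (Δ : ℕ → ℝ) {n : ℕ} (hΔ : Δ n ≠ 0)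
    (l : ℕ) (ω : Ω) :
    aHat X Δ n (l * Δ n) ω =
      -(1 / (n * Δ n)) * laggedSum n l (fun k => X (k * Δ n) ω) := by
  have hfl : ⌊(l : ℝ) * Δ n / Δ n⌋₊ = l := by
    rw [mul_div_cancel_right₀ _ hΔ, Nat.floor_natCast]
  unfold aHat laggedSum sampleMean
  rw [hfl]
  congr 1
  refine Finset.sum_congr rfl fun k hk => ?_
  beta_reduce
  rw [Nat.cast_sub (Finset.mem_Ico.1 hk).1]
  push_cast
  rfl

theorem IsTrawlFunction.eventually_abs_mean_volume_sub_le (ha : IsTrawlFunction a)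
    (hΔ : IsInfillLongSpan Δ) {T : ℝ} (hT : 0 < T) {η : ℝ} (hη : 0 < η) :
    ∀ᶠ n in atTop, ∀ l : ℕ, l * Δ n ≤ T → |1 / (n * Δ n) * (∑ k ∈ Finset.Ico l n,
      (volume ((trawlSetAt a ((k - l : ℕ) * Δ n) ∩ trawlSetAt a (k * Δ n)) \
          trawlSetAt a ((k + 1 : ℕ) * Δ n))).toReal) - a (l * Δ n)| ≤ η := by
  have huc : UniformContinuousOn (fun s => a (max s 0)) (Icc 0 (T + 1)) :=
    isCompact_Icc.uniformContinuousOn_of_continuous ha.continuous_ext.continuousOn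
  rw [Metric.uniformContinuousOn_iff] at huc
  obtain ⟨d, hd, huc⟩ := huc (η / 2) (by positivity)
  have ha0 := ha.nonneg 0 le_rfl
  filter_upwards [hΔ.infill.eventually (gt_mem_nhds hd), hΔ.infill.eventually
    (gt_mem_nhds zero_lt_one), hΔ.longSpan.eventually_ge_atTop (max T (2 * T * a 0 / η)),
    hΔ.longSpan.eventually_gt_atTop 0] with n h1 h2 h3 h4 l hl
  have hpos := hΔ.pos n
  have hnT : T ≤ n * Δ n := (le_max_left _ _).trans h3
  have hnT2 : 2 * T * a 0 / η ≤ n * Δ n := (le_max_right _ _).trans h3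
  have hln : l ≤ n := by
    have : (l : ℝ) * Δ n ≤ n * Δ n := hl.trans hnT
    exact_mod_cast le_of_mul_le_mul_right this hpos
  have hl0 : 0 ≤ l * Δ n := by positivity
  have hl1 : 0 ≤ l * Δ n + Δ n := by positivity
  have hcard : ((Finset.Ico l n).card : ℝ) = n - l := by
    rw [Nat.card_Ico, Nat.cast_sub hln]
  set β : ℕ → ℝ := fun k =>
    (volume ((trawlSetAt a ((k - l : ℕ) * Δ n) ∩ trawlSetAt a (k * Δ n)) \
          trawlSetAt a ((k + 1 : ℕ) * Δ n))).toReal with hβ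
  have hgeom : ∀ k ∈ Finset.Ico l n, β k ≤ a (l * Δ n) * Δ n ∧
      a (l * Δ n + Δ n) * Δ n ≤ β k := fun k hk => by
    have hlk := (Finset.mem_Ico.1 hk).1
    have e1 : ((k - l : ℕ) : ℝ) = k - l := Nat.cast_sub hlk
    have o1 : ((k - l : ℕ) : ℝ) * Δ n ≤ k * Δ n := by
      gcongr
      exact Nat.sub_le k l
    have o2 : (k : ℝ) * Δ n ≤ (k + 1 : ℕ) * Δ n := by
      gcongr
      exact Nat.le_succ k
    have g1 := ha.volume_inter_diff_le o1 o2
    have g2 := ha.le_volume_inter_diff o1 o2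
    have e2 : (k : ℝ) * Δ n - (k - l : ℕ) * Δ n = l * Δ n := by rw [e1]; ring
    have e3 : ((k + 1 : ℕ) : ℝ) * Δ n - k * Δ n = Δ n := by push_cast; ring
    have e4 : ((k + 1 : ℕ) : ℝ) * Δ n - (k - l : ℕ) * Δ n = l * Δ n + Δ n := by
      rw [e1]; push_cast; ring
    rw [e2, e3, max_eq_left hl0] at g1
    rw [e4, e3, max_eq_left hl1] at g2
    exact ⟨g1, g2⟩
  have hup : ∑ k ∈ Finset.Ico l n, β k ≤ (n - l) * (a (l * Δ n) * Δ n) := by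
    have := Finset.sum_le_card_nsmul _ _ _ fun k hk => (hgeom k hk).1
    rwa [nsmul_eq_mul, hcard] at this
  have hlow : (n - l) * (a (l * Δ n + Δ n) * Δ n) ≤ ∑ k ∈ Finset.Ico l n, β k := by
    have := Finset.card_nsmul_le_sum _ _ _ fun k hk => (hgeom k hk).2
    rwa [nsmul_eq_mul, hcard] at this
  have hmod : a (l * Δ n) - a (l * Δ n + Δ n) ≤ η / 2 := by
    have := huc (l * Δ n) ⟨hl0, by linarith⟩ (l * Δ n + Δ n) ⟨hl1, by linarith⟩ (by
      rw [Real.dist_eq]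
      simpa [abs_of_pos hpos] using h1)
    rw [Real.dist_eq, max_eq_left hl0, max_eq_left hl1] at this
    exact (le_abs_self _).trans this.le
  have ha1 : a (l * Δ n + Δ n) ≤ a 0 := ha.antitone (mem_Ici.2 le_rfl) (mem_Ici.2 hl1) hl1
  have ha2 : 0 ≤ a (l * Δ n) := ha.nonneg _ hl0
  have ha3 : 0 ≤ a (l * Δ n + Δ n) := ha.nonneg _ hl1
  have hnn : 2 * T * a 0 ≤ η * (n * Δ n) := by
    rw [div_le_iff₀ hη] at hnT2
    linarith
  rw [one_div_mul_eq_div, abs_le]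
  constructor
  · have : a (l * Δ n) - η ≤ (∑ k ∈ Finset.Ico l n, β k) / (n * Δ n) := by
      rw [le_div_iff₀ h4]
      have i1 : (l : ℝ) * Δ n * a (l * Δ n + Δ n) ≤ T * a 0 := by gcongr
      have i2 : (a (l * Δ n) - a (l * Δ n + Δ n)) * (n * Δ n) ≤ η / 2 * (n * Δ n) := by gcongr
      nlinarith
    linarith
  · have : (∑ k ∈ Finset.Ico l n, β k) / (n * Δ n) ≤ a (l * Δ n) := by
      rw [div_le_iff₀ h4]
      have : 0 ≤ (l : ℝ) * (a (l * Δ n) * Δ n) := by positivity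
      nlinarith
    linarith

theorem tendsto_rpow_neg_mul_moment {p c D : ℝ} (hp : 2 ≤ p) (hc : 0 ≤ c) :
    Tendsto (fun x : ℝ => x ^ (-p) * (D * (1 + c * x + (c * x) ^ (p / 2)))) atTop (𝓝 0) := by
  have h1 := (tendsto_rpow_neg_atTop (by linarith : 0 < p)).const_mul D
  have h2 := (tendsto_rpow_neg_atTop (by linarith : 0 < p - 1)).const_mul (D * c)
  have h3 := (tendsto_rpow_neg_atTop (by linarith : 0 < p / 2)).const_mul (D * c ^ (p / 2))
  have h := (h1.add h2).add h3
  simp only [mul_zero, add_zero] at h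
  refine h.congr' ?_
  filter_upwards [eventually_gt_atTop 0] with x hx
  have e1 : x ^ (-(p - 1)) = x ^ (-p) * x := by
    rw [← Real.rpow_add_one hx.ne']
    congr 1
    ring
  have e2 : x ^ (-(p / 2)) = x ^ (-p) * x ^ (p / 2) := by
    rw [← Real.rpow_add hx]
    congr 1
    ring
  rw [e1, e2, Real.mul_rpow hc hx.le]
  ring

theorem IsTrawlProcess.aemeasurable_aHat (hX : IsTrawlProcess P L a X)
    (hL : IsLevyBasis P γ b ν L) (ha : IsTrawlFunction a) {n : ℕ} (hΔ : Δ n ≠ 0) (l : ℕ) :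
    AEMeasurable (aHat X Δ n (l * Δ n)) P := by
  have h1 : AEMeasurable (fun ω => fun k : ℕ => X (k * Δ n) ω) P :=
    aemeasurable_pi_lambda _ fun k => hX.aemeasurable hL ha _
  have h2 := ((continuous_laggedSum n l).measurable.comp_aemeasurable h1).const_mul
    (-(1 / (n * Δ n)))
  refine h2.congr (ae_of_all _ fun ω => ?_)
  rw [aHat_eq_laggedSum X Δ hΔ]
  rfl

theorem IsTrawlProcess.eventually_lintegral_aHat_sub_le [IsProbabilityMeasure P]
    (hX : IsTrawlProcess P L a X) (hL : IsLevyBasis P γ b ν L)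
    (hm : HasMoments P L m (2 * p)) (hp : 2 ≤ p) (ha : IsTrawlFunction a)
    (hΔ : IsInfillLongSpan Δ) {T : ℝ} (hT : 0 < T) {ε : ℝ} (hε : 0 < ε) :
    ∀ᶠ n in atTop, ∀ l : ℕ, l * Δ n ≤ T →
      ∫⁻ ω, ENNReal.ofReal (|aHat X Δ n (l * Δ n) ω - a (l * Δ n)| ^ p) ∂P ≤
        ENNReal.ofReal ε := by
  have hp0 : 0 < p := by linarith
  obtain ⟨D, hD, hbound⟩ := hX.exists_laggedSum_moment_le hL hm hp ha
  have ha0 := ha.nonneg 0 le_rfl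
  set c := a 0 + 1 with hc
  set η := (ε / 2) ^ (1 / p) / 2 with hη
  have hη0 : 0 < η := by positivity
  have hηp : 2 ^ p * η ^ p = ε / 2 := by
    rw [← Real.mul_rpow (by norm_num) hη0.le, hη, mul_div_cancel₀ _ (by norm_num : (2 : ℝ) ≠ 0),
      ← Real.rpow_mul (by positivity), one_div_mul_cancel hp0.ne', Real.rpow_one]
  have hlim := (tendsto_rpow_neg_mul_moment (D := D) hp (by positivity : 0 ≤ c)).comp hΔ.longSpan
  have hε2 : 0 < ε / 2 / 2 ^ p := by positivity
  filter_upwards [ha.eventually_abs_mean_volume_sub_le hΔ hT hη0,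
    hlim.eventually (gt_mem_nhds hε2), hΔ.longSpan.eventually_ge_atTop T,
    eventually_gt_atTop 0] with n h1 h2 h3 hn l hl
  have hpos := hΔ.pos n
  have hn' : (0 : ℝ) < n := by exact_mod_cast hn
  have hln : l ≤ n := by
    have : (l : ℝ) * Δ n ≤ n * Δ n := hl.trans h3
    exact_mod_cast le_of_mul_le_mul_right this hpos
  have h1' := h1 l hl
  have hb := hbound n l (Δ n) hn hln hpos
  set W := ∑ k ∈ Finset.Ico l n,
      (volume ((trawlSetAt a ((k - l : ℕ) * Δ n) ∩ trawlSetAt a (k * Δ n)) \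
          trawlSetAt a ((k + 1 : ℕ) * Δ n))).toReal with hW
  set N := n * Δ n with hN
  have hN0 : 0 < N := by positivity
  have hpt : ∀ ω, ENNReal.ofReal (|aHat X Δ n (l * Δ n) ω - a (l * Δ n)| ^ p) ≤
      ENNReal.ofReal (2 ^ p * η ^ p) + ENNReal.ofReal (2 ^ p * N ^ (-p)) *
        ENNReal.ofReal (|laggedSum n l (fun k => X (k * Δ n) ω) + W| ^ p) := fun ω => by
    rw [← ENNReal.ofReal_mul (by positivity), ← ENNReal.ofReal_add (by positivity) (by positivity)]
    refine ENNReal.ofReal_le_ofReal ?_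
    rw [aHat_eq_laggedSum X Δ hpos.ne']
    have e : -(1 / N) * laggedSum n l (fun k => X (k * Δ n) ω) - a (l * Δ n) =
        (1 / N * W - a (l * Δ n)) - 1 / N * (laggedSum n l (fun k => X (k * Δ n) ω) + W) := by
      ring
    rw [e]
    refine (abs_sub_rpow_le _ _ hp0.le).trans ?_
    rw [mul_add, mul_assoc (2 ^ p)]
    have e2 : |1 / N * (laggedSum n l (fun k => X (k * Δ n) ω) + W)| ^ p =
        N ^ (-p) * |laggedSum n l (fun k => X (k * Δ n) ω) + W| ^ p := by
      rw [abs_mul, Real.mul_rpow (abs_nonneg _) (abs_nonneg _), abs_of_pos (by positivity),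
        one_div, Real.inv_rpow hN0.le, ← Real.rpow_neg hN0.le]
    rw [e2]
    gcongr
  refine (lintegral_mono hpt).trans ?_
  rw [lintegral_add_left measurable_const, lintegral_const, measure_univ, mul_one,
    lintegral_const_mul' _ _ ENNReal.ofReal_ne_top]
  refine (add_le_add_right (mul_le_mul_right hb _) _).trans ?_
  rw [← ENNReal.ofReal_mul (by positivity), ← ENNReal.ofReal_add (by positivity) (by positivity)]
  refine ENNReal.ofReal_le_ofReal ?_
  have h2' : 2 ^ p * (N ^ (-p) * (D * (1 + c * N + (c * N) ^ (p / 2)))) ≤ ε / 2 := by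
    have := h2.le
    simp only [Function.comp, ← hN] at this
    rw [le_div_iff₀ (by positivity)] at this
    linarith
  have e3 : (n : ℝ) * (c * Δ n) = c * N := by rw [hN]; ring
  rw [hηp, e3]
  linarith

/-! ### Deterministic estimates -/

theorem exists_abs_sub_le_of_polyGrowth {g : ℝ → ℝ} (hg : Continuous g) {q p : ℝ} (hq : 0 ≤ q)
    (hqp : q ≤ p) (hgq : PolyGrowth g q) {A : ℝ} (hA : 0 ≤ A) {ε : ℝ} (hε : 0 < ε) :
    ∃ C, 0 ≤ C ∧ ∀ x ∈ Icc 0 A, ∀ y, |g y - g x| ≤ ε + C * |y - x| ^ p := by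
  obtain ⟨C, hC, hgC⟩ := hgq
  have huc : UniformContinuousOn g (Icc (-1) (A + 1)) :=
    isCompact_Icc.uniformContinuousOn_of_continuous hg.continuousOn
  rw [Metric.uniformContinuousOn_iff] at huc
  obtain ⟨d0, hd0, huc⟩ := huc ε hε
  set d := min d0 1 with hd
  have hdpos : 0 < d := lt_min hd0 one_pos
  have hd1 : d ≤ 1 := min_le_right _ _
  have hp : 0 ≤ p := hq.trans hqp
  set κ := d + A with hκ
  have hκ0 : 0 ≤ κ := by positivity
  refine ⟨C * ((1 + κ ^ q) + (1 + A ^ q)) * d⁻¹ ^ p, by positivity, fun x hx y => ?_⟩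
  rcases lt_or_ge |y - x| d with h | h
  · have hxy := abs_lt.1 (h.trans_le hd1)
    have hy : y ∈ Icc (-1) (A + 1) := ⟨by linarith [hx.1], by linarith [hx.2]⟩
    have hx' : x ∈ Icc (-1) (A + 1) := ⟨by linarith [hx.1], by linarith [hx.2]⟩
    have := huc y hy x hx' (by rw [Real.dist_eq]; exact h.trans_le (min_le_left _ _))
    rw [Real.dist_eq] at this
    have h0 : 0 ≤ C * ((1 + κ ^ q) + (1 + A ^ q)) * d⁻¹ ^ p * |y - x| ^ p := by positivity
    linarith
  · set u := d⁻¹ * |y - x| with hu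
    have hu1 : 1 ≤ u := by
      rw [hu, inv_mul_eq_div, le_div_iff₀ hdpos]
      linarith
    have hup : d⁻¹ ^ p * |y - x| ^ p = u ^ p :=
      (Real.mul_rpow (by positivity) (abs_nonneg _)).symm
    have hup1 : 1 ≤ u ^ p := Real.one_le_rpow hu1 hp
    have huq : u ^ q ≤ u ^ p := Real.rpow_le_rpow_of_exponent_le hu1 hqp
    have hyu : |y| ≤ κ * u := by
      have h1 : |y| ≤ |y - x| + |x| := by
        have := abs_add_le (y - x) x
        rwa [sub_add_cancel] at this
      have h2 : |x| ≤ A := by rw [abs_of_nonneg hx.1]; exact hx.2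
      have h3 : |y - x| = d * u := by rw [hu]; field_simp
      rw [hκ]
      nlinarith
    have hyq : |y| ^ q ≤ κ ^ q * u ^ p := by
      refine (Real.rpow_le_rpow (abs_nonneg y) hyu hq).trans ?_
      rw [Real.mul_rpow hκ0 (by linarith)]
      gcongr
    have hxq : |x| ^ q ≤ A ^ q * u ^ p := by
      rw [abs_of_nonneg hx.1]
      have h1 : x ^ q ≤ A ^ q := Real.rpow_le_rpow hx.1 hx.2 hq
      have h2 : 0 ≤ A ^ q := by positivity
      nlinarith
    have b1 : |g y| ≤ C * ((1 + κ ^ q) * u ^ p) := by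
      refine (hgC y).trans ?_
      gcongr
      linarith
    have b2 : |g x| ≤ C * ((1 + A ^ q) * u ^ p) := by
      refine (hgC x).trans ?_
      gcongr
      linarith
    have b3 := abs_sub (g y) (g x)
    rw [mul_assoc _ (d⁻¹ ^ p), hup]
    nlinarith

theorem eventually_abs_riemann_sub_le {h : ℝ → ℝ} (hh : Continuous h) (hΔ : IsInfillLongSpan Δ)
    {T : ℝ} (hT : 0 < T) {ε : ℝ} (hε : 0 < ε) :
    ∀ᶠ n in atTop, ∀ t ∈ Icc 0 T,
      |Δ n * ∑ l ∈ Finset.range ⌊t / Δ n⌋₊, h (l * Δ n) - ∫ s in (0 : ℝ)..t, h s| ≤ ε := by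
  have huc : UniformContinuousOn h (Icc 0 T) :=
    isCompact_Icc.uniformContinuousOn_of_continuous hh.continuousOn
  rw [Metric.uniformContinuousOn_iff] at huc
  obtain ⟨d, hd, huc⟩ := huc (ε / 2 / T) (by positivity)
  obtain ⟨G, hG⟩ := isCompact_Icc.exists_bound_of_continuousOn (s := Icc 0 T) hh.continuousOn
  have hG0 : 0 ≤ G := (norm_nonneg _).trans (hG 0 ⟨le_rfl, hT.le⟩)
  have hG1 : 0 < ε / 2 / (G + 1) := by positivity
  filter_upwards [hΔ.infill.eventually (gt_mem_nhds hd), hΔ.infill.eventually (gt_mem_nhds hG1)]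
    with n h1 h2 t ht
  have hpos := hΔ.pos n
  set M := ⌊t / Δ n⌋₊ with hM
  have hMt : M * Δ n ≤ t := by
    have := Nat.floor_le (div_nonneg ht.1 hpos.le)
    rwa [le_div_iff₀ hpos] at this
  have htM : t < M * Δ n + Δ n := by
    have := Nat.lt_floor_add_one (t / Δ n)
    rw [div_lt_iff₀ hpos] at this
    linarith
  have hint : ∀ x y, IntervalIntegrable h volume x y := fun x y => hh.intervalIntegrable x y
  have hsplit : ∫ s in (0 : ℝ)..t, h s = ∑ l ∈ Finset.range M,
      (∫ s in (l * Δ n)..((l + 1 : ℕ) * Δ n), h s) + ∫ s in (M * Δ n)..t, h s := by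
    rw [intervalIntegral.sum_integral_adjacent_intervals (a := fun l : ℕ => (l : ℝ) * Δ n)
      fun k _ => hint _ _]
    simp only [Nat.cast_zero, zero_mul]
    exact (intervalIntegral.integral_add_adjacent_intervals (hint _ _) (hint _ _)).symm
  have hcell : ∀ l ∈ Finset.range M,
      |Δ n * h (l * Δ n) - ∫ s in (l * Δ n)..((l + 1 : ℕ) * Δ n), h s| ≤
        ε / 2 / T * Δ n := fun l hl => by
    have hlM : ((l + 1 : ℕ) : ℝ) ≤ M := by exact_mod_cast Finset.mem_range.1 hl
    have hlM' : ((l + 1 : ℕ) : ℝ) * Δ n ≤ M * Δ n := by gcongr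
    have e0 : ((l + 1 : ℕ) : ℝ) * Δ n = l * Δ n + Δ n := by push_cast; ring
    have e : Δ n * h (l * Δ n) - ∫ s in (l * Δ n)..((l + 1 : ℕ) * Δ n), h s =
        ∫ s in (l * Δ n)..((l + 1 : ℕ) * Δ n), (h (l * Δ n) - h s) := by
      rw [intervalIntegral.integral_sub intervalIntegrable_const (hint _ _),
        intervalIntegral.integral_const, smul_eq_mul]
      congr 2
      rw [e0]
      ring
    rw [e, ← Real.norm_eq_abs]
    have := intervalIntegral.norm_integral_le_of_norm_le_const (a := l * Δ n)
      (b := (l + 1 : ℕ) * Δ n) (f := fun s => h (l * Δ n) - h s) (C := ε / 2 / T) fun s hs => by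
        rw [uIoc_of_le (by rw [e0]; linarith)] at hs
        have l0 : 0 ≤ l * Δ n := by positivity
        have hs1 := hs.1
        have hs2 := hs.2
        have hd' := huc (l * Δ n) ⟨l0, by linarith [ht.2]⟩ s ⟨by linarith, by linarith [ht.2]⟩ (by
          rw [Real.dist_eq, abs_lt]
          constructor <;> linarith)
        rw [Real.dist_eq] at hd'
        exact hd'.le
    refine this.trans (le_of_eq ?_)
    rw [e0, add_sub_cancel_left, abs_of_pos hpos]
  have hlast : |∫ s in (M * Δ n)..t, h s| ≤ ε / 2 := by
    have := intervalIntegral.norm_integral_le_of_norm_le_const (a := M * Δ n)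
      (b := t) (f := h) (C := G) fun s hs => by
        rw [uIoc_of_le hMt] at hs
        have l0 : 0 ≤ M * Δ n := by positivity
        exact hG s ⟨by linarith [hs.1], hs.2.trans ht.2⟩
    rw [Real.norm_eq_abs, abs_of_nonneg (by linarith : 0 ≤ t - M * Δ n)] at this
    refine this.trans ?_
    rw [lt_div_iff₀ (by positivity)] at h2
    nlinarith
  have hsum : |∑ l ∈ Finset.range M,
      (Δ n * h (l * Δ n) - ∫ s in (l * Δ n)..((l + 1 : ℕ) * Δ n), h s)| ≤ ε / 2 := by
    refine (Finset.abs_sum_le_sum_abs _ _).trans ((Finset.sum_le_card_nsmul _ _ _ hcell).trans ?_)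
    rw [Finset.card_range, nsmul_eq_mul]
    calc (M : ℝ) * (ε / 2 / T * Δ n) = ε / 2 / T * (M * Δ n) := by ring
      _ ≤ ε / 2 / T * T := by
          gcongr
          exact hMt.trans ht.2
      _ = ε / 2 := by field_simp
  have e : Δ n * ∑ l ∈ Finset.range M, h (l * Δ n) - ∫ s in (0 : ℝ)..t, h s =
      ∑ l ∈ Finset.range M, (Δ n * h (l * Δ n) - ∫ s in (l * Δ n)..((l + 1 : ℕ) * Δ n), h s) -
        ∫ s in (M * Δ n)..t, h s := by
    rw [hsplit, Finset.sum_sub_distrib, Finset.mul_sum]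
    ring
  rw [e]
  refine (abs_sub _ _).trans ?_
  linarith

/-! ### Convergence of the functionals -/

theorem eventually_abs_PsiHat_sub_Psi_le {Ω : Type*} {g : ℝ → ℝ} (hg : Continuous g) {q p : ℝ} (hq : 0 ≤ q)
    (hqp : q ≤ p) (hgq : PolyGrowth g q) (ha : IsTrawlFunction a) (hΔ : IsInfillLongSpan Δ)
    (X : ℝ → Ω → ℝ) {T : ℝ} (hT : 0 < T) {ε : ℝ} (hε : 0 < ε) :
    ∃ C, 0 < C ∧ ∀ᶠ n in atTop, ∀ ω, ∀ t ∈ Icc 0 T, |PsiHat X Δ g n t ω - Psi a g t| ≤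
      ε + C * (Δ n * ∑ l ∈ Finset.range ⌊T / Δ n⌋₊,
        |aHat X Δ n (l * Δ n) ω - a (l * Δ n)| ^ p) := by
  have ha0 := ha.nonneg 0 le_rfl
  obtain ⟨C, hC, hgC⟩ := exists_abs_sub_le_of_polyGrowth hg hq hqp hgq ha0
    (by positivity : 0 < ε / 2 / T)
  refine ⟨C + 1, by positivity, ?_⟩
  filter_upwards [eventually_abs_riemann_sub_le (hg.comp ha.continuous_ext) hΔ hT
    (by positivity : 0 < ε / 2)] with n hR ω t ht
  have hpos := hΔ.pos n
  have hPsi : Psi a g t = ∫ s in (0 : ℝ)..t, (g ∘ fun s => a (max s 0)) s := by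
    refine intervalIntegral.integral_congr fun s hs => ?_
    rw [uIcc_of_le ht.1] at hs
    simp [max_eq_left hs.1]
  have hR' := hR t ht
  rw [← hPsi] at hR'
  have hnode : ∀ l : ℕ, (g ∘ fun s => a (max s 0)) (l * Δ n) = g (a (l * Δ n)) := fun l => by
    have : 0 ≤ l * Δ n := by positivity
    simp [max_eq_left this]
  simp only [hnode] at hR'
  set M := ⌊t / Δ n⌋₊ with hM
  set e : ℕ → ℝ := fun l => |aHat X Δ n (l * Δ n) ω - a (l * Δ n)| ^ p with he
  have hMM : M ≤ ⌊T / Δ n⌋₊ := Nat.floor_le_floor (div_le_div_of_nonneg_right ht.2 hpos.le)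
  have hMT : M * Δ n ≤ T := by
    have := Nat.floor_le (div_nonneg ht.1 hpos.le)
    rw [le_div_iff₀ hpos] at this
    exact this.trans ht.2
  have hdiff : |PsiHat X Δ g n t ω - Δ n * ∑ l ∈ Finset.range M, g (a (l * Δ n))| ≤
      ε / 2 + C * (Δ n * ∑ l ∈ Finset.range ⌊T / Δ n⌋₊, e l) := by
    unfold PsiHat
    rw [← mul_sub, ← Finset.sum_sub_distrib, abs_mul, abs_of_pos hpos]
    have h1 : |∑ l ∈ Finset.range M, (g (aHat X Δ n (l * Δ n) ω) - g (a (l * Δ n)))| ≤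
        ∑ l ∈ Finset.range M, (ε / 2 / T + C * e l) := by
      refine (Finset.abs_sum_le_sum_abs _ _).trans (Finset.sum_le_sum fun l _ => ?_)
      have l0 : 0 ≤ l * Δ n := by positivity
      exact hgC _ ⟨ha.nonneg _ l0, ha.antitone (mem_Ici.2 le_rfl) (mem_Ici.2 l0) l0⟩ _
    have h2 : ∑ l ∈ Finset.range M, e l ≤ ∑ l ∈ Finset.range ⌊T / Δ n⌋₊, e l :=
      Finset.sum_le_sum_of_subset_of_nonneg (Finset.range_mono hMM) fun l _ _ => by positivity
    rw [Finset.sum_add_distrib, ← Finset.mul_sum, Finset.sum_const, Finset.card_range,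
      nsmul_eq_mul] at h1
    calc Δ n * |∑ l ∈ Finset.range M, (g (aHat X Δ n (l * Δ n) ω) - g (a (l * Δ n)))|
        ≤ Δ n * (M * (ε / 2 / T) + C * ∑ l ∈ Finset.range ⌊T / Δ n⌋₊, e l) := by
          gcongr
          exact h1.trans (by gcongr)
      _ = ε / 2 / T * (M * Δ n) + C * (Δ n * ∑ l ∈ Finset.range ⌊T / Δ n⌋₊, e l) := by ring
      _ ≤ ε / 2 / T * T + C * (Δ n * ∑ l ∈ Finset.range ⌊T / Δ n⌋₊, e l) := by gcongr
      _ = _ := by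
          congr 1
          field_simp
  have hQ : 0 ≤ Δ n * ∑ l ∈ Finset.range ⌊T / Δ n⌋₊, e l :=
    mul_nonneg hpos.le (Finset.sum_nonneg fun l _ => by positivity)
  have h3 := abs_add_le (PsiHat X Δ g n t ω - Δ n * ∑ l ∈ Finset.range M, g (a (l * Δ n)))
    (Δ n * ∑ l ∈ Finset.range M, g (a (l * Δ n)) - Psi a g t)
  rw [sub_add_sub_cancel] at h3
  linarith

theorem IsTrawlProcess.tendsto_lintegral_error [IsProbabilityMeasure P]
    (hX : IsTrawlProcess P L a X) (hL : IsLevyBasis P γ b ν L)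
    (hm : HasMoments P L m (2 * p)) (hp : 2 ≤ p) (ha : IsTrawlFunction a)
    (hΔ : IsInfillLongSpan Δ) {T : ℝ} (hT : 0 < T) :
    Tendsto (fun n => ∫⁻ ω, ENNReal.ofReal (Δ n * ∑ l ∈ Finset.range ⌊T / Δ n⌋₊,
        |aHat X Δ n (l * Δ n) ω - a (l * Δ n)| ^ p) ∂P) atTop (𝓝 0) := by
  rw [ENNReal.tendsto_nhds_zero]
  intro ε hε
  obtain ⟨r, hr0, hr⟩ := ENNReal.lt_iff_exists_nnreal_btwn.1 hε
  have hr0' : (0 : ℝ) < r := by exact_mod_cast hr0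
  filter_upwards [hX.eventually_lintegral_aHat_sub_le hL hm hp ha hΔ hT
    (by positivity : 0 < (r : ℝ) / T)] with n hn
  have hpos := hΔ.pos n
  refine le_trans ?_ hr.le
  set M := ⌊T / Δ n⌋₊ with hM
  have hMT : M * Δ n ≤ T := by
    have := Nat.floor_le (div_nonneg hT.le hpos.le)
    rwa [le_div_iff₀ hpos] at this
  have hme : ∀ l : ℕ, AEMeasurable (fun ω =>
      ENNReal.ofReal (|aHat X Δ n (l * Δ n) ω - a (l * Δ n)| ^ p)) P := fun l => by
    have := hX.aemeasurable_aHat hL ha hpos.ne' l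
    fun_prop
  have e : ∀ ω, ENNReal.ofReal (Δ n * ∑ l ∈ Finset.range M,
      |aHat X Δ n (l * Δ n) ω - a (l * Δ n)| ^ p) = ENNReal.ofReal (Δ n) *
        ∑ l ∈ Finset.range M, ENNReal.ofReal (|aHat X Δ n (l * Δ n) ω - a (l * Δ n)| ^ p) :=
    fun ω => by
      rw [ENNReal.ofReal_mul hpos.le, ENNReal.ofReal_sum_of_nonneg fun l _ => by positivity]
  simp_rw [e]
  rw [lintegral_const_mul' _ _ ENNReal.ofReal_ne_top, lintegral_finsetSum' _ fun l _ => hme l]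
  have hsum : ∑ l ∈ Finset.range M, ∫⁻ ω,
      ENNReal.ofReal (|aHat X Δ n (l * Δ n) ω - a (l * Δ n)| ^ p) ∂P ≤
      M * ENNReal.ofReal (r / T) := by
    have := Finset.sum_le_card_nsmul (Finset.range M) (fun l : ℕ => ∫⁻ ω,
      ENNReal.ofReal (|aHat X Δ n (l * Δ n) ω - a (l * Δ n)| ^ p) ∂P) (ENNReal.ofReal (r / T))
      fun l hl => hn l (le_trans (by
        have : (l : ℝ) ≤ M := by exact_mod_cast (Finset.mem_range.1 hl).le
        gcongr) hMT)
    simpa using this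
  refine (mul_le_mul_right hsum _).trans ?_
  rw [← ENNReal.ofReal_natCast, ← ENNReal.ofReal_mul (by positivity),
    ← ENNReal.ofReal_mul hpos.le, ← ENNReal.ofReal_coe_nnreal]
  refine ENNReal.ofReal_le_ofReal ?_
  calc Δ n * (M * (r / T)) = (M * Δ n) * (r / T) := by ring
    _ ≤ T * (r / T) := by gcongr
    _ = r := by field_simp

end Trawl

theorem theorem1 {Ω : Type*} [MeasurableSpace Ω] (P : Measure Ω) [IsProbabilityMeasure P]
    -- homogeneous Lévy basis with triplet `(γ, b, ν)`, and the law `seed` of its Lévy seed `L'`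
    (γ b : ℝ) (ν : Measure ℝ) (L : Set (ℝ × ℝ) → Ω → ℝ) (hL : Trawl.IsLevyBasis P γ b ν L)
    (seed : Measure ℝ) (hseed : Trawl.IsSeedLaw γ b ν seed) (hvar : variance id seed = 1)
    -- trawl function and trawl process
    (a : ℝ → ℝ) (ha : Trawl.IsTrawlFunction a)
    (X : ℝ → Ω → ℝ) (hX : Trawl.IsTrawlProcess P L a X)
    -- sampling scheme
    (Δ : ℕ → ℝ) (hΔ : Trawl.IsInfillLongSpan Δ)
    -- test function
    (g : ℝ → ℝ) (hg : Continuous g) (q : ℝ) (hq : 0 ≤ q) (hgq : Trawl.PolyGrowth g q)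
    -- `E|L'|^{2q ∨ 4} < ∞`
    (hmom : Integrable (fun x : ℝ => |x| ^ (max (2 * q) 4)) seed) :
    Trawl.TendstoUCP P (Trawl.PsiHat X Δ g) (fun t _ => Trawl.Psi a g t) := by
  set p := max q 2 with hp
  have hp2 : 2 ≤ p := le_max_right q 2
  have h2p : max (2 * q) 4 = 2 * p := by
    rw [hp, mul_max_of_nonneg _ _ (by norm_num : (0 : ℝ) ≤ 2)]
    norm_num
  rw [h2p] at hmom
  obtain ⟨m, hm⟩ := hL.exists_hasMoments hseed hvar (by linarith : 2 ≤ 2 * p) hmom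
  intro T hT ε hε
  obtain ⟨r, hr0, hrε⟩ := ENNReal.lt_iff_exists_nnreal_btwn.1 hε
  have hr : (0 : ℝ) < r := by exact_mod_cast hr0
  obtain ⟨C, hC, hev⟩ := Trawl.eventually_abs_PsiHat_sub_Psi_le hg hq (le_max_left q 2) hgq ha hΔ X
    hT (by positivity : 0 < (r : ℝ) / 2)
  have hlim := hX.tendsto_lintegral_error hL hm hp2 ha hΔ hT
  set θ : ℝ := r / 2 / C with hθ
  have hθ0 : 0 < θ := by positivity
  have hlim2 := ENNReal.Tendsto.div_const hlim
    (Or.inr (by simpa using hθ0 : ENNReal.ofReal θ ≠ 0))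
  rw [ENNReal.zero_div] at hlim2
  refine tendsto_of_tendsto_of_tendsto_of_le_of_le' tendsto_const_nhds hlim2
    (Eventually.of_forall fun n => zero_le) ?_
  filter_upwards [hev] with n hn
  have hpos := hΔ.pos n
  set Q : Ω → ℝ := fun ω => Δ n * ∑ l ∈ Finset.range ⌊T / Δ n⌋₊,
        |Trawl.aHat X Δ n (l * Δ n) ω - a (l * Δ n)| ^ p with hQ
  have hQm : AEMeasurable (fun ω => ENNReal.ofReal (Q ω)) P := by
    refine ENNReal.measurable_ofReal.comp_aemeasurable (AEMeasurable.const_mul ?_ _)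
    refine Finset.aemeasurable_fun_sum _ fun l _ => ?_
    have := hX.aemeasurable_aHat hL ha hpos.ne' l
    fun_prop
  refine le_trans (measure_mono fun ω hω => ?_)
    (meas_ge_le_lintegral_div hQm (by simpa using hθ0) ENNReal.ofReal_ne_top)
  have hsup : ⨆ t ∈ Icc (0 : ℝ) T, edist (Trawl.PsiHat X Δ g n t ω) (Trawl.Psi a g t) ≤
      ENNReal.ofReal (r / 2 + C * Q ω) := by
    refine iSup₂_le fun t ht => ?_
    rw [edist_dist, Real.dist_eq]
    exact ENNReal.ofReal_le_ofReal (hn ω t ht)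
  have h1 : ENNReal.ofReal (r : ℝ) ≤ ENNReal.ofReal (r / 2 + C * Q ω) := by
    rw [ENNReal.ofReal_coe_nnreal]
    exact hrε.le.trans (le_trans hω hsup)
  have hQ0 : 0 ≤ Q ω := mul_nonneg hpos.le (Finset.sum_nonneg fun l _ => by positivity)
  rw [ENNReal.ofReal_le_ofReal_iff (by positivity)] at h1
  refine ENNReal.ofReal_le_ofReal ?_
  rw [hθ, div_le_iff₀ hC]
  linarith
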